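/- A container of a triangle $\Delta\subset\mathbb R^2$ is an isosceles (nondegenerate) triangle $\Delta'\supseteq\Delta$; a minimum-perimeter isosceles container is one of least possible perimeter. Label the vertices of $\Delta$ by $A,B,C$ so that $|BC|\le|AC|\le|AB|$, and consider the following five types of isosceles containers of $\Delta$. (1) $AB'C$, where $B'$ lies on the ray $\overrightarrow{CB}$ and $|B'C|=|AC|$. (2) $ABC'$, where $C'$ lies on the ray $\overrightarrow{AC}$ and $|AC'|=|AB|$. (3) $AB\overline{C}$, where $\overline{C}$ is the intersection of the line $BC$ with the perpendicular bisector of $AB$. (4) If $ABC$ is acute: $ARS$, where $|AR|=|RS|$, the apex angle $\sphericalangle ARS$ is $$\gamma^*=4\tan^{-1}\Bigl(\tfrac12\bigl(1+\sqrt5-\sqrt{2(1+\sqrt5)}\bigr)\Bigr)\approx 76.3466^\circ,$$ and $B$, $C$ both lie in the relative interior of the side $RS$ (such a triangle exists only for some $\Delta$). (5) If, after a similarity of the plane, $A=(0,0)$, $C=(1,v)$ and $B=(x_b,0)$ with $0<v<\sqrt3$ and $1<x_b<x_v^*$, where $x_v^*$ is the minimum point on the interval $(1,2)$ of $f_v(x)=x\Bigl(1+\sqrt{1+\frac{v^2}{(1-x)^2}}\Bigr)$: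 the triangle $ARS$ with $S=(x_v^*,0)$, $R$ on the ray $\overrightarrow{SC}$ and $|AR|=|RS|$. Then: (a) For each of the types (4) and (5) there is an infinite family of pairwise non-similar triangles $\Delta$ such that every minimum-perimeter isosceles container of $\Delta$ is of that type and has no side in common with $\Delta$ (in particular, it does not share a side, and an angle at an end of that side, with $\Delta$). (b) Every triangle has a minimum-perimeter isosceles container of one of the five types. (c) All triangles of the five types are isosceles containers of $\Delta$. Those of types (1), (2), (3) share with $\Delta$ a side and the angle at one of the endpoints of this side; those of types (4) and (5) never do. (d) Each of the five types is realized: for each of them there is a scalene triangle $\Delta$ with exactly one minimum-perimeter isosceles container, and that container is of this type. -/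

import Mathlib

namespace IsoContainer

/-- The Euclidean plane. -/
abbrev Plane : Type := EuclideanSpace ℝ (Fin 2)

/-- A nondegenerate triangle in the plane (three affinely independent, labelled vertices). -/
abbrev Tri : Type := Affine.Triangle ℝ Plane

/-- The set of vertices. -/
def verts (T : Tri) : Set Plane := Set.range T.points

/-- The perimeter. -/
noncomputable def per (T : Tri) : ℝ :=
  dist (T.points 0) (T.points 1) + dist (T.points 1) (T.points 2) +
    dist (T.points 2) (T.points 0)

/-- At least two of the sides have the same length. -/
def IsIsosceles (T : Tri) : Prop :=
  ∃ P R S : Plane, verts T = {P, R, S} ∧ dist P R = dist R S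

/-- `T'` is an isosceles triangle containing the (closed, filled) triangle `T`. -/
def IsContainer (T T' : Tri) : Prop :=
  IsIsosceles T' ∧ T.closedInterior ⊆ T'.closedInterior

/-- `T'` is a minimum perimeter isosceles container of `T`. -/
def IsMinContainer (T T' : Tri) : Prop :=
  IsContainer T T' ∧ ∀ T'' : Tri, IsContainer T T'' → per T' ≤ per T''

/-- The two triangles have a side in common. -/
def SharesSide (T T' : Tri) : Prop :=
  ∃ X Y : Plane, X ≠ Y ∧ X ∈ verts T ∧ Y ∈ verts T ∧ X ∈ verts T' ∧ Y ∈ verts T'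

/-- The two triangles have a side `XY` in common, and they have the same angle at its
endpoint `X`. -/
def SharesSideAndAngle (T T' : Tri) : Prop :=
  ∃ X Y Z Z' : Plane, verts T = {X, Y, Z} ∧ verts T' = {X, Y, Z'} ∧
    EuclideanGeometry.angle Y X Z = EuclideanGeometry.angle Y X Z'

/-- `A`, `B`, `C` are the vertices of `T`, named so that `|BC| ≤ |AC| ≤ |AB|`. -/
def IsLabelling (T : Tri) (A B C : Plane) : Prop :=
  verts T = {A, B, C} ∧ dist B C ≤ dist A C ∧ dist A C ≤ dist A B

/-- For `X ≠ Y`: the point `Z` lies on the ray from `X` through `Y`. -/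
def OnRay (X Y Z : Plane) : Prop :=
  ∃ t : ℝ, 0 ≤ t ∧ Z = AffineMap.lineMap X Y t

/-- The apex angle `γ* ≈ 76.3466°`. -/
noncomputable def gammaStar : ℝ :=
  4 * Real.arctan ((1 + √5 - √(2 * (1 + √5))) / 2)

/-- The perimeter of the isosceles triangle with base from `(0, 0)` to `(x, 0)` one of whose
legs lies on the line through `(x, 0)` and `(1, v)`. -/
noncomputable def perimFun (v x : ℝ) : ℝ :=
  x * (1 + √(1 + v ^ 2 / (1 - x) ^ 2))

/-- The names of the five types of containers. -/
inductive Kind : Type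
  | ABpC
  | ABCp
  | ABCbar
  | gammaStarType
  | xStarType

/-- The three special types. -/
def Kind.IsSpecial : Kind → Prop
  | .ABpC => True
  | .ABCp => True
  | .ABCbar => True
  | .gammaStarType => False
  | .xStarType => False

/-- The triangle `AB'C`: `B'` is on the ray `CB` and `|B'C| = |AC|`. -/
def IsABpC (A B C : Plane) (T' : Tri) : Prop :=
  ∃ B' : Plane, OnRay C B B' ∧ dist B' C = dist A C ∧ verts T' = {A, B', C}

/-- The triangle `ABC'`: `C'` is on the ray `AC` and `|AC'| = |AB|`. -/
def IsABCp (A B C : Plane) (T' : Tri) : Prop :=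
  ∃ C' : Plane, OnRay A C C' ∧ dist A C' = dist A B ∧ verts T' = {A, B, C'}

/-- The triangle `ABC̄`: `C̄` is the intersection of the line `BC` and the perpendicular bisector
of `AB`. -/
def IsABCbar (A B C : Plane) (T' : Tri) : Prop :=
  ∃ Cb : Plane, Cb ∈ line[ℝ, B, C] ∧ Cb ∈ AffineSubspace.perpBisector A B ∧
    verts T' = {A, B, Cb}

/-- The first non-special type, for an acute triangle `ABC`: the triangle `ARS` with
`|AR| = |RS|` and apex angle `γ*` at `R`, such that `B` and `C` are in the interior of
the side `RS`. -/
def IsGammaStarType (A B C : Plane) (T' : Tri) : Prop :=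
  EuclideanGeometry.angle B A C < Real.pi / 2 ∧
  EuclideanGeometry.angle A B C < Real.pi / 2 ∧
  EuclideanGeometry.angle A C B < Real.pi / 2 ∧
  ∃ R S : Plane, verts T' = {A, R, S} ∧ dist A R = dist R S ∧
    EuclideanGeometry.angle A R S = gammaStar ∧ Sbtw ℝ R B S ∧ Sbtw ℝ R C S

/-- The second non-special type: up to a similarity `φ` of the plane, `A = (0, 0)`, `C = (1, v)`
and `B = (x_b, 0)` with `1 < x_b < x*`, where `x*` is the minimum point of `perimFun v` in `(1, 2)`;
the container is `ARS` with `S = (x*, 0)`, where `R` is on the ray `SC` and `|AR| = |RS|`. -/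
def IsXStarType (A B C : Plane) (T' : Tri) : Prop :=
  ∃ (φ : Plane ≃ᵈ Plane) (v xb xs : ℝ) (R S : Plane),
    0 < v ∧ v < √3 ∧ 1 < xb ∧ xb < xs ∧ xs < 2 ∧ IsMinOn (perimFun v) (Set.Ioo 1 2) xs ∧
    φ A = !₂[0, 0] ∧ φ C = !₂[1, v] ∧ φ B = !₂[xb, 0] ∧ φ S = !₂[xs, 0] ∧
    OnRay S C R ∧ dist A R = dist R S ∧ verts T' = {A, R, S}

/-- `T'` is a container of `T` of the given type. -/
def IsOfKind (k : Kind) (T T' : Tri) : Prop :=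
  ∃ A B C : Plane, IsLabelling T A B C ∧
    match k with
    | .ABpC => IsABpC A B C T'
    | .ABCp => IsABCp A B C T'
    | .ABCbar => IsABCbar A B C T'
    | .gammaStarType => IsGammaStarType A B C T'
    | .xStarType => IsXStarType A B C T'

/-- The triangles are similar, in some order of the vertices. -/
def AreSimilar (T₁ T₂ : Tri) : Prop :=
  ∃ σ : Equiv.Perm (Fin 3), Similar T₁.points (T₂.points ∘ σ)

end IsoContainer

open IsoContainer

namespace IsoContainer

/-! Existence of a minimum is compactness: a container of bounded perimeter has its vertices in a
fixed ball, and containing given points is a closed condition.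

To classify the minima, put the container in standard position, with base from `(0, 0)` to `(s, 0)`
and base angles of cosine `c` and sine `k`; its perimeter is `s * (1 + c) / c`. For any base
direction and any base angle, three support lines of the triangle bound an isosceles competitor
(`IsMin.le_upright`, `IsMin.le_rotated`). With the angles kept, pushing a side inwards shows that
every side carries a vertex of the triangle. Turning the three support lines together by `t` changes
the width `s * k` to `cos t * (s * k) + sin t * D`, where `D` depends on the contact points. With a
single contact on each side one `D` serves both directions of rotation, and since `cos t < 1` one of
them shortens the perimeter. Hence some side contains two vertices (`Opt.flush`).

The rest of the classification is a case analysis on that side. Its tools are competitors having a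
side of the triangle as a leg (`IsMin.le_apex`) and one-parameter families in which a leg pivots.
Two families have genuine stationary points. If a leg pivots about its contact point while the base
line is fixed, stationarity puts the contact at abscissa `s * c` (`Opt.stationary_leg`), the minimum
of `perimFun`. If the line of a leg and the opposite base vertex are fixed, it gives `c ^ 2 + c = 1`
(`Opt.golden_of_leg`), the angle `gammaStar`. All other positions have a side of the triangle as a
leg or as the base. This is `Outcome`; comparing side lengths then discards the wrong labellings and
leaves the five types (`IsMinContainer.exists_kind`).

For realization, a minimum exists and is of one of the five types, so it is enough to exclude four
of them for a concrete triangle, by perimeter or by a violated necessary condition. The infinite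
families move one vertex along a line and are separated by the similarity invariant `shape`. -/

/-! ### Coordinates, convex combinations and vertex sets -/

theorem dist_coord (A B : Plane) : dist A B = √((A 0 - B 0) ^ 2 + (A 1 - B 1) ^ 2) := by
  simp [EuclideanSpace.dist_eq, Real.dist_eq]

theorem dist_sq_coord (A B : Plane) : dist A B ^ 2 = (A 0 - B 0) ^ 2 + (A 1 - B 1) ^ 2 := by
  rw [dist_coord, Real.sq_sqrt (by positivity)]

theorem plane_ext {A B : Plane} (h0 : A 0 = B 0) (h1 : A 1 = B 1) : A = B := by
  ext i
  fin_cases i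
  · exact h0
  · exact h1

/-- Twice the signed area of the triangle `ABC`. -/
def cr (A B C : Plane) : ℝ := (B 0 - A 0) * (C 1 - A 1) - (B 1 - A 1) * (C 0 - A 0)

/-- `X` is a convex combination of `P`, `R`, `S`. -/
def InTri (P R S X : Plane) : Prop :=
  ∃ u v w : ℝ, 0 ≤ u ∧ 0 ≤ v ∧ 0 ≤ w ∧ u + v + w = 1 ∧
    X 0 = u * P 0 + v * R 0 + w * S 0 ∧ X 1 = u * P 1 + v * R 1 + w * S 1

theorem inTri_iff {P R S X : Plane} : InTri P R S X ↔ X ∈ convexHull ℝ {P, R, S} := by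
  constructor
  · rintro ⟨u, v, w, hu, hv, hw, h1, hx, hy⟩
    have hX : X = u • P + v • R + w • S := by
      apply plane_ext
      · simpa using hx
      · simpa using hy
    rw [hX]
    have hc := convex_convexHull ℝ ({P, R, S} : Set Plane)
    have hP : P ∈ convexHull ℝ ({P, R, S} : Set Plane) := subset_convexHull _ _ (by simp)
    have hR : R ∈ convexHull ℝ ({P, R, S} : Set Plane) := subset_convexHull _ _ (by simp)
    have hS : S ∈ convexHull ℝ ({P, R, S} : Set Plane) := subset_convexHull _ _ (by simp)
    have := hc.sum_mem (t := Finset.univ) (w := ![u, v, w]) (z := ![P, R, S])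
      (by intro i _; fin_cases i <;> simpa) (by simpa [Fin.sum_univ_three] using h1)
      (by intro i _; fin_cases i <;> simpa)
    simpa [Fin.sum_univ_three] using this
  · intro h
    rw [convexHull_insert (by simp), convexHull_pair, mem_convexJoin] at h
    obtain ⟨a, ha, b, ⟨u, v, hu, hv, huv, rfl⟩, s, t, hs, ht, hst, rfl⟩ := h
    rw [Set.mem_singleton_iff] at ha
    subst ha
    refine ⟨s, t * u, t * v, hs, by positivity, by positivity, ?_, ?_, ?_⟩
    · linear_combination hst + t * huv
    · simp; ring
    · simp; ring

theorem affineIndependent_iff_cr {A B C : Plane} :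
    AffineIndependent ℝ ![A, B, C] ↔ cr A B C ≠ 0 := by
  rw [affineIndependent_iff_not_collinear_set, not_iff_not,
    collinear_iff_of_mem (p₀ := A) (by simp)]
  constructor
  · rintro ⟨v, hv⟩
    obtain ⟨r, hr⟩ := hv B (by simp)
    obtain ⟨s, hs⟩ := hv C (by simp)
    subst hr hs
    simp [cr]; ring
  · intro h
    unfold cr at h
    by_cases hB : B = A
    · subst hB
      refine ⟨C - B, ?_⟩
      rintro p (rfl | rfl | rfl)
      · exact ⟨0, by simp⟩
      · exact ⟨0, by simp⟩
      · exact ⟨1, by simp⟩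
    · refine ⟨B - A, ?_⟩
      have hne : B 0 - A 0 ≠ 0 ∨ B 1 - A 1 ≠ 0 := by
        by_contra! hh
        exact hB (plane_ext (by linarith [hh.1]) (by linarith [hh.2]))
      rintro p (rfl | rfl | rfl)
      · exact ⟨0, by simp⟩
      · exact ⟨1, by simp⟩
      · rcases hne with h0 | h1
        · refine ⟨(p 0 - A 0) / (B 0 - A 0), plane_ext ?_ ?_⟩
          · simp; field_simp; ring
          · simp; field_simp; linarith
        · refine ⟨(p 1 - A 1) / (B 1 - A 1), plane_ext ?_ ?_⟩
          · simp; field_simp; linarith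
          · simp; field_simp; ring

theorem exists_tri {A B C : Plane} (h : cr A B C ≠ 0) :
    ∃ T : Tri, T.points = ![A, B, C] ∧ verts T = {A, B, C} := by
  refine ⟨⟨![A, B, C], affineIndependent_iff_cr.2 h⟩, rfl, ?_⟩
  ext X
  simp [verts, eq_comm]
  tauto

theorem verts_eq (T : Tri) : verts T = {T.points 0, T.points 1, T.points 2} := by
  ext X
  simp [verts, Fin.exists_fin_succ, eq_comm]

theorem tri_points_cr (T : Tri) : cr (T.points 0) (T.points 1) (T.points 2) ≠ 0 := by
  rw [← affineIndependent_iff_cr]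
  convert T.independent using 1
  ext i
  fin_cases i <;> rfl

theorem verts_cases {T : Tri} {A B C : Plane} (h : verts T = {A, B, C}) :
    ∃ σ : Equiv.Perm (Fin 3), ∀ i, T.points (σ i) = ![A, B, C] i := by
  have hA : A ∈ Set.range T.points := by change A ∈ verts T; simp [h]
  have hB : B ∈ Set.range T.points := by change B ∈ verts T; simp [h]
  have hC : C ∈ Set.range T.points := by change C ∈ verts T; simp [h]
  obtain ⟨a, ha⟩ := hA
  obtain ⟨b, hb⟩ := hB
  obtain ⟨c, hc⟩ := hC
  have hs : Function.Surjective ![a, b, c] := by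
    intro i
    have : T.points i ∈ verts T := ⟨i, rfl⟩
    rw [h] at this
    rcases this with h' | h' | h'
    · exact ⟨0, T.independent.injective (by simpa [ha] using h'.symm)⟩
    · exact ⟨1, T.independent.injective (by simpa [hb] using h'.symm)⟩
    · exact ⟨2, T.independent.injective (by simpa [hc] using (show C = _ from h'.symm))⟩
  refine ⟨Equiv.ofBijective _ (Finite.surjective_iff_bijective.1 hs), fun i => ?_⟩
  fin_cases i <;> simp [ha, hb, hc]

theorem cr_ne_zero {T : Tri} {A B C : Plane} (h : verts T = {A, B, C}) : cr A B C ≠ 0 := by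
  obtain ⟨σ, hσ⟩ := verts_cases h
  rw [← affineIndependent_iff_cr, ← (funext hσ : T.points ∘ σ = _)]
  exact T.independent.comp_embedding σ.toEmbedding

theorem per_eq {T : Tri} {A B C : Plane} (h : verts T = {A, B, C}) :
    per T = dist A B + dist B C + dist C A := by
  obtain ⟨σ, hσ⟩ := verts_cases h
  have hA : A = T.points (σ 0) := (hσ 0).symm
  have hB : B = T.points (σ 1) := (hσ 1).symm
  have hC : C = T.points (σ 2) := (hσ 2).symm
  have h01 : σ 0 ≠ σ 1 := by simp
  have h02 : σ 0 ≠ σ 2 := by simp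
  have h12 : σ 1 ≠ σ 2 := by simp
  rw [hA, hB, hC]
  generalize σ 0 = a at *
  generalize σ 1 = b at *
  generalize σ 2 = c at *
  unfold per
  have e1 := dist_comm (T.points 0) (T.points 1)
  have e2 := dist_comm (T.points 0) (T.points 2)
  have e3 := dist_comm (T.points 1) (T.points 2)
  fin_cases a <;> fin_cases b <;> fin_cases c <;> simp at * <;> linarith

theorem closedInterior_eq (T : Tri) : T.closedInterior = convexHull ℝ (verts T) :=
  (Affine.Simplex.convexHull_eq_closedInterior T).symm

theorem subset_iff {T T' : Tri} {A B C P R S : Plane} (h : verts T = {A, B, C})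
    (h' : verts T' = {P, R, S}) :
    T.closedInterior ⊆ T'.closedInterior ↔ InTri P R S A ∧ InTri P R S B ∧ InTri P R S C := by
  rw [closedInterior_eq, closedInterior_eq, h, h', (convex_convexHull ℝ _).convexHull_subset_iff]
  simp [Set.insert_subset_iff, inTri_iff]

/-! ### Minimality as a lower bound over labelled triples of points -/

/-- Every isosceles triangle `PRS` (with apex `R`) that contains `A`, `B` and `C` has perimeter at
least `m`. -/
def IsMin (A B C : Plane) (m : ℝ) : Prop :=
  ∀ P R S : Plane, dist P R = dist R S → InTri P R S A → InTri P R S B → InTri P R S C →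
    m ≤ dist P R + dist R S + dist S P

/-- The signed area of `ABC` is that of `PRS` times a determinant of barycentric coordinates. So a
degenerate triple never contains a triangle, and `IsMin` need not ask for nondegeneracy. -/
theorem cr_ne_zero_of_inTri {A B C P R S : Plane} (h : cr A B C ≠ 0) (hA : InTri P R S A)
    (hB : InTri P R S B) (hC : InTri P R S C) : cr P R S ≠ 0 := by
  obtain ⟨u, v, w, -, -, -, h1, a0, a1⟩ := hA
  obtain ⟨u', v', w', -, -, -, h1', b0, b1⟩ := hB
  obtain ⟨u'', v'', w'', -, -, -, h1'', c0, c1⟩ := hC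
  intro h0
  apply h
  obtain rfl : u = 1 - v - w := by linarith
  obtain rfl : u' = 1 - v' - w' := by linarith
  obtain rfl : u'' = 1 - v'' - w'' := by linarith
  have : cr A B C = ((v' - v) * (w'' - w) - (w' - w) * (v'' - v)) * cr P R S := by
    unfold cr
    rw [a0, a1, b0, b1, c0, c1]
    ring
  rw [this, h0, mul_zero]

theorem IsMinContainer.isMin {T T' : Tri} {A B C : Plane} (h : verts T = {A, B, C})
    (hT : IsMinContainer T T') : IsMin A B C (per T') := by
  intro P R S hiso hA hB hC
  obtain ⟨T'', -, hv⟩ := exists_tri (cr_ne_zero_of_inTri (cr_ne_zero h) hA hB hC)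
  rw [← per_eq hv]
  exact hT.2 T'' ⟨⟨P, R, S, hv, hiso⟩, (subset_iff h hv).2 ⟨hA, hB, hC⟩⟩

theorem IsMin.isMinContainer {T T' : Tri} {A B C : Plane} (h : verts T = {A, B, C})
    (hT : IsMin A B C (per T')) (hc : IsContainer T T') : IsMinContainer T T' := by
  refine ⟨hc, fun T'' ⟨⟨P, R, S, hv, hiso⟩, hsub⟩ => ?_⟩
  rw [per_eq hv]
  obtain ⟨hA, hB, hC⟩ := (subset_iff h hv).1 hsub
  exact hT P R S hiso hA hB hC

theorem IsMin.perm_left {A B C : Plane} {m : ℝ} (h : IsMin A B C m) : IsMin B A C m :=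
  fun P R S hi hB hA hC => h P R S hi hA hB hC

theorem IsMin.perm_right {A B C : Plane} {m : ℝ} (h : IsMin A B C m) : IsMin A C B m :=
  fun P R S hi hA hC hB => h P R S hi hA hB hC

theorem InTri.map {P R S X : Plane} (F : Plane ≃ᵃⁱ[ℝ] Plane) (h : InTri P R S X) :
    InTri (F P) (F R) (F S) (F X) := by
  rw [inTri_iff] at *
  have := AffineMap.image_convexHull F.toAffineEquiv.toAffineMap {P, R, S}
  simp only [Set.image_insert_eq, Set.image_singleton] at this
  have h2 : F X ∈ (F.toAffineEquiv.toAffineMap) '' convexHull ℝ {P, R, S} := ⟨X, h, rfl⟩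
  rw [this] at h2
  exact h2

theorem IsMin.of_map {A B C : Plane} {m : ℝ} (F : Plane ≃ᵃⁱ[ℝ] Plane)
    (h : IsMin (F A) (F B) (F C) m) : IsMin A B C m := by
  intro P R S hi hA hB hC
  have := h (F P) (F R) (F S) (by simpa using hi) (hA.map F) (hB.map F) (hC.map F)
  simpa using this

/-- Bounds the distance from a contained point to a vertex by the perimeter; this makes the set of
competitive containers bounded. -/
theorem InTri.mem_closedBall {P R S X : Plane} (h : InTri P R S X) :
    dist X P ≤ dist P R + dist S P := by
  rw [inTri_iff] at h
  have h1 : convexHull ℝ {P, R, S} ⊆ Metric.closedBall P (dist P R + dist S P) := by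
    apply convexHull_min _ (convex_closedBall _ _)
    have := dist_nonneg (x := P) (y := R)
    have := dist_nonneg (x := S) (y := P)
    rintro Y (rfl | rfl | rfl)
    · simp; linarith
    · rw [Metric.mem_closedBall, dist_comm]; linarith
    · rw [Metric.mem_closedBall]; linarith
  exact h1 h

theorem inTri_of_cr {P R S X : Plane} (h : 0 < cr P R S) (h1 : 0 ≤ cr X R S) (h2 : 0 ≤ cr P X S)
    (h3 : 0 ≤ cr P R X) : InTri P R S X := by
  refine ⟨cr X R S / cr P R S, cr P X S / cr P R S, cr P R X / cr P R S, by positivity,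
    by positivity, by positivity, ?_, ?_, ?_⟩ <;> field_simp <;> unfold cr <;> ring

theorem InTri.rev {P R S X : Plane} (h : InTri P R S X) : InTri S R P X := by
  obtain ⟨u, v, w, hu, hv, hw, h1, hx, hy⟩ := h
  exact ⟨w, v, u, hw, hv, hu, by linarith, by linarith, by linarith⟩

/-! ### Existence of a minimum by compactness -/

theorem abs_coord_le (A B : Plane) (i : Fin 2) : |B i - A i| ≤ dist A B := by
  rw [← Real.dist_eq, dist_comm]
  have := EuclideanSpace.dist_eq A B
  rw [this]
  apply Real.le_sqrt_of_sq_le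
  exact Finset.single_le_sum (f := fun i => dist (A i) (B i) ^ 2) (fun _ _ => by positivity)
    (Finset.mem_univ i)

theorem exists_container (A B C : Plane) :
    ∃ P R S : Plane, dist P R = dist R S ∧ InTri P R S A ∧ InTri P R S B ∧ InTri P R S C := by
  set r := dist A B + dist A C + 1 with hr
  have h1 := dist_nonneg (x := A) (y := B)
  have h2 := dist_nonneg (x := A) (y := C)
  have hr0 : 0 < r := by positivity
  -- Relative to `A` the legs lie on `|x| + y = 2 * r` and the base on `y = -r`, so the square `|x|,
  -- |y| ≤ r` just fits.
  have key : ∀ X : Plane, |X 0 - A 0| ≤ r → |X 1 - A 1| ≤ r →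
      InTri !₂[A 0 + 3 * r, A 1 - r] !₂[A 0, A 1 + 2 * r] !₂[A 0 - 3 * r, A 1 - r] X := by
    intro X hX hY
    rw [abs_le] at hX hY
    apply inTri_of_cr <;> simp [cr] <;> nlinarith
  refine ⟨_, _, _, ?_, key A ?_ ?_, key B ?_ ?_, key C ?_ ?_⟩
  · simp only [dist_coord]
    congr 1
    simp
    ring
  · simpa using hr0.le
  · simpa using hr0.le
  · linarith [abs_coord_le A B 0]
  · linarith [abs_coord_le A B 1]
  · linarith [abs_coord_le A C 0]
  · linarith [abs_coord_le A C 1]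

theorem isClosed_inTri_weights (X : Plane) :
    IsClosed {q : (Plane × Plane × Plane) × (ℝ × ℝ × ℝ) |
      0 ≤ q.2.1 ∧ 0 ≤ q.2.2.1 ∧ 0 ≤ q.2.2.2 ∧ q.2.1 + q.2.2.1 + q.2.2.2 = 1 ∧
      X 0 = q.2.1 * q.1.1 0 + q.2.2.1 * q.1.2.1 0 + q.2.2.2 * q.1.2.2 0 ∧
      X 1 = q.2.1 * q.1.1 1 + q.2.2.1 * q.1.2.1 1 + q.2.2.2 * q.1.2.2 1} := by
  simp only [Set.ofPred_and]
  refine (isClosed_le ?_ ?_).inter <| (isClosed_le ?_ ?_).inter <| (isClosed_le ?_ ?_).inter <|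
    (isClosed_eq ?_ ?_).inter <| (isClosed_eq ?_ ?_).inter (isClosed_eq ?_ ?_) <;> fun_prop

/-- The set is the projection, along the compact cube of weights, of a closed set of vertices with
weights. -/
theorem isClosed_inTri (X : Plane) :
    IsClosed {q : Plane × Plane × Plane | InTri q.1 q.2.1 q.2.2 X} := by
  have hK : IsCompact (Set.Icc (0 : ℝ × ℝ × ℝ) 1) := isCompact_Icc
  have h := (isClosed_inTri_weights X).inter
    (isClosed_univ.prod (isClosed_Icc (a := (0 : ℝ × ℝ × ℝ)) (b := 1)))
  have : {q : Plane × Plane × Plane | InTri q.1 q.2.1 q.2.2 X} = Prod.fst ''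
      ({q : (Plane × Plane × Plane) × (ℝ × ℝ × ℝ) |
      0 ≤ q.2.1 ∧ 0 ≤ q.2.2.1 ∧ 0 ≤ q.2.2.2 ∧ q.2.1 + q.2.2.1 + q.2.2.2 = 1 ∧
      X 0 = q.2.1 * q.1.1 0 + q.2.2.1 * q.1.2.1 0 + q.2.2.2 * q.1.2.2 0 ∧
      X 1 = q.2.1 * q.1.1 1 + q.2.2.1 * q.1.2.1 1 + q.2.2.2 * q.1.2.2 1} ∩
        (Set.univ ×ˢ Set.Icc 0 1)) := by
    ext q
    constructor
    · rintro ⟨u, v, w, hu, hv, hw, h1, hx, hy⟩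
      refine ⟨(q, (u, v, w)), ⟨⟨hu, hv, hw, h1, hx, hy⟩, trivial, ?_, ?_⟩, rfl⟩
      · exact ⟨hu, hv, hw⟩
      · refine ⟨?_, ?_, ?_⟩ <;> simp <;> linarith
    · rintro ⟨⟨q', u, v, w⟩, ⟨⟨hu, hv, hw, h1, hx, hy⟩, -⟩, rfl⟩
      exact ⟨u, v, w, hu, hv, hw, h1, hx, hy⟩
  rw [this]
  have hp : IsCompact (Set.Icc (0 : ℝ × ℝ × ℝ) 1) := hK
  rw [← isSeqClosed_iff_isClosed]
  intro q q₀ hq hlim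
  choose z hz hzq using hq
  have hzK : ∀ n, (z n).2 ∈ Set.Icc (0 : ℝ × ℝ × ℝ) 1 := fun n => (hz n).2.2
  obtain ⟨w, hw, φ, hφ, hlimw⟩ := hp.tendsto_subseq hzK
  refine ⟨(q₀, w), ?_, rfl⟩
  have hl : Filter.Tendsto (z ∘ φ) Filter.atTop (nhds (q₀, w)) := by
    rw [Prod.tendsto_iff]
    refine ⟨?_, hlimw⟩
    have : (fun n => ((z ∘ φ) n).1) = q ∘ φ := by ext1 n; simp [hzq]
    rw [this]
    exact hlim.comp hφ.tendsto_atTop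
  exact h.mem_of_tendsto hl (Filter.Eventually.of_forall fun n => hz _)

theorem exists_isMin (A B C : Plane) : ∃ P R S : Plane, dist P R = dist R S ∧ InTri P R S A ∧
    InTri P R S B ∧ InTri P R S C ∧ IsMin A B C (dist P R + dist R S + dist S P) := by
  obtain ⟨P₀, R₀, S₀, hiso, hA, hB, hC⟩ := exists_container A B C
  set M := dist P₀ R₀ + dist R₀ S₀ + dist S₀ P₀ with hM
  let f : Plane × Plane × Plane → ℝ := fun q => dist q.1 q.2.1 + dist q.2.1 q.2.2 + dist q.2.2 q.1
  have hf : Continuous f := by fun_prop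
  -- Cutting off at the perimeter `M` of one known container bounds the feasible set without
  -- affecting the infimum.
  let K : Set (Plane × Plane × Plane) := {q | dist q.1 q.2.1 = dist q.2.1 q.2.2} ∩
    ({q | InTri q.1 q.2.1 q.2.2 A} ∩ ({q | InTri q.1 q.2.1 q.2.2 B} ∩
      ({q | InTri q.1 q.2.1 q.2.2 C} ∩ {q | f q ≤ M})))
  have hKc : IsClosed K := by
    refine IsClosed.inter (isClosed_eq (by fun_prop) (by fun_prop)) <|
      (isClosed_inTri A).inter <| (isClosed_inTri B).inter <| (isClosed_inTri C).inter <|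
      isClosed_le hf continuous_const
  have hK : IsCompact K := by
    refine ((isCompact_closedBall A (M + M)).prod ((isCompact_closedBall A (M + M)).prod
      (isCompact_closedBall A (M + M)))).of_isClosed_subset hKc ?_
    rintro ⟨P, R, S⟩ ⟨-, h1, -, -, h2⟩
    simp only [Set.mem_ofPred_eq, f] at h1 h2
    have h3 := h1.mem_closedBall
    have := dist_nonneg (x := P) (y := R)
    have := dist_nonneg (x := R) (y := S)
    have := dist_nonneg (x := S) (y := P)
    have hPA : dist P A ≤ M := by rw [dist_comm]; linarith
    refine ⟨?_, ?_, ?_⟩ <;> simp only [Metric.mem_closedBall]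
    · linarith
    · linarith [dist_triangle R P A, dist_comm R P]
    · linarith [dist_triangle S P A]
  obtain ⟨⟨P, R, S⟩, ⟨h1, h2, h3, h4, h5⟩, hmin⟩ :=
    hK.exists_isMinOn ⟨(P₀, R₀, S₀), hiso, hA, hB, hC, le_refl M⟩ hf.continuousOn
  refine ⟨P, R, S, h1, h2, h3, h4, ?_⟩
  intro P' R' S' g1 g2 g3 g4
  by_cases hle : dist P' R' + dist R' S' + dist S' P' ≤ M
  · exact hmin (a := (P', R', S')) ⟨g1, g2, g3, g4, hle⟩
  · exact le_trans h5 (not_le.1 hle).le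

theorem exists_isMinContainer (T : Tri) : ∃ T' : Tri, IsMinContainer T T' := by
  obtain ⟨P, R, S, hi, hA, hB, hC, hm⟩ := exists_isMin (T.points 0) (T.points 1) (T.points 2)
  obtain ⟨T', -, hv⟩ := exists_tri (cr_ne_zero_of_inTri (tri_points_cr T) hA hB hC)
  refine ⟨T', ?_⟩
  rw [← per_eq hv] at hm
  exact hm.isMinContainer (verts_eq T) ⟨⟨P, R, S, hv, hi⟩,
    (subset_iff (verts_eq T) hv).2 ⟨hA, hB, hC⟩⟩

/-! ### Standard position and competitors bounded by support lines -/

/-- The isometry `(x, y) ↦ O + x (a, b) + y e (-b, a)`, where `(a, b)` is a unit vector and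
`e = ± 1`. -/
theorem exists_isometry (O : Plane) {a b e : ℝ} (h : a ^ 2 + b ^ 2 = 1) (he : e ^ 2 = 1) :
    ∃ F : Plane ≃ᵃⁱ[ℝ] Plane, ∀ X : Plane,
      F X = !₂[O 0 + a * X 0 - e * b * X 1, O 1 + b * X 0 + e * a * X 1] := by
  let f : Plane → Plane := fun X => !₂[O 0 + a * X 0 - e * b * X 1, O 1 + b * X 0 + e * a * X 1]
  let g : Plane → Plane := fun X => !₂[a * (X 0 - O 0) + b * (X 1 - O 1),
    -e * b * (X 0 - O 0) + e * a * (X 1 - O 1)]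
  have hfg : ∀ X, f (g X) = X := by
    intro X
    apply plane_ext
    · simp [f, g]
      linear_combination (X 0 - O 0) * h + (b * b * (X 0 - O 0) - a * b * (X 1 - O 1)) * he
    · simp [f, g]
      linear_combination (X 1 - O 1) * h + (a * a * (X 1 - O 1) - a * b * (X 0 - O 0)) * he
  have hf : Isometry f := by
    refine Isometry.of_dist_eq fun X Y => ?_
    rw [dist_coord, dist_coord]
    congr 1
    simp [f]
    linear_combination ((X 0 - Y 0) ^ 2 + e ^ 2 * (X 1 - Y 1) ^ 2) * h + (X 1 - Y 1) ^ 2 * he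
  exact ⟨(IsometryEquiv.mk' f g hfg hf).toRealAffineIsometryEquiv, fun X => rfl⟩

/-- The sign `e` is chosen by the orientation of `PRS`, so that the apex lands above the base; equal
legs put it over the midpoint. -/
theorem exists_chart {P R S : Plane} (h : cr P R S ≠ 0) (hi : dist P R = dist R S) :
    ∃ (F : Plane ≃ᵃⁱ[ℝ] Plane) (s t : ℝ), 0 < s ∧ 0 < t ∧ F !₂[0, 0] = P ∧ F !₂[s, 0] = S ∧
      F !₂[s / 2, t] = R := by
  have hPS : P ≠ S := by
    rintro rfl
    apply h
    unfold cr
    ring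
  set s := dist P S with hs
  have hs0 : 0 < s := dist_pos.2 hPS
  have hs2 : s ^ 2 = (P 0 - S 0) ^ 2 + (P 1 - S 1) ^ 2 := dist_sq_coord P S
  have hi2 : (P 0 - R 0) ^ 2 + (P 1 - R 1) ^ 2 = (R 0 - S 0) ^ 2 + (R 1 - S 1) ^ 2 := by
    rw [← dist_sq_coord, ← dist_sq_coord, hi]
  obtain ⟨e, he, ht⟩ : ∃ e : ℝ, e ^ 2 = 1 ∧ 0 < e * (-cr P R S / s) := by
    rcases lt_or_gt_of_ne h with h | h
    · exact ⟨1, by norm_num, by rw [one_mul]; exact div_pos (by linarith) hs0⟩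
    · refine ⟨-1, by norm_num, ?_⟩
      rw [neg_div, neg_mul_neg, one_mul]
      exact div_pos h hs0
  obtain ⟨F, hF⟩ := exists_isometry P (a := (S 0 - P 0) / s) (b := (S 1 - P 1) / s)
    (by field_simp; linarith) he
  refine ⟨F, s, e * (-cr P R S / s), hs0, ht, ?_, ?_, ?_⟩
  · rw [hF]
    apply plane_ext <;> simp
  · rw [hF]
    apply plane_ext <;> simp <;> field_simp <;> ring
  · rw [hF]
    apply plane_ext
    · simp
      field_simp
      rw [he]
      unfold cr
      rw [hs2]
      linear_combination -(S 0 - P 0) * hi2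
    · simp
      field_simp
      rw [he]
      unfold cr
      rw [hs2]
      linear_combination -(S 1 - P 1) * hi2

theorem dist_eq_of_sq {A B : Plane} {d : ℝ} (hd : 0 ≤ d)
    (h : (A 0 - B 0) ^ 2 + (A 1 - B 1) ^ 2 = d ^ 2) : dist A B = d := by
  rw [dist_coord, h, Real.sqrt_sq hd]

/-- The three support lines bound an isosceles triangle with base `w = (r - l - 2 * c * y) / k` and
legs `w / (2 * c)`. It contains the points, so its perimeter bounds `m`. The base angle is free, so
this serves both for moving sides in parallel and for changing the angle. -/
theorem IsMin.le_upright {A B C : Plane} {m c k y l r : ℝ} (hm : IsMin A B C m)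
    (hck : c ^ 2 + k ^ 2 = 1) (hc : 0 < c) (hk : 0 < k) (hpos : 0 < r - l - 2 * c * y)
    (h : ∀ X, X = A ∨ X = B ∨ X = C →
      y ≤ X 1 ∧ l ≤ k * X 0 - c * X 1 ∧ k * X 0 + c * X 1 ≤ r) :
    m ≤ (r - l - 2 * c * y) * (1 + c) / (c * k) := by
  set w := (r - l - 2 * c * y) / k with hw
  have hw0 : 0 < w := by positivity
  set p := (l + c * y) / k with hp
  have hl : l = k * p - c * y := by rw [hp]; field_simp; ring
  have hr : r = k * (p + w) + c * y := by rw [hp, hw]; field_simp; ring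
  let V : Plane := !₂[p, y]
  let S : Plane := !₂[p + w, y]
  let R : Plane := !₂[p + w / 2, y + w * k / (2 * c)]
  have hcr : cr S R V = w ^ 2 * k / (2 * c) := by
    simp [cr, S, R, V]; field_simp
  have key : ∀ X, X = A ∨ X = B ∨ X = C → InTri V R S X := by
    intro X hX
    obtain ⟨h1, h2, h3⟩ := h X hX
    refine (inTri_of_cr ?_ ?_ ?_ ?_).rev
    · rw [hcr]; positivity
    · have : cr X R V = w / (2 * c) * (k * X 0 - c * X 1 - l) := by
        rw [hl]; simp [cr, R, V]; field_simp; ring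
      rw [this]
      exact mul_nonneg (by positivity) (by linarith)
    · have : cr S X V = w * (X 1 - y) := by
        simp [cr, S, V]; ring
      rw [this]
      exact mul_nonneg hw0.le (by linarith)
    · have : cr S R X = w / (2 * c) * (r - (k * X 0 + c * X 1)) := by
        rw [hr]; simp [cr, S, R]; field_simp; ring
      rw [this]
      exact mul_nonneg (by positivity) (by linarith)
  have d1 : dist V R = w / (2 * c) := by
    apply dist_eq_of_sq (by positivity)
    simp [V, R]; field_simp; linear_combination hck
  have d2 : dist R S = w / (2 * c) := by
    apply dist_eq_of_sq (by positivity)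
    simp [S, R]; field_simp; linear_combination hck
  have d3 : dist S V = w := by
    apply dist_eq_of_sq hw0.le
    simp [S, V]
  have := hm V R S (d1.trans d2.symm) (key A (by simp)) (key B (by simp)) (key C (by simp))
  rw [d1, d2, d3] at this
  convert this using 1
  rw [hw]; field_simp; ring

theorem IsMin.le_rotated {A B C : Plane} {m a b c k y l r : ℝ} (hm : IsMin A B C m)
    (hab : a ^ 2 + b ^ 2 = 1)
    (hck : c ^ 2 + k ^ 2 = 1) (hc : 0 < c) (hk : 0 < k) (hpos : 0 < r - l - 2 * c * y)
    (h : ∀ X, X = A ∨ X = B ∨ X = C → y ≤ -b * X 0 + a * X 1 ∧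
      l ≤ k * (a * X 0 + b * X 1) - c * (-b * X 0 + a * X 1) ∧
      k * (a * X 0 + b * X 1) + c * (-b * X 0 + a * X 1) ≤ r) :
    m ≤ (r - l - 2 * c * y) * (1 + c) / (c * k) := by
  obtain ⟨F, hF⟩ := exists_isometry (!₂[0, 0]) (e := 1) hab (by norm_num)
  have key : ∀ X : Plane, F !₂[a * X 0 + b * X 1, -b * X 0 + a * X 1] = X := by
    intro X
    rw [hF]
    apply plane_ext <;> simp
    · linear_combination X 0 * hab
    · linear_combination X 1 * hab
  rw [← key A, ← key B, ← key C] at hm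
  refine hm.of_map.le_upright hck hc hk hpos ?_
  rintro X (rfl | rfl | rfl)
  · simpa using h A (by simp)
  · simpa using h B (by simp)
  · simpa using h C (by simp)

/-! ### First-order conditions at an optimal container -/

/-- `X` lies in the isosceles triangle with vertices `(0, 0)`, `(s, 0)` and base angles with cosine
`c` and sine `k`. -/
def Fits (s c k : ℝ) (X : Plane) : Prop :=
  0 ≤ X 1 ∧ c * X 1 ≤ k * X 0 ∧ c * X 1 ≤ k * (s - X 0)

/-- The triangle with vertices `(0, 0)`, `(s, 0)` and base angles with cosine
`c` and sine `k` is an isosceles container of `ABC` of minimal perimeter. -/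
structure Opt (A B C : Plane) (s c k : ℝ) : Prop where
  s_pos : 0 < s
  c_pos : 0 < c
  k_pos : 0 < k
  unit : c ^ 2 + k ^ 2 = 1
  fits : ∀ X, X = A ∨ X = B ∨ X = C → Fits s c k X
  isMin : IsMin A B C (s * (1 + c) / c)

namespace Opt

variable {A B C : Plane} {s c k : ℝ}

theorem perm_left (h : Opt A B C s c k) : Opt B A C s c k :=
  ⟨h.s_pos, h.c_pos, h.k_pos, h.unit, fun X hX => h.fits X (by tauto), h.isMin.perm_left⟩

theorem perm_right (h : Opt A B C s c k) : Opt A C B s c k :=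
  ⟨h.s_pos, h.c_pos, h.k_pos, h.unit, fun X hX => h.fits X (by tauto), h.isMin.perm_right⟩

/-- The three sides of an optimal container are tight. -/
theorem tight (h : Opt A B C s c k) {y l r : ℝ}
    (hX : ∀ X, X = A ∨ X = B ∨ X = C →
      y ≤ X 1 ∧ l ≤ k * X 0 - c * X 1 ∧ k * X 0 + c * X 1 ≤ r) (hpos : 0 < r - l - 2 * c * y) :
    s * k ≤ r - l - 2 * c * y := by
  have h1 := h.isMin.le_upright h.unit h.c_pos h.k_pos hpos hX
  have hc := h.c_pos
  have hk := h.k_pos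
  rw [div_le_div_iff₀ hc (by positivity)] at h1
  have : (1 + c) * c * (s * k) ≤ (1 + c) * c * (r - l - 2 * c * y) := by linarith
  exact le_of_mul_le_mul_left this (by positivity)

/-- Otherwise the base could be raised between the lines of the two legs, giving a smaller similar
container. -/
theorem touch_base (h : Opt A B C s c k) : ∃ X, (X = A ∨ X = B ∨ X = C) ∧ X 1 = 0 := by
  by_contra! hcon
  have hpos : ∀ X, (X = A ∨ X = B ∨ X = C) → 0 < X 1 := fun X hX =>
    lt_of_le_of_ne (h.fits X hX).1 (Ne.symm (hcon X hX))
  have hc := h.c_pos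
  have hk := h.k_pos
  have hs := h.s_pos
  -- The last entry keeps the width `s * k - 2 * c * y` of the competitor at least `s * k / 2`,
  -- hence positive.
  set y := min (min (A 1) (B 1)) (min (C 1) (s * k / (4 * c))) with hy
  have hy0 : 0 < y := by
    refine lt_min (lt_min (hpos _ (by simp)) (hpos _ (by simp))) (lt_min (hpos _ (by simp)) ?_)
    positivity
  have hy1 : y ≤ s * k / (4 * c) := (min_le_right _ _).trans (min_le_right _ _)
  rw [le_div_iff₀ (by positivity)] at hy1
  have := h.tight (y := y) (l := 0) (r := k * s) (fun X hX => ?_) (by nlinarith [mul_pos hs hk])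
  · nlinarith
  · obtain ⟨f1, f2, f3⟩ := h.fits X hX
    refine ⟨?_, by linarith, by linarith⟩
    rcases hX with rfl | rfl | rfl
    · exact (min_le_left _ _).trans (min_le_left _ _)
    · exact (min_le_left _ _).trans (min_le_right _ _)
    · exact (min_le_right _ _).trans (min_le_left _ _)

theorem touch_left (h : Opt A B C s c k) :
    ∃ X, (X = A ∨ X = B ∨ X = C) ∧ k * X 0 - c * X 1 = 0 := by
  by_contra! hcon
  have hpos : ∀ X, (X = A ∨ X = B ∨ X = C) → 0 < k * X 0 - c * X 1 := fun X hX =>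
    lt_of_le_of_ne (by linarith [(h.fits X hX).2.1]) (Ne.symm (hcon X hX))
  have hk := h.k_pos
  have hs := h.s_pos
  set l := min (min (k * A 0 - c * A 1) (k * B 0 - c * B 1))
    (min (k * C 0 - c * C 1) (s * k / 2)) with hy
  have hy0 : 0 < l := by
    refine lt_min (lt_min (hpos _ (by simp)) (hpos _ (by simp))) (lt_min (hpos _ (by simp)) ?_)
    positivity
  have hy1 : l ≤ s * k / 2 := (min_le_right _ _).trans (min_le_right _ _)
  have := h.tight (y := 0) (l := l) (r := k * s) (fun X hX => ?_) (by nlinarith [mul_pos hs hk])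
  · nlinarith
  · obtain ⟨f1, f2, f3⟩ := h.fits X hX
    refine ⟨f1, ?_, by linarith⟩
    rcases hX with rfl | rfl | rfl
    · exact (min_le_left _ _).trans (min_le_left _ _)
    · exact (min_le_left _ _).trans (min_le_right _ _)
    · exact (min_le_right _ _).trans (min_le_left _ _)

/-- Reflection in the axis of the container. -/
theorem mirror (h : Opt A B C s c k) : Opt !₂[s - A 0, A 1] !₂[s - B 0, B 1] !₂[s - C 0, C 1] s c k := by
  refine ⟨h.s_pos, h.c_pos, h.k_pos, h.unit, ?_, ?_⟩
  · have key : ∀ X : Plane, Fits s c k X → Fits s c k !₂[s - X 0, X 1] := by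
      rintro X ⟨h1, h2, h3⟩
      exact ⟨by simpa using h1, by simpa using h3, by simpa using h2⟩
    rintro X (rfl | rfl | rfl)
    · exact key A (h.fits A (by simp))
    · exact key B (h.fits B (by simp))
    · exact key C (h.fits C (by simp))
  · obtain ⟨F, hF⟩ := exists_isometry (!₂[s, 0]) (a := -1) (b := 0) (e := -1) (by norm_num)
      (by norm_num)
    have key : ∀ X : Plane, F !₂[s - X 0, X 1] = X := by
      intro X
      rw [hF]
      apply plane_ext <;> simp
    apply IsMin.of_map F
    rw [key, key, key]
    exact h.isMin

theorem touch_right (h : Opt A B C s c k) :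
    ∃ X, (X = A ∨ X = B ∨ X = C) ∧ k * (s - X 0) - c * X 1 = 0 := by
  obtain ⟨X, hX, hX0⟩ := h.mirror.touch_left
  rcases hX with rfl | rfl | rfl
  · exact ⟨A, by simp, by simpa using hX0⟩
  · exact ⟨B, by simp, by simpa using hX0⟩
  · exact ⟨C, by simp, by simpa using hX0⟩

open Filter Topology in
theorem eventually_le_of_lt {f g : ℝ → ℝ} (hf : Continuous f) (hg : Continuous g)
    (h : f 0 < g 0) : ∀ᶠ t in 𝓝[>] (0 : ℝ), f t ≤ g t := by
  have : ∀ᶠ t in 𝓝 (0 : ℝ), f t < g t := hf.continuousAt.eventually_lt hg.continuousAt h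
  exact (this.filter_mono nhdsWithin_le_nhds).mono fun _ h => h.le

open Filter Topology in
/-- First order optimality with respect to rotations. -/
theorem rotation_pos (h : Opt A B C s c k) {x₀ a₀ b₀ : ℝ}
    (hx : ∀ X, (X = A ∨ X = B ∨ X = C) → X 1 = 0 → X 0 ≤ x₀)
    (ha : ∀ X, (X = A ∨ X = B ∨ X = C) → k * (s - X 0) = c * X 1 →
      k * X 1 + c * (s - X 0) ≤ a₀)
    (hb : ∀ X, (X = A ∨ X = B ∨ X = C) → k * X 0 = c * X 1 → b₀ ≤ c * X 0 + k * X 1) :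
    0 < 2 * c * (x₀ - s / 2) + a₀ - b₀ := by
  -- Here `k * X 1 + c * (s - X 0)` and `c * X 0 + k * X 1` are positions on the right and left leg,
  -- measured from the base. Turn the frame by a small `t > 0` and use support lines through the
  -- extreme contacts; constraints that were strict survive. The new width is `cos t * (s * k) + sin
  -- t * D`, with `D` the expression in the goal. As `cos t < 1`, already `D ≤ 0` gives a smaller
  -- container, so the conclusion is strict.
  by_contra! hD
  have hc := h.c_pos
  have hk := h.k_pos
  have hs := h.s_pos
  have hsk : 0 < s * k := by positivity
  have ev : ∀ X, (X = A ∨ X = B ∨ X = C) → ∀ᶠ t in 𝓝[>] (0 : ℝ),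
      -Real.sin t * x₀ ≤ -Real.sin t * X 0 + Real.cos t * X 1 ∧
      Real.sin t * b₀ ≤ k * (Real.cos t * X 0 + Real.sin t * X 1) -
        c * (-Real.sin t * X 0 + Real.cos t * X 1) ∧
      k * (Real.cos t * X 0 + Real.sin t * X 1) + c * (-Real.sin t * X 0 + Real.cos t * X 1) ≤
        Real.cos t * (k * s) + Real.sin t * (a₀ - c * s) := by
    intro X hX
    have hsin : ∀ᶠ t in 𝓝[>] (0 : ℝ), 0 < Real.sin t := by
      filter_upwards [Ioo_mem_nhdsGT Real.pi_pos] with t ht using Real.sin_pos_of_mem_Ioo ht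
    obtain ⟨f1, f2, f3⟩ := h.fits X hX
    refine Eventually.and ?_ (Eventually.and ?_ ?_)
    · rcases f1.eq_or_lt with f1 | f1
      · filter_upwards [hsin] with t ht
        have := hx X hX f1.symm
        rw [← f1]
        nlinarith
      · exact eventually_le_of_lt (by fun_prop) (by fun_prop) (by simpa using f1)
    · rcases f2.eq_or_lt with f2 | f2
      · filter_upwards [hsin] with t ht
        have h1 := mul_le_mul_of_nonneg_left (hb X hX f2.symm) ht.le
        linear_combination h1 + Real.cos t * f2
      · exact eventually_le_of_lt (by fun_prop) (by fun_prop) (by simpa using f2)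
    · rcases f3.eq_or_lt with f3 | f3
      · filter_upwards [hsin] with t ht
        have h1 := mul_le_mul_of_nonneg_left (ha X hX f3.symm) ht.le
        linear_combination h1 + Real.cos t * f3
      · exact eventually_le_of_lt (by fun_prop) (by fun_prop) (by simp; linarith)
  have hpos : ∀ᶠ t in 𝓝[>] (0 : ℝ), 0 ≤ Real.cos t * (k * s) + Real.sin t * (a₀ - c * s) -
      Real.sin t * b₀ - 2 * c * (-Real.sin t * x₀) - s * k / 2 :=
    eventually_le_of_lt (f := fun _ => 0) (by fun_prop) (by fun_prop) (by simp; linarith)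
  have hcos : ∀ᶠ t in 𝓝[>] (0 : ℝ), Real.cos t < 1 ∧ 0 < Real.sin t := by
    filter_upwards [Ioo_mem_nhdsGT Real.pi_pos] with t ht
    have hsin := Real.sin_pos_of_mem_Ioo ht
    refine ⟨?_, hsin⟩
    nlinarith [Real.sin_sq_add_cos_sq t, Real.cos_le_one t]
  obtain ⟨t, hA, hB, hC, hpos, hcos, hsin⟩ := ((ev A (by simp)).and <| (ev B (by simp)).and <|
    (ev C (by simp)).and <| hpos.and hcos).exists
  have hm := h.isMin.le_rotated (Real.cos_sq_add_sin_sq t) h.unit hc hk (y := -Real.sin t * x₀)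
    (l := Real.sin t * b₀) (r := Real.cos t * (k * s) + Real.sin t * (a₀ - c * s))
    (by linarith) (by rintro X (rfl | rfl | rfl) <;> assumption)
  rw [div_le_div_iff₀ hc (by positivity)] at hm
  set W := Real.cos t * (k * s) + Real.sin t * (a₀ - c * s) - Real.sin t * b₀ -
    2 * c * (-Real.sin t * x₀) with hW
  have h1 : (1 + c) * c * (s * k) ≤ (1 + c) * c * W := by linarith
  have h2 : s * k ≤ W := le_of_mul_le_mul_left h1 (by positivity)
  have h3 : W = Real.cos t * (k * s) +
      Real.sin t * (2 * c * (x₀ - s / 2) + a₀ - b₀) := by rw [hW]; ring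
  nlinarith

/-- Reflection in the axis reverses the rotation and exchanges the legs, so the opposite extreme
contacts matter. -/
theorem rotation_neg (h : Opt A B C s c k) {x₀ a₀ b₀ : ℝ}
    (hx : ∀ X, (X = A ∨ X = B ∨ X = C) → X 1 = 0 → x₀ ≤ X 0)
    (ha : ∀ X, (X = A ∨ X = B ∨ X = C) → k * (s - X 0) = c * X 1 →
      a₀ ≤ k * X 1 + c * (s - X 0))
    (hb : ∀ X, (X = A ∨ X = B ∨ X = C) → k * X 0 = c * X 1 → c * X 0 + k * X 1 ≤ b₀) :
    2 * c * (x₀ - s / 2) + a₀ - b₀ < 0 := by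
  have hmem : ∀ {Q : Plane → Prop}, (∀ X, (X = A ∨ X = B ∨ X = C) → Q !₂[s - X 0, X 1]) →
      ∀ Y, Y = !₂[s - A 0, A 1] ∨ Y = !₂[s - B 0, B 1] ∨ Y = !₂[s - C 0, C 1] → Q Y := by
    rintro Q hQ Y (rfl | rfl | rfl)
    · exact hQ A (by simp)
    · exact hQ B (by simp)
    · exact hQ C (by simp)
  have := h.mirror.rotation_pos (x₀ := s - x₀) (a₀ := b₀) (b₀ := a₀)
    (hmem fun X hX hX1 => by
      have := hx X hX (by simpa using hX1)
      simp; linarith)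
    (hmem fun X hX hX1 => by
      have := hb X hX (by simpa using hX1)
      simp; linarith)
    (hmem fun X hX hX1 => by
      have := ha X hX (by simpa using hX1)
      simp; linarith)
  linarith

/-- Some side of an optimal container contains two of the points. -/
theorem flush (h : Opt A B C s c k) : ∃ X Y : Plane, X ≠ Y ∧ (X = A ∨ X = B ∨ X = C) ∧
    (Y = A ∨ Y = B ∨ Y = C) ∧ ((X 1 = 0 ∧ Y 1 = 0) ∨
      (k * X 0 = c * X 1 ∧ k * Y 0 = c * Y 1) ∨
      (k * (s - X 0) = c * X 1 ∧ k * (s - Y 0) = c * Y 1)) := by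
  -- With one contact per side the same three numbers are upper and lower bounds, so both rotation
  -- inequalities apply to the same quantity and contradict each other.
  by_contra! hcon
  obtain ⟨X, hX, hX1⟩ := h.touch_base
  obtain ⟨Y, hY, hY1⟩ := h.touch_right
  obtain ⟨Z, hZ, hZ1⟩ := h.touch_left
  have e1 : ∀ X', (X' = A ∨ X' = B ∨ X' = C) → X' 1 = 0 → X' = X := fun X' hX' h' => by
    by_contra hne
    exact (hcon X' X hne hX' hX).1 h' hX1
  have e2 : ∀ X', (X' = A ∨ X' = B ∨ X' = C) → k * (s - X' 0) = c * X' 1 → X' = Y :=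
    fun X' hX' h' => by
      by_contra hne
      exact (hcon X' Y hne hX' hY).2.2 h' (by linarith)
  have e3 : ∀ X', (X' = A ∨ X' = B ∨ X' = C) → k * X' 0 = c * X' 1 → X' = Z :=
    fun X' hX' h' => by
      by_contra hne
      exact (hcon X' Z hne hX' hZ).2.1 h' (by linarith)
  have h1 := h.rotation_pos (x₀ := X 0) (a₀ := k * Y 1 + c * (s - Y 0))
    (b₀ := c * Z 0 + k * Z 1) (fun X' a b => by rw [e1 X' a b]) (fun X' a b => by rw [e2 X' a b])
    (fun X' a b => by rw [e3 X' a b])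
  have h2 := h.rotation_neg (x₀ := X 0) (a₀ := k * Y 1 + c * (s - Y 0))
    (b₀ := c * Z 0 + k * Z 1) (fun X' a b => by rw [e1 X' a b]) (fun X' a b => by rw [e2 X' a b])
    (fun X' a b => by rw [e3 X' a b])
  linarith

end Opt

/-! ### The possible configurations -/

/-- An isosceles triangle with apex `Y` and leg `YX`, the third point lying on the other leg. -/
def ApexCfg (Y X Z : Plane) (D' : Set Plane) : Prop :=
  ∃ Q, D' = {Y, X, Q} ∧ dist Y X = dist Y Q ∧ Wbtw ℝ Y Z Q

/-- An isosceles triangle with base `XY`, the third point lying on the leg at `X`. -/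
def BaseCfg (X Y Z : Plane) (D' : Set Plane) : Prop :=
  ∃ R, D' = {X, Y, R} ∧ dist R X = dist R Y ∧ Wbtw ℝ X Z R

/-- An isosceles triangle with base vertex `Z`, the side opposite to `Z` containing `X` and `Y`,
such that the ratio of the base to a leg is `√5 - 1`. -/
def GammaCfg (Z X Y : Plane) (D' : Set Plane) : Prop :=
  ∃ R V, D' = {Z, R, V} ∧ dist Z R = dist R V ∧ Sbtw ℝ R X V ∧ Sbtw ℝ R Y V ∧
    dist Z V = (√5 - 1) * dist Z R ∧ dist Z X ^ 2 < dist X Y ^ 2 + dist Z Y ^ 2 ∧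
    dist Z Y ^ 2 < dist X Y ^ 2 + dist Z X ^ 2

/-- An isosceles triangle with base vertex `X` and base containing `XY`, one leg containing `Z`,
which is critical for rotations of this leg about `Z`. -/
def XCfg (X Y Z : Plane) (D' : Set Plane) : Prop :=
  ∃ (F : Plane ≃ᵃⁱ[ℝ] Plane) (s c k x : ℝ), 0 < s ∧ 1 / 2 < c ∧ 0 < k ∧ c ^ 2 + k ^ 2 = 1 ∧ 0 < x ∧
    x < s ∧ X = F !₂[0, 0] ∧ Y = F !₂[x, 0] ∧ Z = F !₂[s * c, k * (s * (1 - c)) / c] ∧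
    D' = {F !₂[0, 0], F !₂[s / 2, s * k / (2 * c)], F !₂[s, 0]} ∧
    dist X Z ≤ dist X Y ∧ dist Y Z ≤ dist X Z

/-- The possible configurations of an optimal container. -/
def Outcome (D D' : Set Plane) : Prop :=
  ∃ X Y Z : Plane, D = {X, Y, Z} ∧
    (ApexCfg X Y Z D' ∨ BaseCfg X Y Z D' ∨ GammaCfg X Y Z D' ∨ XCfg X Y Z D')

theorem Outcome.map (F : Plane ≃ᵃⁱ[ℝ] Plane) {D D' : Set Plane} (h : Outcome D D') :
    Outcome (F '' D) (F '' D') := by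
  obtain ⟨X, Y, Z, rfl, h⟩ := h
  refine ⟨F X, F Y, F Z, by simp [Set.image_insert_eq], ?_⟩
  have hw : ∀ {a b c : Plane}, Wbtw ℝ a b c → Wbtw ℝ (F a) (F b) (F c) :=
    fun h => h.map F.toAffineEquiv.toAffineMap
  have hs : ∀ {a b c : Plane}, Sbtw ℝ a b c → Sbtw ℝ (F a) (F b) (F c) :=
    fun h => F.toAffineEquiv.sbtw_map_iff.2 h
  rcases h with ⟨Q, rfl, h1, h2⟩ | ⟨Q, rfl, h1, h2⟩ | ⟨R, V, rfl, h1, h2, h3, h4, h5, h6⟩ |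
    ⟨G, s, c, k, x, h1, h2, h3, h4, h5, h6, rfl, rfl, rfl, rfl, h7, h8⟩
  · exact Or.inl ⟨F Q, by simp [Set.image_insert_eq], by simpa using h1, hw h2⟩
  · exact Or.inr (Or.inl ⟨F Q, by simp [Set.image_insert_eq], by simpa using h1, hw h2⟩)
  · exact Or.inr (Or.inr (Or.inl ⟨F R, F V, by simp [Set.image_insert_eq], by simpa using h1,
      hs h2, hs h3, by simpa using h4, by simpa using h5, by simpa using h6⟩))
  · exact Or.inr (Or.inr (Or.inr ⟨G.trans F, s, c, k, x, h1, h2, h3, h4, h5, h6, rfl, rfl, rfl,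
      by simp [Set.image_insert_eq], by simpa using h7, by simpa using h8⟩))

theorem InTri.left (P R S : Plane) : InTri P R S P := ⟨1, 0, 0, by norm_num⟩

theorem InTri.mid (P R S : Plane) : InTri P R S R := ⟨0, 1, 0, by norm_num⟩

theorem InTri.right (P R S : Plane) : InTri P R S S := ⟨0, 0, 1, by norm_num⟩

theorem InTri.of_wbtw_right {P R S X : Plane} (h : Wbtw ℝ R X S) : InTri P R S X := by
  obtain ⟨t, ⟨h0, h1⟩, rfl⟩ := h
  refine ⟨0, 1 - t, t, le_rfl, by linarith, h0, by ring, ?_, ?_⟩ <;>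
    simp [AffineMap.lineMap_apply] <;> ring

theorem InTri.of_wbtw_left {P R S X : Plane} (h : Wbtw ℝ P X R) : InTri P R S X :=
  (InTri.of_wbtw_right h.symm).rev

/-- The basic competitor: the side `OU` is kept as a leg, and the other side at `O` is prolonged to
the same length. Most non-optimal positions are excluded by it. -/
theorem IsMin.le_apex {O U W Q : Plane} {m : ℝ} (hm : IsMin O U W m) (h : dist O U = dist O Q)
    (hW : Wbtw ℝ O W Q) : m ≤ 2 * dist O U + dist U Q := by
  have := hm U O Q (by rw [dist_comm, h]) (InTri.mid _ _ _) (InTri.left _ _ _)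
    (InTri.of_wbtw_right hW)
  rw [dist_comm U O, ← h, dist_comm Q U] at this
  linarith

theorem wbtw_of_coord {A B C : Plane} {t : ℝ} (h0 : 0 ≤ t) (h1 : t ≤ 1)
    (hx : B 0 = A 0 + t * (C 0 - A 0)) (hy : B 1 = A 1 + t * (C 1 - A 1)) : Wbtw ℝ A B C := by
  refine ⟨t, ⟨h0, h1⟩, plane_ext ?_ ?_⟩ <;> simp [AffineMap.lineMap_apply]
  · linarith
  · linarith

theorem exists_unit_of_tan {T : ℝ} (hT : 0 < T) :
    ∃ c k : ℝ, 0 < c ∧ 0 < k ∧ c ^ 2 + k ^ 2 = 1 ∧ k = T * c := by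
  have h : 0 < √(1 + T ^ 2) := Real.sqrt_pos.2 (by positivity)
  have h2 : √(1 + T ^ 2) ^ 2 = 1 + T ^ 2 := Real.sq_sqrt (by positivity)
  refine ⟨1 / √(1 + T ^ 2), T / √(1 + T ^ 2), by positivity, by positivity, ?_, by ring⟩
  field_simp
  rw [h2]

theorem lt_cos_of_tan_lt {c k c' k' T : ℝ} (hc : 0 < c) (hk : 0 < k) (hc' : 0 < c')
    (h : c ^ 2 + k ^ 2 = 1) (h' : c' ^ 2 + k' ^ 2 = 1) (hT : 0 < T)
    (hk' : k' = T * c') (hlt : T * c < k) : c < c' := by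
  subst hk'
  by_contra! hle
  have h1 : c' ^ 2 ≤ c ^ 2 := by nlinarith
  have h2 : (T * c) ^ 2 < k ^ 2 := by nlinarith [mul_pos hT hc]
  nlinarith [mul_le_mul_of_nonneg_left h1 (sq_nonneg T)]

theorem cos_lt_of_lt_tan {c k c' k' T : ℝ} (hc : 0 < c) (hk : 0 < k) (hc' : 0 < c')
    (h : c ^ 2 + k ^ 2 = 1) (h' : c' ^ 2 + k' ^ 2 = 1) (hk' : k' = T * c')
    (hlt : k < T * c) : c' < c := by
  subst hk'
  by_contra! hle
  have h1 : c ^ 2 ≤ c' ^ 2 := by nlinarith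
  have h2 : k ^ 2 < (T * c) ^ 2 := by nlinarith
  nlinarith [mul_le_mul_of_nonneg_left h1 (sq_nonneg T)]

theorem exists_angle {c k : ℝ} (hc : 0 < c) (hk : 0 < k) (h : c ^ 2 + k ^ 2 = 1) :
    ∃ θ : ℝ, Real.cos θ = c ∧ Real.sin θ = k := by
  refine ⟨Real.arcsin k, ?_, Real.sin_arcsin (by linarith) (by nlinarith)⟩
  rw [Real.cos_arcsin, show 1 - k ^ 2 = c ^ 2 by linarith, Real.sqrt_sq hc.le]

/-! ### A vertex of the triangle at the apex of the container -/

namespace Opt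

/-- The vertices of the container in normal position. -/
abbrev stdVerts (s c k : ℝ) : Set Plane := {!₂[0, 0], !₂[s / 2, s * k / (2 * c)], !₂[s, 0]}

/-- Polar coordinates at the apex, with direction `(a, -b)`. The bounds on `a` and `b` say that the
direction lies in the apex sector; the bound on `dist R X * b` says that `X` is not below the base.
-/
theorem polar {s c k : ℝ} {R U W : Plane} (h : Opt R U W s c k)
    (hR : R = !₂[s / 2, s * k / (2 * c)]) {X : Plane} (hX : X = R ∨ X = U ∨ X = W) (hne : X ≠ R) :
    ∃ a b : ℝ, a ^ 2 + b ^ 2 = 1 ∧ k ≤ b ∧ -c ≤ a ∧ a ≤ c ∧ dist R X * b ≤ s * k / (2 * c) ∧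
      X 0 = s / 2 + dist R X * a ∧ X 1 = s * k / (2 * c) - dist R X * b := by
  have hc := h.c_pos
  have hk := h.k_pos
  have hu := h.unit
  have hd : 0 < dist R X := dist_pos.2 (Ne.symm hne)
  have hd2 := dist_sq_coord R X
  obtain ⟨f1, f2, f3⟩ := h.fits X hX
  have hR0 : R 0 = s / 2 := by rw [hR]; simp
  have hR1 : R 1 = s * k / (2 * c) := by rw [hR]; simp
  rw [hR0, hR1] at hd2
  generalize dist R X = d at *
  have e0 : X 0 = s / 2 + d * ((X 0 - s / 2) / d) := by field_simp; ring
  have e1 : X 1 = s * k / (2 * c) - d * ((s * k / (2 * c) - X 1) / d) := by field_simp; ring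
  have hab : ((X 0 - s / 2) / d) ^ 2 + ((s * k / (2 * c) - X 1) / d) ^ 2 = 1 := by
    rw [div_pow, div_pow, ← add_div, hd2, div_eq_one_iff_eq (by rw [← hd2]; positivity)]
    ring
  generalize (X 0 - s / 2) / d = a at *
  generalize (s * k / (2 * c) - X 1) / d = b at *
  have g : c * (s * k / (2 * c)) = s * k / 2 := by field_simp
  have g2 : 0 ≤ d * (k * a + c * b) := by rw [e0, e1] at f2; linarith
  have g3 : 0 ≤ d * (-(k * a) + c * b) := by rw [e0, e1] at f3; linarith
  have g2' : 0 ≤ k * a + c * b := nonneg_of_mul_nonneg_right g2 hd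
  have g3' : 0 ≤ -(k * a) + c * b := nonneg_of_mul_nonneg_right g3 hd
  have hb : 0 ≤ b := by
    apply nonneg_of_mul_nonneg_right _ hc
    linarith
  have hac : a ^ 2 ≤ c ^ 2 := by nlinarith [mul_nonneg g2' g3']
  have hac' := abs_le_of_sq_le_sq' hac hc.le
  refine ⟨a, b, hab, abs_le_of_sq_le_sq' (by linarith) hb |>.2, hac'.1, hac'.2, by linarith, e0, e1⟩

/-- By `hsq` the two unit directions are at distance at least `2 * c`, which is the largest distance
within the apex sector and is attained only by its two boundary rays. -/
theorem opposite_of_chord {c k a b a' b' : ℝ} (hc : 0 < c) (hk : 0 < k) (hu : c ^ 2 + k ^ 2 = 1)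
    (hab : a ^ 2 + b ^ 2 = 1) (hkb : k ≤ b) (ha1 : -c ≤ a) (ha2 : a ≤ c)
    (hab' : a' ^ 2 + b' ^ 2 = 1) (hkb' : k ≤ b') (ha1' : -c ≤ a') (ha2' : a' ≤ c)
    (hsq : (2 * c) ^ 2 ≤ 2 - 2 * (a * a') - 2 * (b * b')) :
    ((a = c ∧ a' = -c) ∨ (a = -c ∧ a' = c)) ∧ b = k ∧ b' = k := by
  have hbb : k ^ 2 ≤ b * b' := by nlinarith
  have haa2 : a * a' ≤ -c ^ 2 := by nlinarith
  have key : (a = c ∧ a' = -c) ∨ (a = -c ∧ a' = c) := by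
    rcases le_or_gt 0 a with ha | ha
    · left
      have h1 : 0 ≤ a * (a' + c) := mul_nonneg ha (by linarith)
      have h2 : c * c ≤ c * a := by linarith
      have h3 : a = c := le_antisymm ha2 (le_of_mul_le_mul_left h2 hc)
      subst h3
      refine ⟨rfl, ?_⟩
      have : a * a' ≤ a * (-a) := by linarith
      exact le_antisymm (le_of_mul_le_mul_left this hc) ha1'
    · right
      have h1 : 0 ≤ (-a) * (c - a') := mul_nonneg (by linarith) (by linarith)
      have h2 : c * c ≤ c * (-a) := by linarith
      have h3 : a = -c := le_antisymm (by linarith [le_of_mul_le_mul_left h2 hc]) ha1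
      subst h3
      refine ⟨rfl, ?_⟩
      have : c * c ≤ c * a' := by linarith
      exact le_antisymm ha2' (le_of_mul_le_mul_left this hc)
  have bk : ∀ {a b : ℝ}, a ^ 2 + b ^ 2 = 1 → k ≤ b → a ^ 2 = c ^ 2 → b = k := by
    intro a b h1 h2 h3
    exact le_antisymm (abs_le_of_sq_le_sq' (by linarith) hk.le).2 h2
  refine ⟨key, bk hab hkb ?_, bk hab' hkb' ?_⟩ <;> rcases key with ⟨h, h'⟩ | ⟨h, h'⟩ <;>
    simp [h, h']

/-- Compare with the triangle of apex `R` and leg `RU`. Its apex angle is at most that of the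
container, so its perimeter is at most `2 * u * (1 + c)` with `u = dist R U`, and minimality makes
`u` at least the old leg. The base line gives the reverse inequality. Equality puts `U` at a base
vertex and `W` on the opposite leg. -/
theorem apex_aux {s c k : ℝ} {R U W : Plane} (h : Opt R U W s c k)
    (hR : R = !₂[s / 2, s * k / (2 * c)])
    (hU : U ≠ R) (hW : W ≠ R) (hle : dist R W ≤ dist R U) : ApexCfg R U W (stdVerts s c k) := by
  have hc := h.c_pos
  have hk := h.k_pos
  have hs := h.s_pos
  have hR0 : R 0 = s / 2 := by rw [hR]; simp
  have hR1 : R 1 = s * k / (2 * c) := by rw [hR]; simp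
  obtain ⟨a, b, hab, hkb, ha1, ha2, hUh, u0, u1⟩ := h.polar hR (X := U) (by simp) hU
  obtain ⟨a', b', hab', hkb', ha1', ha2', hWh, w0, w1⟩ := h.polar hR (X := W) (by simp) hW
  have hu0 : 0 < dist R U := dist_pos.2 (Ne.symm hU)
  have hw0 : 0 < dist R W := dist_pos.2 (Ne.symm hW)
  set u := dist R U with hu_def
  set w := dist R W with hw_def
  obtain ⟨Q, hQ0, hQ1⟩ : ∃ Q : Plane, Q 0 = s / 2 + u * a' ∧ Q 1 = s * k / (2 * c) - u * b' :=
    ⟨!₂[s / 2 + u * a', s * k / (2 * c) - u * b'], by simp, by simp⟩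
  have hRQ : dist R Q = u := by
    apply dist_eq_of_sq hu0.le
    rw [hR0, hR1, hQ0, hQ1]
    linear_combination u ^ 2 * hab'
  have hWQ : Wbtw ℝ R W Q := by
    apply wbtw_of_coord (t := w / u) (by positivity) (div_le_one_of_le₀ hle hu0.le)
    · rw [hR0, w0, hQ0]; field_simp; ring
    · rw [hR1, w1, hQ1]; field_simp; ring
  have hm := h.isMin.le_apex (hu_def.symm.trans hRQ.symm) hWQ
  have hUQ2 : dist U Q ^ 2 = u ^ 2 * (2 - 2 * (a * a') - 2 * (b * b')) := by
    rw [dist_sq_coord, u0, u1, hQ0, hQ1]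
    linear_combination u ^ 2 * hab + u ^ 2 * hab'
  have hUQ : dist U Q ≤ 2 * c * u := by
    apply abs_le_of_sq_le_sq' _ (by positivity) |>.2
    have haa : 0 ≤ c ^ 2 + a * a' := by nlinarith
    have hbb : k ^ 2 ≤ b * b' := by nlinarith
    rw [hUQ2, show (2 * c * u) ^ 2 = u ^ 2 * (4 * c ^ 2) by ring]
    apply mul_le_mul_of_nonneg_left _ (sq_nonneg u)
    linarith [h.unit]
  rw [← hu_def] at hm
  have hl : s * (1 + c) / c = 2 * (s / (2 * c)) * (1 + c) := by field_simp
  have hlu : s / (2 * c) ≤ u := by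
    rw [hl] at hm
    have : (1 + c) * (s / (2 * c)) ≤ (1 + c) * u := by linarith
    exact le_of_mul_le_mul_left this (by positivity)
  have hul : u * b ≤ s / (2 * c) * k := by rw [div_mul_eq_mul_div]; exact hUh
  have hueq : u = s / (2 * c) := by
    apply le_antisymm _ hlu
    have : k * u ≤ k * (s / (2 * c)) := by linarith [mul_le_mul_of_nonneg_left hkb hu0.le]
    exact le_of_mul_le_mul_left this hk
  have hUQ' : 2 * c * u ≤ dist U Q := by rw [hl, ← hueq] at hm; linarith
  have hsq : (2 * c * u) ^ 2 ≤ dist U Q ^ 2 := by gcongr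
  rw [hUQ2] at hsq
  have hsq' : (2 * c) ^ 2 ≤ 2 - 2 * (a * a') - 2 * (b * b') := by
    apply le_of_mul_le_mul_left _ (show 0 < u ^ 2 by positivity)
    linarith
  obtain ⟨key, hb, hb'⟩ := opposite_of_chord hc hk h.unit hab hkb ha1 ha2 hab' hkb' ha1' ha2' hsq'
  clear hsq hsq' hUQ' hul hlu hl hUQ hUQ2 hm hUh hWh hab hab'
  refine ⟨Q, ?_, hRQ.symm, hWQ⟩
  have hR' := hR
  rcases key with ⟨ha, ha'⟩ | ⟨ha, ha'⟩
  · have hUS : U = !₂[s, 0] := by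
      apply plane_ext <;> simp
      · rw [u0, hueq, ha]; field_simp; ring
      · rw [u1, hueq, hb]; field_simp; ring
    have hQV : Q = !₂[0, 0] := by
      apply plane_ext <;> simp
      · rw [hQ0, hueq, ha']; field_simp; ring
      · rw [hQ1, hueq, hb']; field_simp; ring
    rw [hUS, hQV, hR]
    ext x; simp only [stdVerts, Set.mem_insert_iff, Set.mem_singleton_iff]; tauto
  · have hUS : U = !₂[0, 0] := by
      apply plane_ext <;> simp
      · rw [u0, hueq, ha]; field_simp; ring
      · rw [u1, hueq, hb]; field_simp; ring
    have hQV : Q = !₂[s, 0] := by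
      apply plane_ext <;> simp
      · rw [hQ0, hueq, ha']; field_simp; ring
      · rw [hQ1, hueq, hb']; field_simp; ring
    rw [hUS, hQV, hR]
    ext x; simp only [stdVerts, Set.mem_insert_iff, Set.mem_singleton_iff]; tauto

theorem outcome_of_apex {s c k : ℝ} {R U W : Plane} (h : Opt R U W s c k) (hcr : cr R U W ≠ 0)
    (hR : R = !₂[s / 2, s * k / (2 * c)]) : Outcome {R, U, W} (stdVerts s c k) := by
  have hU : U ≠ R := by rintro rfl; exact hcr (by unfold cr; ring)
  have hW : W ≠ R := by rintro rfl; exact hcr (by unfold cr; ring)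
  rcases le_total (dist R W) (dist R U) with hle | hle
  · exact ⟨R, U, W, rfl, Or.inl (h.apex_aux hR hU hW hle)⟩
  · exact ⟨R, W, U, by rw [Set.pair_comm], Or.inl (h.perm_right.apex_aux hR hW hU hle)⟩

end Opt

/-! ### Two vertices on the base -/

namespace Opt

variable {s c k : ℝ} {X Y Z : Plane}

theorem outcome_of_mirror
    (h : Outcome {!₂[s - X 0, X 1], !₂[s - Y 0, Y 1], !₂[s - Z 0, Z 1]} (stdVerts s c k)) :
    Outcome {X, Y, Z} (stdVerts s c k) := by
  obtain ⟨F, hF⟩ := exists_isometry (!₂[s, 0]) (a := -1) (b := 0) (e := -1) (by norm_num)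
    (by norm_num)
  have key : ∀ X : Plane, F !₂[s - X 0, X 1] = X := by
    intro X
    rw [hF]
    apply plane_ext <;> simp
  have h2 := h.map F
  have e : F '' stdVerts s c k = stdVerts s c k := by
    have e1 : F !₂[0, 0] = !₂[s, 0] := by rw [hF]; apply plane_ext <;> simp
    have e2 : F !₂[s, 0] = !₂[0, 0] := by rw [hF]; apply plane_ext <;> simp
    have e3 : F !₂[s / 2, s * k / (2 * c)] = !₂[s / 2, s * k / (2 * c)] := by
      rw [hF]; apply plane_ext <;> simp; ring
    simp only [stdVerts, Set.image_insert_eq, Set.image_singleton, e1, e2, e3]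
    ext x; simp only [Set.mem_insert_iff, Set.mem_singleton_iff]; tauto
  rw [e] at h2
  simpa only [Set.image_insert_eq, Set.image_singleton, key] using h2

theorem baseCfg_of_left (h : Opt X Y Z s c k) (hX : X = !₂[0, 0]) (hY : Y = !₂[s, 0])
    (hZ : 0 < Z 1) (hl : k * Z 0 = c * Z 1) : Outcome {X, Y, Z} (stdVerts s c k) := by
  have hc := h.c_pos
  have hk := h.k_pos
  have hs := h.s_pos
  refine ⟨X, Y, Z, rfl, Or.inr (Or.inl ⟨!₂[s / 2, s * k / (2 * c)], ?_, ?_, ?_⟩)⟩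
  · subst hX hY
    ext x; simp only [stdVerts, Set.mem_insert_iff, Set.mem_singleton_iff]; tauto
  · rw [hX, hY, dist_coord, dist_coord]
    congr 1
    simp; ring
  · have f3 := (h.fits Z (by simp)).2.2
    apply wbtw_of_coord (t := Z 1 * (2 * c) / (s * k)) (by positivity)
    · rw [div_le_one (by positivity)]
      linarith
    · rw [hX]; simp; field_simp; linarith
    · rw [hX]; simp; field_simp

/-- With the base fixed, the perimeter `s * (1 + 1 / c)` decreases as the base angle is lowered, so
the legs can be lowered until one of them meets `Z`. -/
theorem exists_tan_between (h : Opt X Y Z s c k) (hX : X = !₂[0, 0]) (hY : Y = !₂[s, 0])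
    (hZ : 0 < Z 1) : k * Z 0 = c * Z 1 ∨ k * (s - Z 0) = c * Z 1 := by
  by_contra! hcon
  have hc := h.c_pos
  have hk := h.k_pos
  have hs := h.s_pos
  obtain ⟨f1, f2, f3⟩ := h.fits Z (by simp)
  have f2 := lt_of_le_of_ne f2 (Ne.symm hcon.1)
  have f3 := lt_of_le_of_ne f3 (Ne.symm hcon.2)
  have hcZ : 0 < c * Z 1 := by positivity
  have hp : 0 < Z 0 := pos_of_mul_pos_right (by linarith) hk.le
  have hq : 0 < s - Z 0 := pos_of_mul_pos_right (by linarith) hk.le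
  -- The least tangent of a base angle for which `Z` stays inside.
  set T := max (Z 1 / Z 0) (Z 1 / (s - Z 0)) with hT
  have hT1 : Z 1 ≤ T * Z 0 := by rw [← div_le_iff₀ hp]; exact le_max_left _ _
  have hT2 : Z 1 ≤ T * (s - Z 0) := by rw [← div_le_iff₀ hq]; exact le_max_right _ _
  have hT0 : 0 < T := lt_of_lt_of_le (by positivity) (le_max_left _ _)
  have hTk : T * c < k := by
    rw [← lt_div_iff₀ hc, hT, max_lt_iff, div_lt_div_iff₀ hp hc, div_lt_div_iff₀ hq hc]
    constructor <;> linarith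
  obtain ⟨c', k', hc', hk', hu, hkT⟩ := exists_unit_of_tan hT0
  have hlt := lt_cos_of_tan_lt hc hk hc' h.unit hu hT0 hkT hTk
  have := h.isMin.le_upright hu hc' hk' (y := 0) (l := 0) (r := k' * s) (by
    rw [mul_zero, sub_zero, sub_zero]; positivity) (by
    have hX0 : X 0 = 0 := by rw [hX]; simp
    have hX1 : X 1 = 0 := by rw [hX]; simp
    have hY0 : Y 0 = s := by rw [hY]; simp
    have hY1 : Y 1 = 0 := by rw [hY]; simp
    rintro W (rfl | rfl | rfl)
    · rw [hX0, hX1]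
      refine ⟨le_rfl, by simp, ?_⟩
      simp; positivity
    · rw [hY0, hY1]
      refine ⟨le_rfl, ?_, by simp⟩
      simp; positivity
    · rw [hkT]
      refine ⟨f1, ?_, ?_⟩
      · have := mul_le_mul_of_nonneg_left hT1 hc'.le
        linarith
      · have := mul_le_mul_of_nonneg_left hT2 hc'.le
        linarith)
  have e : (k' * s - 0 - 2 * c' * 0) * (1 + c') / (c' * k') = s * (1 + c') / c' := by
    field_simp; ring
  rw [e, div_le_div_iff₀ hc hc'] at this
  have : s * c' ≤ s * c := by linarith
  have := le_of_mul_le_mul_left this hs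
  linarith

/-- The base of an optimal container is not in the interior of the base line between two contact
points. -/
theorem not_interior (h : Opt X Y Z s c k) (hX : X 1 = 0) (hY : Y 1 = 0) (hlt : X 0 < Y 0)
    (hZ : 0 < Z 1) (hX0 : 0 < X 0) (hYs : Y 0 < s) : False := by
  have hc := h.c_pos
  have hk := h.k_pos
  have hs := h.s_pos
  have hl : k * Z 0 - c * Z 1 = 0 := by
    obtain ⟨W, rfl | rfl | rfl, hW⟩ := h.touch_left
    · rw [hX] at hW; nlinarith
    · rw [hY] at hW; nlinarith
    · exact hW
  have hr : k * (s - Z 0) - c * Z 1 = 0 := by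
    obtain ⟨W, rfl | rfl | rfl, hW⟩ := h.touch_right
    · rw [hX] at hW; nlinarith
    · rw [hY] at hW; nlinarith
    · exact hW
  -- Since `Z` touches both legs it is the apex. Keep it and the base line, and steepen the legs
  -- until the half base is `D`, just enough for `X` and `Y`. At fixed height the perimeter `2 * Z 1
  -- * (1 + c) / k` decreases with the base angle.
  set D := max (Z 0 - X 0) (Y 0 - Z 0) with hD
  have hD1 : Z 0 - X 0 ≤ D := le_max_left _ _
  have hD2 : Y 0 - Z 0 ≤ D := le_max_right _ _
  have hD0 : 0 < D := by linarith
  have hkD : k * D < c * Z 1 := by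
    rcases max_cases (Z 0 - X 0) (Y 0 - Z 0) with ⟨e, -⟩ | ⟨e, -⟩ <;> rw [hD, e]
    · have := mul_pos hk hX0
      linarith
    · have := mul_pos hk (sub_pos.2 hYs)
      linarith
  set T := Z 1 / D with hT
  have hT0 : 0 < T := by positivity
  have hTD : T * D = Z 1 := by rw [hT]; field_simp
  have hTk : k < T * c := by
    rw [hT, div_mul_eq_mul_div, lt_div_iff₀ hD0]; linarith
  obtain ⟨c', k', hc', hk', hu, hkT⟩ := exists_unit_of_tan hT0
  have hlt' := cos_lt_of_lt_tan hc hk hc' h.unit hu hkT hTk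
  have := h.isMin.le_upright hu hc' hk' (y := 0) (l := k' * Z 0 - c' * Z 1)
    (r := k' * Z 0 + c' * Z 1) (by
      have : 0 < c' * Z 1 := by positivity
      linarith) (by
    rintro W (rfl | rfl | rfl)
    · rw [hX, hkT, ← hTD]
      have h1 := mul_le_mul_of_nonneg_left hD1 (mul_pos hT0 hc').le
      have h2 := mul_le_mul_of_nonneg_left (show W 0 - Z 0 ≤ D by linarith) (mul_pos hT0 hc').le
      refine ⟨le_rfl, by linarith, by linarith⟩
    · rw [hY, hkT, ← hTD]
      have h1 := mul_le_mul_of_nonneg_left hD2 (mul_pos hT0 hc').le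
      have h2 := mul_le_mul_of_nonneg_left (show Z 0 - W 0 ≤ D by linarith) (mul_pos hT0 hc').le
      refine ⟨le_rfl, by linarith, by linarith⟩
    · exact ⟨hZ.le, le_rfl, le_rfl⟩)
  have e : (k' * Z 0 + c' * Z 1 - (k' * Z 0 - c' * Z 1) - 2 * c' * 0) * (1 + c') / (c' * k') =
      2 * Z 1 * (1 + c') / k' := by
    field_simp; ring
  have hm : s * (1 + c) / c = 2 * Z 1 * (1 + c) / k := by
    rw [div_eq_div_iff hc.ne' hk.ne']
    linear_combination (1 + c) * hl + (1 + c) * hr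
  have hkk : k < k' := by
    have := h.unit
    nlinarith
  rw [e, hm, div_le_div_iff₀ hk hk'] at this
  have h1 : 2 * Z 1 * ((1 + c) * k') ≤ 2 * Z 1 * ((1 + c') * k) := by linarith
  have h2 := le_of_mul_le_mul_left h1 (by positivity)
  nlinarith

open Filter Topology in
/-- The stationarity condition for rotations of a leg about the contact point `Z`. -/
theorem stationary_leg (h : Opt X Y Z s c k) (hX : X = !₂[0, 0]) (hY1 : Y 1 = 0) (hY0 : 0 < Y 0)
    (hYs : Y 0 < s) (hZ : 0 < Z 1) (hr : k * (s - Z 0) = c * Z 1) (hl : c * Z 1 < k * Z 0) :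
    Z 0 = s * c := by
  have hc := h.c_pos
  have hk := h.k_pos
  have hs := h.s_pos
  have hu := h.unit
  obtain ⟨θ, hcθ, hkθ⟩ := exists_angle hc hk hu
  have hcZ : 0 < c * Z 1 := by positivity
  have hp : 0 < Z 0 := pos_of_mul_pos_right (by linarith) hk.le
  -- Perimeter as a function of the base angle `t` when the right leg pivots about `Z`: the first
  -- factor is the base, and the left leg turns about the origin. All other constraints are strict
  -- at `θ`, so these triangles are containers nearby.
  let G : ℝ → ℝ := fun t => (Z 0 + Z 1 * (Real.cos t / Real.sin t)) * (1 + 1 / Real.cos t)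
  have hsZ : Z 0 + Z 1 * (c / k) = s := by field_simp; linarith
  have hGθ : G θ = s * (1 + c) / c := by
    simp only [G, hcθ, hkθ, hsZ]; field_simp; ring
  have ev1 : ∀ᶠ t in 𝓝 θ, 0 < Real.cos t :=
    Real.continuous_cos.continuousAt.eventually_const_lt (by rw [hcθ]; exact hc)
  have ev2 : ∀ᶠ t in 𝓝 θ, 0 < Real.sin t :=
    Real.continuous_sin.continuousAt.eventually_const_lt (by rw [hkθ]; exact hk)
  have ev3 : ∀ᶠ t in 𝓝 θ, Real.cos t * Z 1 < Real.sin t * Z 0 :=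
    ContinuousAt.eventually_lt (by fun_prop) (by fun_prop) (by rw [hcθ, hkθ]; exact hl)
  have ev4 : ∀ᶠ t in 𝓝 θ, Real.sin t * Y 0 < Real.sin t * Z 0 + Real.cos t * Z 1 :=
    ContinuousAt.eventually_lt (by fun_prop) (by fun_prop) (by
      rw [hcθ, hkθ]
      have := mul_lt_mul_of_pos_left hYs hk
      linarith)
  have hmin : IsLocalMin G θ := by
    filter_upwards [ev1, ev2, ev3, ev4] with t h1 h2 h3 h4
    rw [hGθ]
    have hX0 : X 0 = 0 := by rw [hX]; simp
    have hX1 : X 1 = 0 := by rw [hX]; simp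
    have := h.isMin.le_upright (Real.cos_sq_add_sin_sq t) h1 h2 (y := 0) (l := 0)
      (r := Real.sin t * Z 0 + Real.cos t * Z 1) (by
        have := mul_pos h2 hp
        have := mul_pos h1 hZ
        linarith) (by
        have g1 := mul_pos h2 hp
        have g2 := mul_pos h1 hZ
        have g3 := mul_pos h2 hY0
        rintro W (rfl | rfl | rfl)
        · rw [hX0, hX1]
          exact ⟨le_rfl, by simp, by simp; linarith⟩
        · rw [hY1]
          exact ⟨le_rfl, by simp; linarith, by simp; linarith⟩
        · exact ⟨hZ.le, by linarith, le_rfl⟩)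
    refine this.trans_eq ?_
    simp only [G]
    field_simp
    ring
  have hd : HasDerivAt G ((Z 1 * ((-Real.sin θ * Real.sin θ - Real.cos θ * Real.cos θ) /
      Real.sin θ ^ 2)) * (1 + 1 / Real.cos θ) + (Z 0 + Z 1 * (Real.cos θ / Real.sin θ)) *
      (-(-Real.sin θ) / Real.cos θ ^ 2)) θ := by
    refine HasDerivAt.mul ?_ ?_
    · refine HasDerivAt.const_add _ (HasDerivAt.const_mul _ ?_)
      exact (Real.hasDerivAt_cos θ).div (Real.hasDerivAt_sin θ) (by rw [hkθ]; exact hk.ne')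
    · refine HasDerivAt.const_add _ ?_
      simp only [one_div]
      exact (Real.hasDerivAt_cos θ).inv (by rw [hcθ]; exact hc.ne')
  have h0 := hmin.hasDerivAt_eq_zero hd
  rw [hcθ, hkθ, hsZ] at h0
  field_simp at h0
  have e1 : (k * (1 + c)) * (Z 0 - s * c) = 0 := by
    linear_combination h0 + (Z 1 * c * (c + 1) - k * s) * hu - (1 + c) * hr
  rcases mul_eq_zero.1 e1 with e | e
  · exact absurd e (by positivity)
  · linarith

end Opt

namespace Opt

variable {s c k : ℝ} {X Y Z : Plane}

theorem xCfg_of_stationary (h : Opt X Y Z s c k) (hX : X = !₂[0, 0]) (hY1 : Y 1 = 0)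
    (hY0 : 0 < Y 0) (hYs : Y 0 < s) (hZ : 0 < Z 1) (hr : k * (s - Z 0) = c * Z 1)
    (hl : c * Z 1 < k * Z 0) : XCfg X Y Z (stdVerts s c k) := by
  have hp := h.stationary_leg hX hY1 hY0 hYs hZ hr hl
  have hc := h.c_pos
  have hk := h.k_pos
  have hs := h.s_pos
  have hu := h.unit
  have hq : Z 1 = k * (s * (1 - c)) / c := by
    rw [eq_div_iff hc.ne']; rw [hp] at hr; linarith
  have hc1 : c < 1 := by nlinarith
  have hc2 : 1 / 2 < c := by
    rw [← hr, hp] at hl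
    have h1 : (k * s) * (1 - c) < (k * s) * c := by linarith
    have := lt_of_mul_lt_mul_left h1 (by positivity)
    linarith
  have hX0 : X 0 = 0 := by rw [hX]; simp
  have hX1 : X 1 = 0 := by rw [hX]; simp
  have hYeq : Y = !₂[Y 0, 0] := plane_ext (by simp) (by simpa using hY1)
  have hXY : dist X Y = Y 0 := dist_eq_of_sq hY0.le (by rw [hX0, hX1, hY1]; ring)
  have hXZ : dist X Z ^ 2 = (s * c) ^ 2 + (Z 1) ^ 2 := by
    rw [dist_sq_coord, hX0, hX1, hp]; ring
  have hw : dist X Z < s := by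
    apply lt_of_pow_lt_pow_left₀ 2 hs.le
    rw [hXZ, hq]
    have e : s ^ 2 - ((s * c) ^ 2 + (k * (s * (1 - c)) / c) ^ 2) =
        s ^ 2 * k ^ 2 * (2 * c - 1) / c ^ 2 := by
      field_simp
      linear_combination -(c ^ 2) * hu
    have : 0 < s ^ 2 * k ^ 2 * (2 * c - 1) / c ^ 2 := by
      have : 0 < 2 * c - 1 := by linarith
      positivity
    linarith
  have hwY : dist X Z ≤ dist X Y := by
    rw [hXY]
    -- If `XZ` were longer than `XY`, take apex `X` and leg `XZ`, the other leg running along the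
    -- base. By the triangle inequality through `(s, 0)` its perimeter is at most `w + s + s * (1 -
    -- c) / c`, less than the optimal one as `w < s`.
    by_contra! hcon
    set w := dist X Z with hwd
    have hw0 : 0 < w := by linarith
    have hm := h.isMin.perm_right.le_apex (Q := !₂[w, 0]) (by
      rw [← hwd]
      symm
      apply dist_eq_of_sq hw0.le
      simp [hX0, hX1]) (wbtw_of_coord (t := Y 0 / w) (by positivity)
        (div_le_one_of_le₀ hcon.le hw0.le) (by simp [hX0]; field_simp) (by simp [hX1, hY1]))
    have h1 : dist Z !₂[s, 0] = s * (1 - c) / c := by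
      apply dist_eq_of_sq
      · have : 0 < 1 - c := by linarith
        positivity
      · rw [hp, hq]
        simp
        field_simp
        linear_combination (1 - c) ^ 2 * hu
    have h2 : dist (!₂[s, 0] : Plane) !₂[w, 0] = s - w :=
      dist_eq_of_sq (by linarith) (by simp)
    have h3 := dist_triangle Z !₂[s, 0] !₂[w, 0]
    have h4 : s * (1 + c) / c = s + s * (1 - c) / c + s := by field_simp; ring
    rw [← hwd] at hm
    linarith
  refine ⟨AffineIsometryEquiv.refl ℝ Plane, s, c, k, Y 0, hs, hc2, hk, hu, hY0, hYs, hX, hYeq,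
    plane_ext hp hq, rfl, hwY, ?_⟩
  refine (pow_le_pow_iff_left₀ dist_nonneg dist_nonneg two_ne_zero).1 ?_
  rw [hXZ, dist_sq_coord, hY1, hp]
  have : s < 2 * (s * c) := by nlinarith
  nlinarith

/-- If `Y` is the other base vertex, `XY` is the base. Otherwise `Z` must touch the right leg: if it
touches both legs it is the apex, and if not, that leg can pivot about it. -/
theorem outcome_of_base_left (h : Opt X Y Z s c k) (hX : X = !₂[0, 0]) (hY1 : Y 1 = 0)
    (hY0 : 0 < Y 0) (hZ : 0 < Z 1) : Outcome {X, Y, Z} (stdVerts s c k) := by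
  have hc := h.c_pos
  have hk := h.k_pos
  have hs := h.s_pos
  have hX0 : X 0 = 0 := by rw [hX]; simp
  have hX1 : X 1 = 0 := by rw [hX]; simp
  have hYs : Y 0 ≤ s := by
    have := (h.fits Y (by simp)).2.2
    rw [hY1, mul_zero] at this
    linarith [nonneg_of_mul_nonneg_right this hk]
  rcases hYs.eq_or_lt with hYs | hYs
  · have hY : Y = !₂[s, 0] := plane_ext (by simpa using hYs) (by simpa using hY1)
    rcases h.exists_tan_between hX hY hZ with hl | hr
    · exact h.baseCfg_of_left hX hY hZ hl
    · apply outcome_of_mirror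
      have := h.mirror.perm_left.baseCfg_of_left (plane_ext (by simp [hY]) (by simp [hY]))
        (plane_ext (by simp [hX]) (by simp [hX])) (by simpa using hZ) (by simpa using hr)
      rwa [Set.insert_comm] at this
  · have hr : k * (s - Z 0) - c * Z 1 = 0 := by
      obtain ⟨W, rfl | rfl | rfl, hW⟩ := h.touch_right
      · rw [hX0, hX1] at hW; nlinarith
      · rw [hY1] at hW; nlinarith
      · exact hW
    rcases (h.fits Z (by simp)).2.1.eq_or_lt with hl | hl
    · have hZ0 : Z 0 = s / 2 := by
        have : k * (Z 0) = k * (s / 2) := by linarith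
        exact mul_left_cancel₀ hk.ne' this
      have hZR : Z = !₂[s / 2, s * k / (2 * c)] := by
        refine plane_ext hZ0 ?_
        simp
        rw [eq_div_iff (by positivity)]
        rw [hZ0] at hl
        linarith
      have := h.perm_right.perm_left.outcome_of_apex (by
        unfold cr
        rw [hX0, hX1, hY1]
        have : Z 1 * Y 0 ≠ 0 := by positivity
        convert this using 1
        ring) hZR
      rwa [Set.insert_comm, Set.pair_comm Z Y] at this
    · exact ⟨X, Y, Z, rfl, Or.inr (Or.inr (Or.inr
        (h.xCfg_of_stationary hX hY1 hY0 hYs hZ (by linarith) hl)))⟩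

theorem outcome_of_base (h : Opt X Y Z s c k) (hX1 : X 1 = 0) (hY1 : Y 1 = 0)
    (hlt : X 0 < Y 0) (hZ : 0 < Z 1) : Outcome {X, Y, Z} (stdVerts s c k) := by
  have hk := h.k_pos
  have hX0 : 0 ≤ X 0 := by
    have := (h.fits X (by simp)).2.1
    rw [hX1, mul_zero] at this
    exact nonneg_of_mul_nonneg_right this hk
  have hYs : Y 0 ≤ s := by
    have := (h.fits Y (by simp)).2.2
    rw [hY1, mul_zero] at this
    linarith [nonneg_of_mul_nonneg_right this hk]
  rcases hX0.eq_or_lt with hX0 | hX0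
  · exact h.outcome_of_base_left (plane_ext hX0.symm hX1) hY1 (by linarith) hZ
  · rcases hYs.eq_or_lt with hYs | hYs
    · apply outcome_of_mirror
      have := h.mirror.perm_left.outcome_of_base_left (plane_ext (by simp [hYs]) (by simp [hY1]))
        (by simpa using hX1) (by simp; linarith) (by simpa using hZ)
      rwa [Set.insert_comm] at this
    · exact (h.not_interior hX1 hY1 hlt hZ hX0 hYs).elim

end Opt

/-! ### Two vertices on a leg -/

namespace Opt

variable {s c k : ℝ} {X Y Z : Plane}

open Filter Topology in
/-- The stationarity condition for the base angle of a container whose leg `VR` is a fixed line and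
whose base vertex `S` is a fixed point. -/
theorem golden_of_leg (h : Opt X Y Z s c k) {b₁ b₂ : ℝ} (hX : X = !₂[b₁ * c, b₁ * k])
    (hY : Y = !₂[b₂ * c, b₂ * k]) (hZ : Z = !₂[s, 0]) (hb₁ : 0 < b₁) (hb : b₁ < b₂)
    (hb₂ : b₂ < s / (2 * c)) : c ^ 2 + c = 1 := by
  have hc := h.c_pos
  have hk := h.k_pos
  have hs := h.s_pos
  have hu := h.unit
  obtain ⟨θ, hcθ, hkθ⟩ := exists_angle hc hk hu
  -- The altitude from `S` to the fixed line of the leg is `s * k`, so at base angle `t` the base is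
  -- `s * k / sin t` and the legs are `s * k / (2 * sin t * cos t)`.
  let G : ℝ → ℝ := fun t => s * k * ((1 + Real.cos t) / (Real.sin t * Real.cos t))
  have hGθ : G θ = s * (1 + c) / c := by
    simp only [G, hcθ, hkθ]; field_simp
  have ev1 : ∀ᶠ t in 𝓝 θ, 0 < Real.cos t :=
    Real.continuous_cos.continuousAt.eventually_const_lt (by rw [hcθ]; exact hc)
  have ev2 : ∀ᶠ t in 𝓝 θ, 0 < Real.sin t :=
    Real.continuous_sin.continuousAt.eventually_const_lt (by rw [hkθ]; exact hk)
  have ev3 : ∀ᶠ t in 𝓝 θ, s * c * Real.sin t - s * k * Real.cos t < b₁ * Real.sin t :=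
    ContinuousAt.eventually_lt (by fun_prop) (by fun_prop) (by
      rw [hcθ, hkθ]
      have := mul_pos hb₁ hk
      linarith)
  have ev4 : ∀ᶠ t in 𝓝 θ, b₂ * (2 * Real.sin t * Real.cos t) <
      2 * (s * c * Real.sin t - s * k * Real.cos t) * Real.cos t + s * k :=
    ContinuousAt.eventually_lt (by fun_prop) (by fun_prop) (by
      rw [hcθ, hkθ]
      rw [lt_div_iff₀ (by positivity)] at hb₂
      have := mul_lt_mul_of_pos_left hb₂ hk
      linarith)
  have hmin : IsLocalMin G θ := by
    filter_upwards [ev1, ev2, ev3, ev4] with t h1 h2 h3 h4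
    have hcs := Real.cos_sq_add_sin_sq t
    rw [hGθ]
    simp only [G]
    generalize Real.cos t = C at *
    generalize Real.sin t = K at *
    -- Along the fixed line, `p` is the position of the new base vertex and `p + l` that of the new
    -- apex; both points of contact lie between them.
    set p := s * c - s * k * C / K with hp
    set l := s * k / (2 * K * C) with hl
    have hl0 : 0 < l := by positivity
    have hpb : p < b₁ := by
      have : p = (s * c * K - s * k * C) / K := by rw [hp]; field_simp
      rwa [this, div_lt_iff₀ h2]
    have hlb : b₂ < p + l := by
      have : p + l = (2 * (s * c * K - s * k * C) * C + s * k) / (2 * K * C) := by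
        rw [hp, hl]; field_simp
      rwa [this, lt_div_iff₀ (by positivity)]
    have wb : ∀ b, p ≤ b → b ≤ p + l →
        Wbtw ℝ (!₂[(p + l) * c, (p + l) * k] : Plane) !₂[b * c, b * k] !₂[p * c, p * k] := by
      intro b hb1 hb2
      apply wbtw_of_coord (t := (p + l - b) / l) (div_nonneg (by linarith) hl0.le)
      · rw [div_le_one hl0]; linarith
      · simp; field_simp; ring
      · simp; field_simp; ring
    have d1 : dist (!₂[(p + l) * c, (p + l) * k] : Plane) !₂[p * c, p * k] = l := by
      apply dist_eq_of_sq hl0.le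
      simp
      linear_combination l ^ 2 * hu
    have d2 : dist (!₂[s, 0] : Plane) !₂[p * c, p * k] = s * k / K := by
      apply dist_eq_of_sq (by positivity)
      simp
      rw [hp]
      field_simp
      linear_combination (K ^ 2 * (c ^ 2 - 1) - 2 * K * c * k * C + k ^ 2 * C ^ 2) * hu +
        k ^ 2 * hcs
    have d3 : dist (!₂[s, 0] : Plane) !₂[(p + l) * c, (p + l) * k] = l := by
      apply dist_eq_of_sq hl0.le
      simp
      have e : s * k = l * (2 * K * C) := by rw [hl]; field_simp
      have e2 : p + l = s * c + l * (1 - 2 * C ^ 2) := by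
        rw [hp, e]; field_simp; ring
      rw [e2]
      have : (s - (s * c + l * (1 - 2 * C ^ 2)) * c) ^ 2 + ((s * c + l * (1 - 2 * C ^ 2)) * k) ^ 2 =
          (s * k) ^ 2 + l ^ 2 * (1 - 2 * C ^ 2) ^ 2 := by
        linear_combination (l ^ 2 * (1 - 2 * C ^ 2) ^ 2 + s ^ 2 * (c ^ 2 - 1) +
          2 * s * c * l * (1 - 2 * C ^ 2)) * hu
      rw [this, e]
      linear_combination (4 * C ^ 2 * l ^ 2) * hcs
    have := h.isMin !₂[s, 0] !₂[(p + l) * c, (p + l) * k] !₂[p * c, p * k] (by rw [d1, d3])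
      (by rw [hX]; exact InTri.of_wbtw_right (wb b₁ hpb.le (by linarith)))
      (by rw [hY]; exact InTri.of_wbtw_right (wb b₂ (by linarith) hlb.le))
      (by rw [hZ]; exact InTri.left _ _ _)
    rw [dist_comm !₂[p * c, p * k], d1, d2, d3] at this
    refine this.trans_eq ?_
    rw [hl]
    field_simp
    ring
  have hd : HasDerivAt G (s * k * (((-Real.sin θ) * (Real.sin θ * Real.cos θ) -
      (1 + Real.cos θ) * (Real.cos θ * Real.cos θ + Real.sin θ * (-Real.sin θ))) /
      (Real.sin θ * Real.cos θ) ^ 2)) θ := by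
    refine HasDerivAt.const_mul _ (HasDerivAt.div ?_ ?_ ?_)
    · exact (Real.hasDerivAt_cos θ).const_add _
    · exact (Real.hasDerivAt_sin θ).mul (Real.hasDerivAt_cos θ)
    · rw [hcθ, hkθ]; positivity
  have h0 := hmin.hasDerivAt_eq_zero hd
  rw [hcθ, hkθ] at h0
  have h1 : (-k * (k * c) - (1 + c) * (c * c + k * -k)) = 0 := by
    rcases mul_eq_zero.1 h0 with h0 | h0
    · exact absurd h0 (by positivity)
    · rcases div_eq_zero_iff.1 h0 with h0 | h0
      · exact h0
      · exact absurd h0 (by positivity)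
  have h2 : (1 + c) * (c ^ 2 + c - 1) = 0 := by
    linear_combination -h1 + hu
  rcases mul_eq_zero.1 h2 with h2 | h2
  · exact absurd h2 (by positivity)
  · linarith

-- The perimeter of an isosceles triangle of leg `r`, the square root being the ratio of base to leg
-- and its inner quotient the cosine of the apex angle. Its derivative at `l` is `2 * (1 + c) * (e -
-- l * c * (1 - c)) / e`, which is positive because `c * (1 - c) ≤ 1 / 4` and `l < 2 * e`. So
-- shortening the leg helps.
open Filter Topology in
theorem not_eventually_le_of_slope {c e l N w : ℝ} (hc : 0 < c) (he : 0 < e) (hl : 0 < l) (hle : l < 2 * e)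
    (hE : √(l ^ 2 - 2 * l * N + w ^ 2) = e) (hN : l - N = (1 - 2 * c ^ 2) * e) :
    ¬ ∀ᶠ r in 𝓝[<] l,
      2 * l + l * √(2 - 2 * ((l - N) / √(l ^ 2 - 2 * l * N + w ^ 2))) ≤
      2 * r + r * √(2 - 2 * ((r - N) / √(r ^ 2 - 2 * r * N + w ^ 2))) := by
  intro ev
  have hNl : (l - N) / √(l ^ 2 - 2 * l * N + w ^ 2) = 1 - 2 * c ^ 2 := by
    rw [hE, hN]; field_simp
  have hsq : √(2 - 2 * (1 - 2 * c ^ 2)) = 2 * c := by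
    rw [show 2 - 2 * (1 - 2 * c ^ 2) = (2 * c) ^ 2 by ring, Real.sqrt_sq (by positivity)]
  have hpos : l ^ 2 - 2 * l * N + w ^ 2 ≠ 0 := by
    intro h0
    rw [h0, Real.sqrt_zero] at hE
    linarith
  have hin0 : 2 - 2 * ((l - N) / √(l ^ 2 - 2 * l * N + w ^ 2)) ≠ 0 := by
    rw [hNl]
    have : 2 - 2 * (1 - 2 * c ^ 2) = (2 * c) ^ 2 := by ring
    rw [this]; positivity
  have hq : HasDerivAt (fun r : ℝ => r ^ 2 - 2 * r * N + w ^ 2) (2 * l - 2 * N) l := by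
    have h1 := ((hasDerivAt_pow 2 l).sub ((hasDerivAt_id l).const_mul (2 * N))).add_const (w ^ 2)
    refine (h1.congr_of_eventuallyEq (Eventually.of_forall fun r => ?_)).congr_deriv ?_
    · simp; ring
    · simp
  have hd := ((hasDerivAt_id l).const_mul 2).add ((hasDerivAt_id l).mul
    (HasDerivAt.sqrt (HasDerivAt.const_sub 2 (HasDerivAt.const_mul 2
      (((hasDerivAt_id l).sub_const N).div (hq.sqrt hpos) (by rw [hE]; exact he.ne')))) hin0))
  have hlim := (hasDerivAt_iff_tendsto_slope.1 hd).mono_left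
    (nhdsWithin_mono l (s := Set.Iio l) (fun x (hx : x < l) => hx.ne))
  have hle0 := le_of_tendsto hlim (b := 0) (by
    filter_upwards [ev, self_mem_nhdsWithin] with r h1 h2
    rw [slope_def_field]
    exact div_nonpos_of_nonneg_of_nonpos (sub_nonneg.2 h1) (sub_nonpos.2 (le_of_lt h2)))
  simp only [id, Pi.div_apply] at hle0
  rw [hNl, hsq, hE, hN, show 2 * l - 2 * N = 2 * ((1 - 2 * c ^ 2) * e) by linarith] at hle0
  have e1 : 2 * (1 + c) * (e - l * (c * (1 - c))) / e ≤ 0 := by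
    refine le_trans (le_of_eq ?_) hle0
    field_simp
    ring
  have hcc : c * (1 - c) ≤ 1 / 4 := by nlinarith [sq_nonneg (c - 1 / 2)]
  have : 0 < 2 * (1 + c) * (e - l * (c * (1 - c))) / e := by
    have : 0 < e - l * (c * (1 - c)) := by
      have := mul_le_mul_of_nonneg_left hcc hl.le
      linarith
    positivity
  linarith

open Filter Topology in
/-- A container one of whose legs contains two points, and the other leg the third one, is not
optimal if the apex is far from the third point. -/
theorem far_leg_contact_false (h : Opt X Y Z s c k) {l a b : ℝ} (hsl : s = 2 * c * l)
    (hX : X = !₂[0, 0]) (hY : Y = !₂[b * c, b * k]) (hZ : Z = !₂[s - a * c, a * k]) (hb0 : 0 < b)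
    (hbl : b < l) (ha : 0 < a) (hal : a < l) (hfar : dist X Z < l - a) : False := by
  have hc := h.c_pos
  have hk := h.k_pos
  have hs := h.s_pos
  have hu := h.unit
  set w := dist X Z with hw
  have hw0 : 0 ≤ w := dist_nonneg
  have hw2 : w ^ 2 = s ^ 2 - 2 * s * a * c + a ^ 2 := by
    rw [hw, dist_sq_coord, hX, hZ]; simp
    linear_combination a ^ 2 * hu
  set N := c * (s - a * c) + k * (a * k) with hN
  -- The apex slides to `r * (c, k)` on the left leg and the other leg is drawn through `Z`. `E r`
  -- is the distance from the apex to `Z`, `(r - N) / E r` the cosine of the apex angle, and `G r`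
  -- the perimeter.
  let E : ℝ → ℝ := fun r => √(r ^ 2 - 2 * r * N + w ^ 2)
  let G : ℝ → ℝ := fun r => 2 * r + r * √(2 - 2 * ((r - N) / E r))
  have hEl : E l = l - a := by
    simp only [E]
    rw [show l ^ 2 - 2 * l * N + w ^ 2 = (l - a) ^ 2 by
      rw [hw2, hN, hsl]
      linear_combination -2 * l * a * hu, Real.sqrt_sq (by linarith)]
  have hNl : (l - N) / (l - a) = 1 - 2 * c ^ 2 := by
    rw [div_eq_iff (by linarith), hN, hsl]
    linear_combination -a * hu
  have hsq : √(2 - 2 * (1 - 2 * c ^ 2)) = 2 * c := by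
    rw [show 2 - 2 * (1 - 2 * c ^ 2) = (2 * c) ^ 2 by ring, Real.sqrt_sq (by positivity)]
  have hGl : G l = s * (1 + c) / c := by
    simp only [G, hEl, hNl, hsq, hsl]
    field_simp
  have hEc : Continuous E := by fun_prop
  have ev : ∀ᶠ r in 𝓝[<] l, G l ≤ G r := by
    have ev1 : ∀ᶠ r in 𝓝[<] l, b < r :=
      nhdsWithin_le_nhds (eventually_gt_nhds hbl)
    have ev2 : ∀ᶠ r in 𝓝[<] l, E r < r := nhdsWithin_le_nhds
      (ContinuousAt.eventually_lt hEc.continuousAt continuousAt_id (by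
        change E l < l; linarith))
    have ev3 : ∀ᶠ r in 𝓝[<] l, 0 < E r := nhdsWithin_le_nhds
      (hEc.continuousAt.eventually_const_lt (by linarith))
    filter_upwards [ev1, ev2, ev3] with r h1 h2 h3
    have hr0 : 0 < r := by linarith
    have hEsq : E r ^ 2 = r ^ 2 - 2 * r * N + w ^ 2 := by
      have : 0 < r ^ 2 - 2 * r * N + w ^ 2 := Real.sqrt_pos.1 h3
      exact Real.sq_sqrt this.le
    rw [hGl]
    generalize hEr : E r = e at *
    have hnn : N ^ 2 ≤ w ^ 2 := by
      have : w ^ 2 = (s - a * c) ^ 2 + (a * k) ^ 2 := by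
        rw [hw2]; linear_combination -a ^ 2 * hu
      rw [this, hN]
      have e2 : (s - a * c) ^ 2 + (a * k) ^ 2 - (c * (s - a * c) + k * (a * k)) ^ 2 =
          (k * (s - a * c) - c * (a * k)) ^ 2 := by
        linear_combination -((s - a * c) ^ 2 + (a * k) ^ 2) * hu
      nlinarith [sq_nonneg (k * (s - a * c) - c * (a * k))]
    have hin : 0 ≤ 2 - 2 * ((r - N) / e) := by
      have : (r - N) / e ≤ 1 := by
        rw [div_le_one h3]
        apply abs_le_of_sq_le_sq' _ h3.le |>.2
        nlinarith
      linarith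
    have hq : (s - a * c - r * c) ^ 2 + (a * k - r * k) ^ 2 = e ^ 2 := by
      rw [hEsq, hw2, hN]
      linear_combination (a ^ 2 + r ^ 2) * hu
    have hq2 : c * (s - a * c - r * c) + k * (a * k - r * k) = N - r := by
      rw [hN]; linear_combination -r * hu
    let R : Plane := !₂[r * c, r * k]
    let S : Plane := !₂[r * c + r / e * (s - a * c - r * c), r * k + r / e * (a * k - r * k)]
    have d1 : dist X R = r := by
      apply dist_eq_of_sq hr0.le
      rw [hX]; simp [R]
      linear_combination r ^ 2 * hu
    have d2 : dist R S = r := by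
      apply dist_eq_of_sq hr0.le
      simp [R, S]
      rw [mul_pow, mul_pow, ← mul_add, hq]
      field_simp
    have d3 : dist S X = r * √(2 - 2 * ((r - N) / e)) := by
      apply dist_eq_of_sq (by positivity)
      rw [mul_pow, Real.sq_sqrt hin, hX]
      simp [S]
      have e1 : (r * c + r / e * (s - a * c - r * c)) ^ 2 +
          (r * k + r / e * (a * k - r * k)) ^ 2 = r ^ 2 * (c ^ 2 + k ^ 2) +
          2 * r ^ 2 / e * (c * (s - a * c - r * c) + k * (a * k - r * k)) +
          (r / e) ^ 2 * ((s - a * c - r * c) ^ 2 + (a * k - r * k) ^ 2) := by ring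
      rw [e1, hu, hq, hq2]
      field_simp
      ring
    have := h.isMin X R S (d1.trans d2.symm) (InTri.left _ _ _)
      (InTri.of_wbtw_left (wbtw_of_coord (t := b / r) (by positivity)
        (div_le_one_of_le₀ h1.le hr0.le) (by rw [hX, hY]; simp [R]; field_simp)
        (by rw [hX, hY]; simp [R]; field_simp)))
      (InTri.of_wbtw_right (wbtw_of_coord (t := e / r) (by positivity)
        (div_le_one_of_le₀ h2.le hr0.le) (by rw [hZ]; simp [R, S]; field_simp; ring)
        (by rw [hZ]; simp [R, S]; field_simp; ring)))
    rw [d1, d2, d3] at this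
    refine this.trans_eq ?_
    simp only [G, hEr]
    ring
  have hla : 0 < l - a := by linarith
  have hwa : a ≤ w := by
    refine (pow_le_pow_iff_left₀ ha.le hw0 two_ne_zero).1 ?_
    rw [hw2, hsl]
    have : 0 < 4 * c ^ 2 * l * (l - a) := by
      have : 0 < l := by linarith
      positivity
    linarith
  refine not_eventually_le_of_slope hc hla (by linarith) (by linarith) hEl ?_ ev
  · rw [← hNl]; field_simp

end Opt

namespace Opt

variable {s c k : ℝ} {A B C X Y Z : Plane}

/-- Three competitors, according to `w = dist X Z`. If `w < l - a`, slide the apex towards `X`. If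
`b ≤ w`, take apex `X` and leg `XZ`. If `w < b`, take apex `X` and leg `XY`. -/
theorem leg_contact_false (h : Opt X Y Z s c k) {l a b : ℝ} (hsl : s = 2 * c * l)
    (hX : X = !₂[0, 0]) (hY : Y = !₂[b * c, b * k]) (hZ : Z = !₂[s - a * c, a * k]) (hb0 : 0 < b)
    (hbl : b < l) (ha : 0 < a) (hal : a < l) : False := by
  have hc := h.c_pos
  have hk := h.k_pos
  have hs := h.s_pos
  have hu := h.unit
  have hl0 : 0 < l := by linarith
  have hX0 : X 0 = 0 := by rw [hX]; simp
  have hX1 : X 1 = 0 := by rw [hX]; simp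
  have hY0 : Y 0 = b * c := by rw [hY]; simp
  have hY1 : Y 1 = b * k := by rw [hY]; simp
  have hZ0 : Z 0 = s - a * c := by rw [hZ]; simp
  have hZ1 : Z 1 = a * k := by rw [hZ]; simp
  have hbk : 0 < b * k := by positivity
  have hak : 0 < a * k := by positivity
  have hck : 0 < c * k := by positivity
  have hrot := h.rotation_pos (x₀ := 0) (a₀ := a) (b₀ := 0)
    (by
      rintro W (rfl | rfl | rfl) hW
      · exact hX0.le
      · rw [hY1] at hW; linarith
      · rw [hZ1] at hW; linarith)
    (by
      rintro W (rfl | rfl | rfl) hW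
      · rw [hX0, hX1] at hW; have := mul_pos hk hs; linarith
      · rw [hY0, hY1, hsl] at hW
        have := mul_lt_mul_of_pos_left hbl hck
        linarith
      · rw [hZ0, hZ1]
        linear_combination a * hu)
    (by
      rintro W (rfl | rfl | rfl) hW
      · rw [hX0, hX1]; simp
      · rw [hY0, hY1]; positivity
      · rw [hZ0, hZ1, hsl] at hW
        have := mul_lt_mul_of_pos_left hal hck
        linarith)
  set w := dist X Z with hw
  have hw0 : 0 ≤ w := dist_nonneg
  have hw2 : w ^ 2 = s ^ 2 - 2 * s * a * c + a ^ 2 := by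
    rw [hw, dist_sq_coord, hX0, hX1, hZ0, hZ1]
    linear_combination a ^ 2 * hu
  have hm : s * (1 + c) / c = 2 * l * (1 + c) := by rw [hsl]; field_simp
  rcases lt_or_ge w (l - a) with hfar | hnear
  · exact h.far_leg_contact_false hsl hX hY hZ hb0 hbl ha hal hfar
  · have hwpos : 0 < w := by linarith
    rcases le_or_gt b w with hbw | hwb
    -- By the rotation condition `Z` lies beyond the foot of the altitude from `X`, that is `2 * c ^
    -- 2 * l < a`. This makes `XZ` shorter than the leg.
    · have hwl : w < l := by
        refine lt_of_pow_lt_pow_left₀ 2 hl0.le ?_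
        rw [hw2, hsl]
        have h1 : 2 * c ^ 2 * l < a := by rw [hsl] at hrot; linarith
        have h2 : 0 < (l - a) * (l + a - 4 * c ^ 2 * l) := mul_pos (by linarith) (by linarith)
        linarith
      have hle := h.isMin.perm_right.le_apex (Q := !₂[w * c, w * k]) (by
        rw [← hw]
        symm
        apply dist_eq_of_sq hw0
        simp [hX0, hX1]
        linear_combination w ^ 2 * hu) (wbtw_of_coord (t := b / w) (by positivity)
          (div_le_one_of_le₀ hbw hw0) (by simp [hX0, hY0]; field_simp)
          (by simp [hX1, hY1]; field_simp))
      have d1 : dist Z !₂[l * c, l * k] = l - a := by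
        apply dist_eq_of_sq (by linarith)
        rw [hZ0, hZ1, hsl]; simp
        linear_combination (l - a) ^ 2 * hu
      have d2 : dist (!₂[l * c, l * k] : Plane) !₂[w * c, w * k] = l - w := by
        apply dist_eq_of_sq (by linarith)
        simp
        linear_combination (l - w) ^ 2 * hu
      have d3 := dist_triangle Z !₂[l * c, l * k] !₂[w * c, w * k]
      rw [← hw, hm] at hle
      have hws : w < s + a := by
        refine lt_of_pow_lt_pow_left₀ 2 (by positivity) ?_
        rw [hw2]
        have : 0 < s * a * (1 + c) := by positivity
        linarith
      rw [hsl] at hws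
      linarith
    -- Here `g` is the cosine of the apex angle of the container and `N / w` that of the angle at
    -- `X` in `XYZ`. In the triangle of `X`, `Z` and the apex, `l - a ≤ w` makes the angle at `X`
    -- the smaller one, so the competitor has a smaller apex angle as well as a shorter leg.
    · set N := c * (s - a * c) + k * (a * k) with hN
      set g := 1 - 2 * c ^ 2 with hg
      have hNg : N = l - g * (l - a) := by
        rw [hN, hsl, hg]; linear_combination a * hu
      have hw2' : w ^ 2 = l ^ 2 + (l - a) ^ 2 - 2 * l * (l - a) * g := by
        rw [hw2, hsl, hg]; ring
      have hgl : 2 * (l - a) * g ≤ l := by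
        have h1 : (l - a) ^ 2 ≤ w ^ 2 := by gcongr
        have h2 : l * (2 * (l - a) * g) ≤ l * l := by linarith
        exact le_of_mul_le_mul_left h2 hl0
      have hgN : g * w ≤ N := by
        rcases le_or_gt g 0 with hg0 | hg0
        · have h1 : g * w ≤ 0 := mul_nonpos_of_nonpos_of_nonneg hg0 hw0
          have h2 : g * (l - a) ≤ 0 := mul_nonpos_of_nonpos_of_nonneg hg0 (by linarith)
          linarith
        · have hg1 : 0 ≤ 1 - g := by rw [hg]; ring_nf; positivity
          refine (pow_le_pow_iff_left₀ (by positivity) (by rw [hNg]; linarith) two_ne_zero).1 ?_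
          rw [mul_pow, hw2', hNg]
          have : 0 ≤ l * (1 - g) * (1 + g) * (l - 2 * (l - a) * g) :=
            mul_nonneg (by positivity) (by linarith)
          linarith
      have hXQ : dist X (!₂[b / w * Z 0, b / w * Z 1] : Plane) = b := by
        apply dist_eq_of_sq hb0.le
        have : (Z 0) ^ 2 + (Z 1) ^ 2 = w ^ 2 := by
          rw [hw, dist_sq_coord, hX0, hX1]; ring
        simp [hX0, hX1]
        field_simp
        exact this
      have hXY : dist X Y = b := by
        apply dist_eq_of_sq hb0.le
        rw [hX0, hX1, hY0, hY1]
        linear_combination b ^ 2 * hu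
      have hle := h.isMin.le_apex (hXY.trans hXQ.symm) (wbtw_of_coord (t := w / b) (by positivity)
          (div_le_one_of_le₀ hwb.le hb0.le) (by simp [hX0]; field_simp)
          (by simp [hX1]; field_simp))
      have hYQ : dist Y (!₂[b / w * Z 0, b / w * Z 1] : Plane) ≤ 2 * c * b := by
        refine (pow_le_pow_iff_left₀ dist_nonneg (by positivity) two_ne_zero).1 ?_
        have e1 : dist Y (!₂[b / w * Z 0, b / w * Z 1] : Plane) ^ 2 =
            2 * b ^ 2 - 2 * b ^ 2 * (N / w) := by
          have : (Z 0) ^ 2 + (Z 1) ^ 2 = w ^ 2 := by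
            rw [hw, dist_sq_coord, hX0, hX1]; ring
          have hNZ : N = c * Z 0 + k * Z 1 := by rw [hN, hZ0, hZ1]
          rw [dist_sq_coord, hNZ, hY0, hY1]
          simp
          field_simp
          linear_combination w ^ 2 * hu + this
        have h2 : g ≤ N / w := by rwa [le_div_iff₀ hwpos]
        rw [e1]
        have h3 := mul_le_mul_of_nonneg_left h2 (show 0 ≤ 2 * b ^ 2 by positivity)
        rw [hg] at h3
        linarith
      rw [hm, hXY] at hle
      have : b * (1 + c) < l * (1 + c) := mul_lt_mul_of_pos_right hbl (by positivity)
      linarith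

/-- The golden equation gives the ratio `2 * c = √5 - 1` of base to leg. The two rotation
inequalities place the foot of the altitude from `Z`, at position `c * s`, strictly between `X` and
`Y`, so the angles there are acute. -/
theorem gammaCfg_of_golden (h : Opt X Y Z s c k) {l b₁ b₂ : ℝ} (hsl : s = 2 * c * l)
    (hX : X = !₂[b₁ * c, b₁ * k])
    (hY : Y = !₂[b₂ * c, b₂ * k]) (hZ : Z = !₂[s, 0]) (hb₁ : 0 < b₁) (hb : b₁ < b₂)
    (hb₂ : b₂ < l) : GammaCfg Z X Y (stdVerts s c k) := by
  have hc := h.c_pos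
  have hk := h.k_pos
  have hs := h.s_pos
  have hu := h.unit
  have hl0 : 0 < l := by linarith
  have hgold := h.golden_of_leg hX hY hZ hb₁ hb (by rw [hsl]; field_simp; exact hb₂)
  have hX0 : X 0 = b₁ * c := by rw [hX]; simp
  have hX1 : X 1 = b₁ * k := by rw [hX]; simp
  have hY0 : Y 0 = b₂ * c := by rw [hY]; simp
  have hY1 : Y 1 = b₂ * k := by rw [hY]; simp
  have hZ0 : Z 0 = s := by rw [hZ]; simp
  have hZ1 : Z 1 = 0 := by rw [hZ]; simp
  have hb20 : 0 < b₂ := by linarith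
  have hck : 0 < c * k := by positivity
  have base : ∀ W, (W = X ∨ W = Y ∨ W = Z) → W 1 = 0 → W = Z := by
    rintro W (rfl | rfl | rfl) hW
    · rw [hX1] at hW; have := mul_pos hb₁ hk; linarith
    · rw [hY1] at hW; have := mul_pos hb20 hk; linarith
    · rfl
  have right : ∀ W, (W = X ∨ W = Y ∨ W = Z) → k * (s - W 0) = c * W 1 → W = Z := by
    rintro W (rfl | rfl | rfl) hW
    · rw [hX0, hX1, hsl] at hW
      have := mul_lt_mul_of_pos_left (hb.trans hb₂) hck
      linarith
    · rw [hY0, hY1, hsl] at hW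
      have := mul_lt_mul_of_pos_left hb₂ hck
      linarith
    · rfl
  have left : ∀ W, (W = X ∨ W = Y ∨ W = Z) → k * W 0 = c * W 1 → W = X ∨ W = Y := by
    rintro W (rfl | rfl | rfl) hW
    · exact Or.inl rfl
    · exact Or.inr rfl
    · rw [hZ0, hZ1] at hW; have := mul_pos hk hs; linarith
  have hX3 : c * X 0 + k * X 1 = b₁ := by rw [hX0, hX1]; linear_combination b₁ * hu
  have hY3 : c * Y 0 + k * Y 1 = b₂ := by rw [hY0, hY1]; linear_combination b₂ * hu
  have hr1 := h.rotation_pos (x₀ := s) (a₀ := 0) (b₀ := b₁)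
    (fun W hW hW' => by rw [base W hW hW', hZ0])
    (fun W hW hW' => by rw [right W hW hW', hZ0, hZ1]; simp)
    (fun W hW hW' => by rcases left W hW hW' with rfl | rfl <;> linarith)
  have hr2 := h.rotation_neg (x₀ := s) (a₀ := 0) (b₀ := b₂)
    (fun W hW hW' => by rw [base W hW hW', hZ0])
    (fun W hW hW' => by rw [right W hW hW', hZ0, hZ1]; simp)
    (fun W hW hW' => by rcases left W hW hW' with rfl | rfl <;> linarith)
  have h5 : √5 ^ 2 = 5 := Real.sq_sqrt (by norm_num)
  have h50 : 0 ≤ √5 := Real.sqrt_nonneg 5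
  have hcg : 2 * c = √5 - 1 := by
    have : (2 * c + 1 - √5) * (2 * c + 1 + √5) = 0 := by linear_combination 4 * hgold - h5
    rcases mul_eq_zero.1 this with h | h
    · linarith
    · linarith
  have hR : (!₂[s / 2, s * k / (2 * c)] : Plane) = !₂[l * c, l * k] := by
    apply plane_ext <;> simp [hsl] <;> field_simp
  have d1 : dist Z !₂[l * c, l * k] = l := by
    apply dist_eq_of_sq hl0.le
    rw [hZ0, hZ1, hsl]; simp
    linear_combination l ^ 2 * hu
  have d2 : dist (!₂[l * c, l * k] : Plane) !₂[0, 0] = l := by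
    apply dist_eq_of_sq hl0.le
    simp
    linear_combination l ^ 2 * hu
  have d3 : dist Z !₂[0, 0] = s := by
    apply dist_eq_of_sq hs.le
    rw [hZ0, hZ1]; simp
  have sb : ∀ W b, W = !₂[b * c, b * k] → 0 < b → b < l → Sbtw ℝ !₂[l * c, l * k] W !₂[0, 0] := by
    rintro W b rfl hb0 hbl
    refine ⟨wbtw_of_coord (t := (l - b) / l) (div_nonneg (by linarith) hl0.le)
      (by rw [div_le_one hl0]; linarith) (by simp; field_simp; ring) (by simp; field_simp; ring),
      ?_, ?_⟩
    · intro he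
      have := congrArg (fun W : Plane => W 0) he
      simp at this
      rcases this with h | h <;> linarith
    · intro he
      have := congrArg (fun W : Plane => W 0) he
      simp at this
      rcases this with h | h <;> linarith
  refine ⟨!₂[s / 2, s * k / (2 * c)], !₂[0, 0], ?_, ?_, ?_, ?_, ?_, ?_, ?_⟩
  · rw [hZ]
    ext x; simp only [stdVerts, Set.mem_insert_iff, Set.mem_singleton_iff]; tauto
  · rw [hR, d1, d2]
  · rw [hR]; exact sb X b₁ hX hb₁ (by linarith)
  · rw [hR]; exact sb Y b₂ hY hb20 hb₂
  · rw [hR, d1, d3, hsl, hcg]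
  · rw [dist_sq_coord, dist_sq_coord, dist_sq_coord, hX0, hX1, hY0, hY1, hZ0, hZ1]
    have : 0 < (b₂ - b₁) * (b₂ - c * s) := mul_pos (by linarith) (by linarith)
    have e : (b₁ * c - b₂ * c) ^ 2 + (b₁ * k - b₂ * k) ^ 2 +
        ((s - b₂ * c) ^ 2 + (0 - b₂ * k) ^ 2) - ((s - b₁ * c) ^ 2 + (0 - b₁ * k) ^ 2) =
        2 * ((b₂ - b₁) * (b₂ - c * s)) := by
      linear_combination (2 * b₂ ^ 2 - 2 * b₁ * b₂) * hu
    linarith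
  · rw [dist_sq_coord, dist_sq_coord, dist_sq_coord, hX0, hX1, hY0, hY1, hZ0, hZ1]
    have : 0 < (b₂ - b₁) * (c * s - b₁) := mul_pos (by linarith) (by linarith)
    have e : (b₁ * c - b₂ * c) ^ 2 + (b₁ * k - b₂ * k) ^ 2 +
        ((s - b₁ * c) ^ 2 + (0 - b₁ * k) ^ 2) - ((s - b₂ * c) ^ 2 + (0 - b₂ * k) ^ 2) =
        2 * ((b₂ - b₁) * (c * s - b₁)) := by
      linear_combination (2 * b₁ ^ 2 - 2 * b₁ * b₂) * hu
    linarith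

/-- The positions of the contacts on the legs are measured from the base: `b₁ < b₂` on the left, `a`
on the right. `b₂ = l` is the apex case; `b₁ = 0` gives the base case or `leg_contact_false`;
otherwise only `Z` can touch the base and the right leg, so it is their common vertex. -/
theorem outcome_of_left (h : Opt X Y Z s c k) (hcr : cr X Y Z ≠ 0) (hX : k * X 0 = c * X 1)
    (hY : k * Y 0 = c * Y 1) (hlt : X 1 < Y 1) : Outcome {X, Y, Z} (stdVerts s c k) := by
  have hc := h.c_pos
  have hk := h.k_pos
  have hs := h.s_pos
  have hu := h.unit
  obtain ⟨l, hsl⟩ : ∃ l, s = 2 * c * l := ⟨s / (2 * c), by field_simp⟩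
  have hck : 0 < c * k := by positivity
  have hl0 : 0 < l := by
    rw [hsl] at hs
    exact pos_of_mul_pos_right hs (by positivity)
  obtain ⟨b₁, hb₁⟩ : ∃ b, X 1 = b * k := ⟨X 1 / k, by field_simp⟩
  obtain ⟨b₂, hb₂⟩ : ∃ b, Y 1 = b * k := ⟨Y 1 / k, by field_simp⟩
  obtain ⟨a, ha⟩ : ∃ a, Z 1 = a * k := ⟨Z 1 / k, by field_simp⟩
  have hX' : X = !₂[b₁ * c, b₁ * k] := by
    refine plane_ext ?_ (by simpa using hb₁)
    have : k * X 0 = k * (b₁ * c) := by rw [hX, hb₁]; ring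
    simpa using mul_left_cancel₀ hk.ne' this
  have hY' : Y = !₂[b₂ * c, b₂ * k] := by
    refine plane_ext ?_ (by simpa using hb₂)
    have : k * Y 0 = k * (b₂ * c) := by rw [hY, hb₂]; ring
    simpa using mul_left_cancel₀ hk.ne' this
  have hX0 : X 0 = b₁ * c := by rw [hX']; simp
  have hY0 : Y 0 = b₂ * c := by rw [hY']; simp
  have hb : b₁ < b₂ := by
    rw [hb₁, hb₂] at hlt
    exact lt_of_mul_lt_mul_right hlt hk.le
  have hb10 : 0 ≤ b₁ := by
    have := (h.fits X (by simp)).1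
    rw [hb₁] at this
    exact nonneg_of_mul_nonneg_left this hk
  have hb2l : b₂ ≤ l := by
    have := (h.fits Y (by simp)).2.2
    rw [hb₂, hY0, hsl] at this
    have h2 : (c * k) * b₂ ≤ (c * k) * l := by linarith
    exact le_of_mul_le_mul_left h2 hck
  have hZ10 := (h.fits Z (by simp)).1
  rcases hb2l.eq_or_lt with hb2l | hb2l
  · have hYR : Y = !₂[s / 2, s * k / (2 * c)] := by
      rw [hY', hb2l, hsl]
      apply plane_ext <;> simp <;> field_simp
    have := h.perm_left.outcome_of_apex (by
      intro h0
      apply hcr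
      unfold cr at h0 ⊢
      linarith) hYR
    rwa [Set.insert_comm] at this
  · have hZr : k * (s - Z 0) - c * Z 1 = 0 := by
      obtain ⟨W, rfl | rfl | rfl, hW⟩ := h.touch_right
      · rw [hb₁, hX0, hsl] at hW
        have := mul_lt_mul_of_pos_left (hb.trans hb2l) hck
        linarith
      · rw [hb₂, hY0, hsl] at hW
        have := mul_lt_mul_of_pos_left hb2l hck
        linarith
      · exact hW
    have hZ0 : Z 0 = s - a * c := by
      have : k * Z 0 = k * (s - a * c) := by rw [ha] at hZr; linarith
      exact mul_left_cancel₀ hk.ne' this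
    have hZ' : Z = !₂[s - a * c, a * k] := plane_ext (by simpa using hZ0) (by simpa using ha)
    have ha0 : 0 ≤ a := by
      rw [ha] at hZ10
      exact nonneg_of_mul_nonneg_left hZ10 hk
    rcases hb10.eq_or_lt with hb10 | hb10
    · have hXV : X = !₂[0, 0] := by rw [hX', ← hb10]; simp
      rcases ha0.eq_or_lt with ha0 | ha0
      · have hZS : Z = !₂[s, 0] := by rw [hZ', ← ha0]; simp
        have := h.perm_right.outcome_of_base_left hXV (by rw [hZS]; simp) (by rw [hZS]; simpa)
          (by rw [hb₂]; exact mul_pos (by linarith) hk)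
        rwa [Set.pair_comm] at this
      · exfalso
        refine h.leg_contact_false hsl hXV hY' hZ' (by linarith) hb2l ha0 ?_
        have hle : a ≤ l := by
          have := (h.fits Z (by simp)).2.1
          rw [ha, hZ0, hsl] at this
          have h2 : (c * k) * a ≤ (c * k) * l := by linarith
          exact le_of_mul_le_mul_left h2 hck
        refine lt_of_le_of_ne hle ?_
        rintro rfl
        apply hcr
        unfold cr
        rw [hZ0, ha, hX0, hb₁, hY0, hb₂, hsl]
        ring
    · have hZ1 : Z 1 = 0 := by
        obtain ⟨W, rfl | rfl | rfl, hW⟩ := h.touch_base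
        · rw [hb₁] at hW; have := mul_pos hb10 hk; linarith
        · rw [hb₂] at hW; have := mul_pos (hb10.trans hb) hk; linarith
        · exact hW
      have ha0 : a = 0 := by
        rw [ha] at hZ1
        exact (mul_eq_zero.1 hZ1).resolve_right hk.ne'
      have hZS : Z = !₂[s, 0] := by rw [hZ', ha0]; simp
      refine ⟨Z, X, Y, ?_, Or.inr (Or.inr (Or.inl
        (h.gammaCfg_of_golden hsl hX' hY' hZS hb10 hb hb2l)))⟩
      ext x; simp only [Set.mem_insert_iff, Set.mem_singleton_iff]; tauto

theorem exists_third (h : Opt A B C s c k) (hcr : cr A B C ≠ 0) (hXY : X ≠ Y)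
    (hX : X = A ∨ X = B ∨ X = C) (hY : Y = A ∨ Y = B ∨ Y = C) :
    ∃ Z, Opt X Y Z s c k ∧ cr X Y Z ≠ 0 ∧ ({X, Y, Z} : Set Plane) = {A, B, C} := by
  rcases hX with rfl | rfl | rfl <;> rcases hY with rfl | rfl | rfl <;> try exact absurd rfl hXY
  · exact ⟨C, h, hcr, rfl⟩
  · exact ⟨B, h.perm_right, fun h0 => hcr (by unfold cr at *; linarith), by
      ext x; simp only [Set.mem_insert_iff, Set.mem_singleton_iff]; tauto⟩
  · exact ⟨C, h.perm_left, fun h0 => hcr (by unfold cr at *; linarith), by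
      ext x; simp only [Set.mem_insert_iff, Set.mem_singleton_iff]; tauto⟩
  · exact ⟨A, h.perm_left.perm_right, fun h0 => hcr (by unfold cr at *; linarith), by
      ext x; simp only [Set.mem_insert_iff, Set.mem_singleton_iff]; tauto⟩
  · exact ⟨B, h.perm_right.perm_left, fun h0 => hcr (by unfold cr at *; linarith), by
      ext x; simp only [Set.mem_insert_iff, Set.mem_singleton_iff]; tauto⟩
  · exact ⟨A, h.perm_right.perm_left.perm_right, fun h0 => hcr (by unfold cr at *; linarith), by
      ext x; simp only [Set.mem_insert_iff, Set.mem_singleton_iff]; tauto⟩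

theorem outcome_of_left' (h : Opt X Y Z s c k) (hcr : cr X Y Z ≠ 0) (hX : k * X 0 = c * X 1)
    (hY : k * Y 0 = c * Y 1) : Outcome {X, Y, Z} (stdVerts s c k) := by
  rcases lt_trichotomy (X 1) (Y 1) with hlt | heq | hlt
  · exact h.outcome_of_left hcr hX hY hlt
  · exfalso
    have hXY : X = Y := by
      refine plane_ext ?_ heq
      rw [heq, ← hY] at hX
      exact mul_left_cancel₀ h.k_pos.ne' hX
    apply hcr
    rw [hXY]; unfold cr; ring
  · have := h.perm_left.outcome_of_left (fun h0 => hcr (by unfold cr at *; linarith)) hY hX hlt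
    rwa [Set.insert_comm] at this

theorem outcome (h : Opt A B C s c k) (hcr : cr A B C ≠ 0) :
    Outcome {A, B, C} (stdVerts s c k) := by
  obtain ⟨X, Y, hXY, hX, hY, hside⟩ := h.flush
  obtain ⟨Z, hopt, hcr', hset⟩ := h.exists_third hcr hXY hX hY
  rw [← hset]
  rcases hside with ⟨hX1, hY1⟩ | ⟨hX1, hY1⟩ | ⟨hX1, hY1⟩
  · have hZ : 0 < Z 1 := by
      refine lt_of_le_of_ne (hopt.fits Z (by simp)).1 ?_
      intro h0
      apply hcr'
      unfold cr
      rw [hX1, hY1, ← h0]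
      ring
    rcases lt_trichotomy (X 0) (Y 0) with hlt | heq | hlt
    · exact hopt.outcome_of_base hX1 hY1 hlt hZ
    · exact absurd (plane_ext heq (by rw [hX1, hY1])) hXY
    · have := hopt.perm_left.outcome_of_base hY1 hX1 hlt hZ
      rwa [Set.insert_comm] at this
  · exact hopt.outcome_of_left' hcr' hX1 hY1
  · apply outcome_of_mirror
    refine hopt.mirror.outcome_of_left' ?_ (by simpa using hX1) (by simpa using hY1)
    intro h0
    apply hcr'
    unfold cr at *
    simp at h0
    linarith

end Opt

/-! ### Transport from standard position to arbitrary containers -/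

/-- The configurations of a minimum perimeter isosceles container. -/
theorem IsMinContainer.outcome {T T' : Tri} (h : IsMinContainer T T') :
    Outcome (verts T) (verts T') := by
  obtain ⟨⟨⟨P, R, S, hv', hi⟩, hsub⟩, -⟩ := id h
  have hv := verts_eq T
  obtain ⟨F, s, t, hs, ht, hP, hS, hR⟩ := exists_chart (cr_ne_zero hv') hi
  obtain ⟨hA, hB, hC⟩ := (subset_iff hv hv').1 hsub
  have hm := h.isMin hv
  rw [per_eq hv'] at hm
  set l := dist P R with hl
  have hcr' := cr_ne_zero hv'
  have hl2 : l ^ 2 = (s / 2) ^ 2 + t ^ 2 := by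
    rw [hl, ← hP, ← hR, F.dist_map, dist_sq_coord]
    simp
  have hSP : dist S P = s := by
    rw [← hP, ← hS, F.dist_map]
    exact dist_eq_of_sq hs.le (by simp)
  have hl0 : 0 < l := by
    refine lt_of_le_of_ne dist_nonneg ?_
    intro h0
    rw [← h0] at hl2
    have : 0 < (s / 2) ^ 2 + t ^ 2 := by positivity
    linarith
  rw [← hi, hSP] at hm
  set c := s / (2 * l) with hc
  set k := t / l with hk
  have hc0 : 0 < c := by positivity
  have hk0 : 0 < k := by positivity
  have htk : t = s * k / (2 * c) := by rw [hc, hk]; field_simp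
  have hu : c ^ 2 + k ^ 2 = 1 := by
    rw [hc, hk]
    field_simp
    linarith
  have hfit : ∀ X, InTri P R S X → Fits s c k (F.symm X) := by
    intro X hX
    have h1 := hX.map F.symm
    rw [← hP, ← hR, ← hS] at h1
    simp only [AffineIsometryEquiv.symm_apply_apply] at h1
    obtain ⟨u, v, w, hu0, hv0, hw0, h1, hx, hy⟩ := h1
    simp at hx hy
    have e : c * t = k * (s / 2) := by rw [htk]; field_simp
    refine ⟨?_, ?_, ?_⟩
    · rw [hy]; positivity
    · rw [hx, hy]
      have : 0 ≤ k * (w * s) := by positivity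
      linear_combination this + v * e
    · rw [hx, hy]
      have : 0 ≤ k * (u * s) := by positivity
      linear_combination this + v * e + k * s * h1
  have hopt : Opt (F.symm (T.points 0)) (F.symm (T.points 1)) (F.symm (T.points 2)) s c k := by
    refine ⟨hs, hc0, hk0, hu, ?_, ?_⟩
    · rintro X (rfl | rfl | rfl)
      · exact hfit _ hA
      · exact hfit _ hB
      · exact hfit _ hC
    · apply IsMin.of_map F
      simp only [AffineIsometryEquiv.apply_symm_apply]
      convert hm using 1
      rw [hc]; field_simp; ring
  have hcr : cr (F.symm (T.points 0)) (F.symm (T.points 1)) (F.symm (T.points 2)) ≠ 0 := by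
    rw [← affineIndependent_iff_cr]
    have h1 := affineIndependent_iff_cr.2 (tri_points_cr T)
    have h2 := (F.symm.toAffineEquiv.affineIndependent_iff).2 h1
    have e : ![F.symm (T.points 0), F.symm (T.points 1), F.symm (T.points 2)] =
        ⇑F.symm.toAffineEquiv ∘ ![T.points 0, T.points 1, T.points 2] := by
      funext i
      fin_cases i <;> rfl
    rw [e]
    exact h2
  have hout := (hopt.outcome hcr).map F
  simp only [Set.image_insert_eq, Set.image_singleton, AffineIsometryEquiv.apply_symm_apply,
    Opt.stdVerts, ← htk, hP, hS, hR] at hout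
  rw [hv, hv']
  exact hout

/-! ### From configurations to types, by comparing side lengths -/

theorem lineMap_coord (P Q : Plane) (t : ℝ) (i : Fin 2) :
    AffineMap.lineMap P Q t i = P i + t * (Q i - P i) := by
  simp [AffineMap.lineMap_apply]
  ring

/-- Stewart's theorem. -/
theorem dist_sq_lineMap (O P Q : Plane) (t : ℝ) : dist O (AffineMap.lineMap P Q t) ^ 2 =
    (1 - t) * dist O P ^ 2 + t * dist O Q ^ 2 - t * (1 - t) * dist P Q ^ 2 := by
  simp only [dist_sq_coord, lineMap_coord]
  ring

theorem onRay_of_wbtw {O W Q : Plane} (h : Wbtw ℝ O W Q) (hW : O ≠ W) : OnRay O W Q := by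
  obtain ⟨t, ⟨ht0, ht1⟩, rfl⟩ := h
  have ht : t ≠ 0 := by rintro rfl; simp at hW
  refine ⟨t⁻¹, inv_nonneg.2 ht0, ?_⟩
  apply plane_ext <;> simp only [lineMap_coord] <;> field_simp <;> ring

theorem ne_of_verts {T : Tri} {A B C : Plane} (h : verts T = {A, B, C}) : A ≠ B ∧ A ≠ C ∧ B ≠ C := by
  have := cr_ne_zero h
  refine ⟨?_, ?_, ?_⟩ <;> rintro rfl <;> apply this <;> unfold cr <;> ring

/-- Strict triangle inequalities. -/
theorem dist_lt_of_verts {T : Tri} {A B C : Plane} (h : verts T = {A, B, C}) :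
    dist A C < dist A B + dist B C := by
  rcases lt_or_eq_of_le (dist_triangle A B C) with h1 | h1
  · exact h1
  · exfalso
    have h2 : Wbtw ℝ A B C := dist_add_dist_eq_iff.1 h1.symm
    obtain ⟨t, -, rfl⟩ := h2
    apply cr_ne_zero h
    simp only [cr, lineMap_coord]
    ring

theorem verts_swap_left {T : Tri} {A B C : Plane} (h : verts T = {A, B, C}) : verts T = {B, A, C} := by
  rw [h, Set.insert_comm]

theorem verts_swap_right {T : Tri} {A B C : Plane} (h : verts T = {A, B, C}) :
    verts T = {A, C, B} := by
  rw [h, Set.pair_comm]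

/-- The base of an isosceles triangle with apex `O` and leg `OU`, `W` lying on the other leg. -/
theorem apex_base_sq {O U W Q : Plane} (h : dist O U = dist O Q) (hW : Wbtw ℝ O W Q) :
    dist O W * dist U Q ^ 2 = dist O U * (dist U W ^ 2 - (dist O U - dist O W) ^ 2) := by
  obtain ⟨t, ⟨ht0, ht1⟩, rfl⟩ := hW
  rw [dist_sq_lineMap, dist_left_lineMap, Real.norm_of_nonneg ht0, dist_comm U O, ← h]
  ring

theorem exists_apex {O U W : Plane} (hW : O ≠ W) (h : dist O W ≤ dist O U) :
    ∃ Q, dist O U = dist O Q ∧ Wbtw ℝ O W Q := by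
  have h0 : 0 < dist O W := dist_pos.2 hW
  refine ⟨AffineMap.lineMap O W (dist O U / dist O W), ?_, ?_⟩
  · rw [dist_left_lineMap, Real.norm_of_nonneg (by positivity), div_mul_cancel₀ _ h0.ne']
  · refine ⟨dist O W / dist O U, ⟨by positivity, div_le_one_of_le₀ h dist_nonneg⟩, ?_⟩
    have h1 : 0 < dist O U := h0.trans_le h
    apply plane_ext <;> simp only [lineMap_coord] <;> field_simp <;> ring

/-- The competitor of `IsMin.le_apex` in terms of the side lengths of the triangle only. -/
theorem IsMin.exists_le_apex {O U W : Plane} {m : ℝ} (hm : IsMin O U W m) (hW : O ≠ W)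
    (h : dist O W ≤ dist O U) : ∃ e, 0 ≤ e ∧ m ≤ 2 * dist O U + e ∧
      dist O W * e ^ 2 = dist O U * (dist U W ^ 2 - (dist O U - dist O W) ^ 2) := by
  obtain ⟨Q, h1, h2⟩ := exists_apex hW h
  exact ⟨dist U Q, dist_nonneg, hm.le_apex h1 h2, apex_base_sq h1 h2⟩

/-- With `p = YX`, `q = YZ`, `r = XZ` one has `q ≤ p`. The orders `r ≤ q` and `p ≤ r` are two of the
types. If `q < r < p`, moving the apex to `X` keeps the leg `p` and shortens the base, the gain
having the sign of `(r - q) * ((r + q) ^ 2 - p ^ 2)`. -/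
theorem ApexCfg.exists_kind {T T' : Tri} (hT : IsMinContainer T T') {Y X Z : Plane}
    (hv : verts T = {Y, X, Z}) (h : ApexCfg Y X Z (verts T')) : ∃ k, IsOfKind k T T' := by
  obtain ⟨Q, hv', hQ, hZ⟩ := h
  obtain ⟨hYX, hYZ, hXZ⟩ := ne_of_verts hv
  have hqp : dist Y Z ≤ dist Y X := by
    rw [hQ]
    obtain ⟨t, ⟨ht0, ht1⟩, rfl⟩ := hZ
    rw [dist_left_lineMap, Real.norm_of_nonneg ht0]
    exact mul_le_of_le_one_left dist_nonneg ht1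
  by_cases h1 : dist X Z ≤ dist Y Z
  · exact ⟨.ABCp, Y, X, Z, ⟨hv, h1, hqp⟩, Q, onRay_of_wbtw hZ hYZ, hQ.symm, hv'⟩
  by_cases h2 : dist Y X ≤ dist X Z
  · refine ⟨.ABpC, X, Z, Y, ⟨by rw [hv, Set.insert_comm, Set.pair_comm], ?_, ?_⟩, Q,
      onRay_of_wbtw hZ hYZ, ?_, ?_⟩
    · rwa [dist_comm Z, dist_comm X]
    · rwa [dist_comm X]
    · rw [dist_comm Q, ← hQ, dist_comm]
    · rw [hv', Set.insert_comm, Set.pair_comm]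
  exfalso
  push Not at h1 h2
  have hm := hT.isMin (verts_swap_left hv)
  obtain ⟨e, he0, hme, he⟩ := hm.exists_le_apex (W := Z) hXZ (by rw [dist_comm X Y]; exact h2.le)
  rw [per_eq hv'] at hme
  have hb := apex_base_sq hQ hZ
  have htri := dist_lt_of_verts hv
  have htri' := dist_lt_of_verts (verts_swap_right hv)
  have hq0 : 0 < dist Y Z := dist_pos.2 hYZ
  rw [dist_comm Q Y, ← hQ, dist_comm X Y] at hme
  rw [dist_comm X Y] at he
  rw [dist_comm Z X] at htri'
  set p := dist Y X
  set q := dist Y Z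
  set r := dist X Z
  set f := dist X Q
  have hf0 : 0 ≤ f := dist_nonneg
  have hfe : f ≤ e := by linarith
  have h3 : q * f ^ 2 ≤ q * e ^ 2 := by gcongr
  have h4 : r * (q * f ^ 2) ≤ q * (r * e ^ 2) := by nlinarith
  rw [hb, he] at h4
  have h5 : 0 < p * ((r - q) * ((r + q) ^ 2 - p ^ 2)) := by
    apply mul_pos (by linarith) (mul_pos (by linarith) _)
    nlinarith
  nlinarith

/-- The relation between the base `w`, the leg `l` and the distances `a`, `b` from the base
vertices to a point of a leg. -/
theorem base_relation {X Y Z R : Plane} (h : dist R X = dist R Y) (hZ : Wbtw ℝ X Z R) :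
    dist X Z ≤ dist R X ∧ dist X Y ^ 2 * dist X Z =
      dist R X * (dist X Y ^ 2 + dist X Z ^ 2 - dist Y Z ^ 2) := by
  obtain ⟨t, ⟨ht0, ht1⟩, rfl⟩ := hZ
  rw [dist_sq_lineMap Y, dist_left_lineMap, Real.norm_of_nonneg ht0, dist_comm Y R, ← h, dist_comm Y X,
    dist_comm X R]
  constructor
  · exact mul_le_of_le_one_left dist_nonneg ht1
  · ring

/-- For an apex angle less than `60°`, the perimeter of an isosceles triangle with a prescribed
altitude to a leg decreases in the apex angle; `y`, `z` are the sines of half of the angles. -/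
theorem apex_monotone {y z : ℝ} (hy : 0 < y) (hyz : y < z) (hz : z ≤ 1 / 2) :
    y ^ 2 * (1 - y) * (1 + z) < z ^ 2 * (1 - z) * (1 + y) := by
  have h : 0 < (z - y) * ((z + y) - z ^ 2 - y ^ 2 - z * y * (z + y)) := by
    apply mul_pos (by linarith)
    have h1 : z ^ 2 ≤ z / 2 := by nlinarith
    have h2 : y ^ 2 ≤ y / 2 := by nlinarith
    have h3 : z * y ≤ 1 / 4 := by nlinarith
    have h4 : z * y * (z + y) ≤ 1 / 4 * (z + y) :=
      mul_le_mul_of_nonneg_right h3 (by linarith)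
    linarith
  nlinarith

/-- Compare `2 l + w` and `2 b + e` where `z = e / (2 b)` and `y = w / (2 l)` are sines of half of
the apex angles, and the altitudes to the legs agree. -/
theorem apex_perimeter_lt {l w b e : ℝ} (hl : 0 < l) (hb : 0 < b) (hw : 0 < w)
    (h : w / (2 * l) < e / (2 * b)) (he : e ≤ b)
    (hh : w ^ 2 - w ^ 4 / (4 * l ^ 2) = e ^ 2 - e ^ 4 / (4 * b ^ 2)) : 2 * b + e < 2 * l + w := by
  obtain ⟨y, hy⟩ : ∃ y, y = w / (2 * l) := ⟨_, rfl⟩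
  obtain ⟨z, hz⟩ : ∃ z, z = e / (2 * b) := ⟨_, rfl⟩
  rw [← hy, ← hz] at h
  have hy0 : 0 < y := by rw [hy]; positivity
  have hz1 : z ≤ 1 / 2 := by rw [hz, div_le_iff₀ (by positivity)]; linarith
  have hw' : w = 2 * l * y := by rw [hy]; field_simp
  have he' : e = 2 * b * z := by rw [hz]; field_simp
  have hh' : l ^ 2 * (y ^ 2 * (1 - y ^ 2)) = b ^ 2 * (z ^ 2 * (1 - z ^ 2)) := by
    rw [hw', he'] at hh
    field_simp at hh
    linarith
  have hm := apex_monotone hy0 h hz1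
  have h1 : (b * (1 + z)) ^ 2 < (l * (1 + y)) ^ 2 := by
    have hp : 0 < z ^ 2 * (1 - z) := by apply mul_pos (by nlinarith) (by linarith)
    have hq : (z ^ 2 * (1 - z)) * (b * (1 + z)) ^ 2 = (l ^ 2 * (1 + y)) * (y ^ 2 * (1 - y) * (1 + z)) := by
      linear_combination (-(1 + z)) * hh'
    have hr : (z ^ 2 * (1 - z)) * (l * (1 + y)) ^ 2 = (l ^ 2 * (1 + y)) * (z ^ 2 * (1 - z) * (1 + y)) := by
      ring
    rw [← mul_lt_mul_iff_right₀ hp, hq, hr]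
    gcongr
  have h2 := lt_of_pow_lt_pow_left₀ 2 (by positivity) h1
  rw [hw', he']
  linarith

/-- Let `w = XY`, `a = XZ`, `b = YZ`; always `a ≤ b`. If `b ≤ w` this is the type with `C̄`. If `a ≤
w < b`, apex `X` with leg `XY` is shorter. If `w < a` and `Z` is not the apex, apex `Z` with leg
`ZY` has the same altitude from `Y` and a wider apex angle, still at most 60°, so
`apex_perimeter_lt` applies. If `Z` is the apex, the container is the triangle itself. -/
theorem BaseCfg.exists_kind {T T' : Tri} (hT : IsMinContainer T T') {X Y Z : Plane}
    (hv : verts T = {X, Y, Z}) (h : BaseCfg X Y Z (verts T')) : ∃ k, IsOfKind k T T' := by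
  obtain ⟨R, hv', hR, hZ⟩ := h
  obtain ⟨hXY, hXZ, hYZ⟩ := ne_of_verts hv
  obtain ⟨hal, hrel⟩ := base_relation hR hZ
  have ha0 : 0 < dist X Z := dist_pos.2 hXZ
  have hb0 : 0 < dist Y Z := dist_pos.2 hYZ
  have hw0 : 0 < dist X Y := dist_pos.2 hXY
  have hl0 := ha0.trans_le hal
  have hab : dist X Z ≤ dist Y Z := by
    have h1 : dist X Y ^ 2 * dist X Z ≤ dist X Y ^ 2 * dist R X := by gcongr
    rw [hrel] at h1
    have h2 : (dist R X) * (dist X Z ^ 2) ≤ dist R X * (dist Y Z ^ 2) := by nlinarith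
    exact le_of_sq_le_sq (le_of_mul_le_mul_left h2 hl0) hb0.le
  by_cases hwb : dist Y Z ≤ dist X Y
  · refine ⟨.ABCbar, Y, X, Z, ⟨verts_swap_left hv, hab, by rwa [dist_comm Y X]⟩, R, ?_, ?_, ?_⟩
    · obtain ⟨t, -, rfl⟩ := onRay_of_wbtw hZ hXZ
      exact AffineMap.lineMap_mem_affineSpan_pair _ _ _
    · rw [AffineSubspace.mem_perpBisector_iff_dist_eq, hR]
    · rw [hv', Set.insert_comm]
  push Not at hwb
  have hper := per_eq hv'
  rw [dist_comm Y R, ← hR] at hper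
  by_cases haw : dist X Z ≤ dist X Y
  · exfalso
    obtain ⟨e, he0, hme, he⟩ := (hT.isMin hv).exists_le_apex hXZ haw
    rw [hper] at hme
    have htri := dist_lt_of_verts (verts_swap_left hv)
    rw [dist_comm Y X] at htri
    set w := dist X Y
    set a := dist X Z
    set b := dist Y Z
    set l := dist R X
    -- The cosine of the base angle of the container, which is also the angle of the triangle at
    -- `X`.
    obtain ⟨x, hx⟩ : ∃ x, x = w / (2 * l) := ⟨_, rfl⟩
    have hx0 : 0 < x := by rw [hx]; positivity
    have hw : w = 2 * l * x := by rw [hx]; field_simp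
    have hb2 : b ^ 2 = w ^ 2 + a ^ 2 - 2 * a * w * x := by
      have : l * (w ^ 2 + a ^ 2 - b ^ 2) = l * (2 * a * w * x) := by
        rw [← hrel]; nth_rw 1 [pow_two, hw]; ring
      linarith [mul_left_cancel₀ hl0.ne' this]
    have he2 : e ^ 2 = w ^ 2 * (2 * (1 - x)) := by
      apply mul_left_cancel₀ ha0.ne'
      rw [he, hb2]; ring
    have hx2 : x < 1 / 2 := by
      have h1 : 0 < a * (a - 2 * w * x) := by nlinarith
      have h2 := pos_of_mul_pos_right h1 ha0.le
      nlinarith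
    have h1 : (x * e) ^ 2 < (w * (1 - x)) ^ 2 := by
      rw [mul_pow, he2]
      have h3 : 0 < w ^ 2 * ((1 - x) * ((1 - 2 * x) * (1 + x))) := by
        apply mul_pos (by positivity) (mul_pos (by linarith) (mul_pos (by linarith) (by linarith)))
      nlinarith
    have h2 := lt_of_pow_lt_pow_left₀ 2 (by nlinarith) h1
    have h3 : x * (w + l + l) ≤ x * (2 * w + e) := by
      apply mul_le_mul_of_nonneg_left _ hx0.le
      linarith
    have h4 : 2 * l * x = w := hw.symm
    nlinarith
  push Not at haw
  by_cases hZR : Z = R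
  · subst hZR
    refine ApexCfg.exists_kind hT (Y := Z) (X := X) (Z := Y) ?_ ⟨Y, ?_, hR, wbtw_self_right ℝ _ _⟩
    · rw [hv, Set.pair_comm, Set.insert_comm, Set.pair_comm]
    · rw [hv', Set.pair_comm Y, Set.insert_comm]
  exfalso
  have hal' : dist X Z < dist R X := by
    rw [dist_comm R]
    obtain ⟨t, ⟨ht0, ht1⟩, rfl⟩ := hZ
    rw [dist_left_lineMap, Real.norm_of_nonneg ht0]
    rw [dist_comm] at hl0
    rcases ht1.lt_or_eq with h1 | rfl
    · exact mul_lt_of_lt_one_left hl0 h1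
    · simp at hZR
  have hm := hT.isMin (show verts T = {Z, Y, X} by rw [hv, Set.pair_comm Y, Set.insert_comm, Set.pair_comm X])
  obtain ⟨e, he0, hme, he⟩ := hm.exists_le_apex hXZ.symm (by rwa [dist_comm Z X, dist_comm Z Y])
  rw [hper, dist_comm Z Y] at hme
  rw [dist_comm Z X, dist_comm Z Y, dist_comm Y X] at he
  set w := dist X Y
  set a := dist X Z
  set b := dist Y Z
  set l := dist R X
  -- The projection of `XY` onto the leg `XR`, so that `w ^ 2 - p ^ 2` is the squared altitude from
  -- `Y`.
  obtain ⟨p, hp⟩ : ∃ p, p = w ^ 2 / (2 * l) := ⟨_, rfl⟩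
  have hp0 : 0 < p := by rw [hp]; positivity
  have hw : w ^ 2 = 2 * l * p := by rw [hp]; field_simp
  have hpw : p < a := by
    nlinarith
  have hb2 : b ^ 2 = w ^ 2 + a ^ 2 - 2 * a * p := by
    apply mul_left_cancel₀ hl0.ne'
    linear_combination hrel - a * hw
  have he2 : e ^ 2 = 2 * b * (b - a + p) := by
    apply mul_left_cancel₀ ha0.ne'
    linear_combination he - b * hb2
  have heb : e ≤ b := by
    refine le_of_sq_le_sq ?_ hb0.le
    refine le_of_mul_le_mul_left ?_ ha0
    rw [he, pow_two b, mul_left_comm]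
    gcongr
    nlinarith
  have hlt : w / (2 * l) < e / (2 * b) := by
    refine lt_of_pow_lt_pow_left₀ 2 (by positivity) ?_
    rw [div_pow, div_pow, he2, hw, div_lt_div_iff₀ (by positivity) (by positivity)]
    have hc : (a - p) * l < (l - p) * b := by
      refine lt_of_pow_lt_pow_left₀ 2 (mul_nonneg (by linarith) hb0.le) ?_
      have h1 : (a - p) ^ 2 < (l - p) ^ 2 := by
        apply pow_lt_pow_left₀ (by linarith) (by linarith) (by norm_num)
      have h2 : 0 < w ^ 2 - p ^ 2 := by
        rw [hw]; nlinarith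
      have h3 : 0 < ((l - p) ^ 2 - (a - p) ^ 2) * (w ^ 2 - p ^ 2) := mul_pos (by linarith) h2
      have h4 : b ^ 2 = (a - p) ^ 2 + (w ^ 2 - p ^ 2) := by rw [hb2]; ring
      have h5 : l ^ 2 = (l - p) ^ 2 + (w ^ 2 - p ^ 2) := by rw [hw]; ring
      rw [mul_pow, mul_pow, h4, h5]
      linarith
    have h6 : 0 < 8 * l * b * ((l - p) * b - (a - p) * l) := by
      apply mul_pos (by positivity) (by linarith)
    linarith
  have hfin := apex_perimeter_lt hl0 hb0 hw0 hlt heb (by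
    have h1 : w ^ 4 = (w ^ 2) ^ 2 := by ring
    have h2 : e ^ 4 = (e ^ 2) ^ 2 := by ring
    rw [h1, h2, he2, hw]
    field_simp
    linear_combination (-2) * hb2 - 2 * hw)
  linarith

/-! ### The angle γ* and the golden ratio of base to leg -/

/-- The argument `τ` of the arctangent is the root below 1 of `1 + τ ^ 2 = (1 + √5) * τ`; doubling
the angle twice then gives the cosine, which is `1 - (√5 - 1) ^ 2 / 2`. -/
theorem cos_gammaStar_bounds : 0 ≤ gammaStar ∧ gammaStar ≤ Real.pi ∧ Real.cos gammaStar = √5 - 2 := by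
  obtain ⟨τ, hτ⟩ : ∃ τ, τ = (1 + √5 - √(2 * (1 + √5))) / 2 := ⟨_, rfl⟩
  have h5 : √5 ^ 2 = 5 := Real.sq_sqrt (by norm_num)
  have h50 : 2 < √5 := by rw [Real.lt_sqrt (by norm_num)]; norm_num
  have hq : √(2 * (1 + √5)) ^ 2 = 2 * (1 + √5) := Real.sq_sqrt (by positivity)
  have hq0 : 0 ≤ √(2 * (1 + √5)) := Real.sqrt_nonneg _
  have hsq : 1 + τ ^ 2 = (1 + √5) * τ := by
    rw [hτ]
    linear_combination hq / 4 - h5 / 4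
  have hτ0 : 0 < τ := by
    by_contra h
    nlinarith
  have hτ1 : τ < 1 := by
    have : √5 - 1 < √(2 * (1 + √5)) := by
      refine lt_of_pow_lt_pow_left₀ 2 hq0 ?_
      rw [hq]; nlinarith
    rw [hτ]; linarith
  have hg : gammaStar = 2 * (2 * Real.arctan τ) := by rw [gammaStar, hτ]; ring
  have ha0 : 0 < Real.arctan τ := Real.arctan_pos.2 hτ0
  have ha1 : Real.arctan τ < Real.pi / 4 := by
    rw [← Real.arctan_one]; exact Real.arctan_strictMono hτ1
  refine ⟨by rw [hg]; linarith, by rw [hg]; linarith, ?_⟩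
  have hp : 0 < 1 + √5 := by linarith
  have hc : Real.cos (Real.arctan τ) ^ 2 = 1 / (1 + τ ^ 2) := Real.cos_sq_arctan τ
  rw [hg, Real.cos_two_mul, Real.cos_two_mul, hc, hsq]
  field_simp
  have e2 : τ ^ 2 = (1 + √5) * τ - 1 := by linarith
  ring_nf
  have e3 : √5 ^ 3 = 5 * √5 := by rw [pow_succ, h5]
  simp only [e3, h5, e2]
  ring_nf

theorem angle_lt_pi_div_two {X Y Z : Plane} (h : dist X Z ^ 2 < dist X Y ^ 2 + dist Y Z ^ 2) :
    EuclideanGeometry.angle X Y Z < Real.pi / 2 := by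
  have h1 := EuclideanGeometry.law_cos X Y Z
  by_contra h2
  push Not at h2
  have h3 := Real.cos_nonpos_of_pi_div_two_le_of_le h2
    ((EuclideanGeometry.angle_le_pi X Y Z).trans (by linarith [Real.pi_pos]))
  have h4 : dist X Y * dist Z Y * Real.cos (EuclideanGeometry.angle X Y Z) ≤ 0 :=
    mul_nonpos_of_nonneg_of_nonpos (by positivity) h3
  rw [dist_comm Y Z] at h
  nlinarith

theorem angle_eq_gammaStar_iff {Z R V : Plane} (hl : Z ≠ R) (h : dist Z R = dist R V) :
    EuclideanGeometry.angle Z R V = gammaStar ↔ dist Z V = (√5 - 1) * dist Z R := by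
  obtain ⟨g0, g1, g2⟩ := cos_gammaStar_bounds
  have hl0 : 0 < dist Z R := dist_pos.2 hl
  have h1 := EuclideanGeometry.law_cos Z R V
  rw [dist_comm V R, ← h] at h1
  have h5 : √5 ^ 2 = 5 := Real.sq_sqrt (by norm_num)
  have h50 : 2 < √5 := by rw [Real.lt_sqrt (by norm_num)]; norm_num
  constructor
  · intro h2
    rw [h2, g2] at h1
    rw [← sq_eq_sq₀ dist_nonneg (mul_nonneg (by linarith) hl0.le)]
    linear_combination h1 - dist Z R ^ 2 * h5
  · intro h2
    apply Real.injOn_cos ⟨EuclideanGeometry.angle_nonneg _ _ _, EuclideanGeometry.angle_le_pi _ _ _⟩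
      ⟨g0, g1⟩
    rw [g2]
    rw [h2] at h1
    have h3 : dist Z R ^ 2 * 2 ≠ 0 := by positivity
    apply mul_left_cancel₀ h3
    linear_combination h1 - dist Z R ^ 2 * h5

/-- Used for `X` and, by symmetry, for `Y`: the side on the leg is the shortest, so `Z` takes the
role of `A` in the labelling. -/
theorem GammaCfg.dist_le {Z X Y : Plane} {D' : Set Plane} (h : GammaCfg Z X Y D') :
    dist X Y ≤ dist Z X := by
  obtain ⟨R, V, -, hl, ⟨⟨t, ⟨ht0, ht1⟩, rfl⟩, -⟩, ⟨⟨r, ⟨hr0, hr1⟩, rfl⟩, -⟩, he, -⟩ := h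
  have h5 : √5 ^ 2 = 5 := Real.sq_sqrt (by norm_num)
  have h50 : 2 < √5 := by rw [Real.lt_sqrt (by norm_num)]; norm_num
  have h51 : √5 < 9 / 4 := by rw [Real.sqrt_lt' (by norm_num)]; norm_num
  refine le_of_sq_le_sq ?_ dist_nonneg
  rw [dist_sq_lineMap Z, he, ← hl, dist_lineMap_lineMap, mul_pow, Real.dist_eq, sq_abs, ← hl]
  have h1 : (t - r) ^ 2 ≤ 1 + (4 - 2 * √5) * t + t ^ 2 := by
    rcases le_total t r with h | h <;> nlinarith
  have h2 := mul_le_mul_of_nonneg_right h1 (sq_nonneg (dist Z R))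
  linear_combination h2 - t * dist Z R ^ 2 * h5

theorem GammaCfg.symm {Z X Y : Plane} {D' : Set Plane} (h : GammaCfg Z X Y D') :
    GammaCfg Z Y X D' := by
  obtain ⟨R, V, h1, h2, h3, h4, h5, h6, h7⟩ := h
  refine ⟨R, V, h1, h2, h4, h3, h5, ?_, ?_⟩
  · rwa [dist_comm Y X]
  · rwa [dist_comm Y X]

theorem GammaCfg.exists_kind {T T' : Tri} {Z X Y : Plane}
    (hv : verts T = {Z, X, Y}) (h : GammaCfg Z X Y (verts T')) : ∃ k, IsOfKind k T T' := by
  wlog hle : dist Z Y ≤ dist Z X generalizing X Y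
  · exact this (verts_swap_right hv) h.symm (not_le.1 hle).le
  have h1 := h.dist_le
  have h2 := h.symm.dist_le
  have h3 := ne_of_verts hv
  have h0 : 0 < dist Z Y := dist_pos.2 h3.2.1
  obtain ⟨R, V, hv', hl, hX, hY, he, hx, hy⟩ := h
  refine ⟨.gammaStarType, Z, X, Y, ⟨hv, by rwa [dist_comm], hle⟩, ?_, ?_, ?_, R, V, hv', hl, ?_, hX, hY⟩
  · apply angle_lt_pi_div_two
    rw [dist_comm X Z]
    nlinarith [dist_nonneg (x := X) (y := Y)]
  · apply angle_lt_pi_div_two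
    linarith
  · apply angle_lt_pi_div_two
    rw [dist_comm Y X]
    linarith
  · rwa [angle_eq_gammaStar_iff (ne_of_verts hv').1 hl]

/-! ### The minimum point of `perimFun` -/

/-- The polynomial inequality behind the minimality of `perimFun`. -/
theorem perim_identity (k x : ℝ) : x ^ 2 * (k - 1) ^ 3 + k * (2 * x - k ^ 2 - k) * (x - 1) ^ 2 =
    (x - k) ^ 2 * (2 * k * x - k - 1) := by ring

theorem perimFun_self {v k : ℝ} (hk : 1 < k) (hv : v ^ 2 = (k - 1) ^ 3 * (k + 1)) :
    perimFun v k = k * (k + 1) := by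
  have h : 1 + v ^ 2 / (1 - k) ^ 2 = k ^ 2 := by
    have : 1 - k ≠ 0 := by linarith
    rw [hv]
    field_simp
    ring
  rw [perimFun, h, Real.sqrt_sq (by linarith)]
  ring

/-- Parametrizing `v` by the minimum point `k` avoids solving a quartic. After squaring, the
difference carries the double root `(x - k) ^ 2` of `perim_identity`, so the minimum is strict on
all of `x > 1`. -/
theorem lt_perimFun {v k x : ℝ} (hk : 1 < k) (hv : v ^ 2 = (k - 1) ^ 3 * (k + 1)) (hx : 1 < x)
    (hxk : x ≠ k) : k * (k + 1) < perimFun v x := by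
  have h1 : 0 < (x - k) ^ 2 * (2 * k * x - k - 1) := by
    have : 0 < (x - k) ^ 2 := by
      have := sub_ne_zero.2 hxk
      positivity
    apply mul_pos this
    nlinarith
  rw [← perim_identity] at h1
  have h2 : (k * (k + 1) - x) / x < √(1 + v ^ 2 / (1 - x) ^ 2) := by
    apply Real.lt_sqrt_of_sq_lt
    rw [hv, div_pow, show (1 - x) ^ 2 = (x - 1) ^ 2 by ring]
    have h3 : 0 < x - 1 := by linarith
    rw [← sub_pos]
    have : 1 + (k - 1) ^ 3 * (k + 1) / (x - 1) ^ 2 - (k * (k + 1) - x) ^ 2 / x ^ 2 =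
        (k + 1) * (x ^ 2 * (k - 1) ^ 3 + k * (2 * x - k ^ 2 - k) * (x - 1) ^ 2) /
          ((x - 1) ^ 2 * x ^ 2) := by
      field_simp
      ring
    rw [this]
    positivity
  rw [div_lt_iff₀ (by linarith)] at h2
  unfold perimFun
  linarith

theorem isMinOn_perimFun {v k : ℝ} (hk : 1 < k) (hv : v ^ 2 = (k - 1) ^ 3 * (k + 1)) :
    IsMinOn (perimFun v) (Set.Ioo 1 2) k := by
  intro x hx
  rw [Set.mem_ofPred_eq, perimFun_self hk hv]
  by_cases h : x = k
  · rw [h, perimFun_self hk hv]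
  · exact (lt_perimFun hk hv hx.1 h).le

/-- The polynomial runs from 0 to 3 on `[1, 2]`, which is where `v < √3` enters: some `r` in the
interval satisfies the equation, and strictness of its minimum forces `k = r`. -/
theorem sq_eq_of_isMinOn {v k : ℝ} (hv0 : 0 < v) (hv3 : v < √3) (hk : 1 < k)
    (h : IsMinOn (perimFun v) (Set.Ioo 1 2) k) : v ^ 2 = (k - 1) ^ 3 * (k + 1) := by
  have hv3' : v ^ 2 < 3 := by rwa [Real.lt_sqrt hv0.le] at hv3
  obtain ⟨r, ⟨hr1, hr2⟩, hr⟩ : v ^ 2 ∈ (fun r : ℝ => (r - 1) ^ 3 * (r + 1)) '' Set.Ioo 1 2 := by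
    apply intermediate_value_Ioo (by norm_num) (by fun_prop)
    constructor
    · norm_num; positivity
    · norm_num; exact hv3'
  by_cases hrk : k = r
  · rw [hrk]; exact hr.symm
  · exfalso
    have h1 := h ⟨hr1, hr2⟩
    rw [Set.mem_ofPred_eq, perimFun_self hr1 hr.symm] at h1
    exact absurd (lt_perimFun hr1 hr.symm hk hrk) (not_lt.2 h1)

/-- Stationarity puts `Z` at abscissa `s * c`, so scaling by `(s * c)⁻¹` brings it to abscissa 1 and
the base vertex to `1 / c`, which is then the minimum point. -/
theorem XCfg.exists_kind {T T' : Tri} {X Y Z : Plane}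
    (hv : verts T = {X, Y, Z}) (h : XCfg X Y Z (verts T')) : ∃ k, IsOfKind k T T' := by
  obtain ⟨F, s, c, k, x, hs, hc, hk, hu, hx0, hxs, rfl, rfl, rfl, hv', h1, h2⟩ := h
  have hc1 : c < 1 := by nlinarith
  have hc0 : 0 < c := by linarith
  have hsc : (s * c)⁻¹ ≠ 0 := by positivity
  let φ : Plane ≃ᵈ Plane := F.symm.toIsometryEquiv.toDilationEquiv.trans
    (DilationEquiv.smulTorsor (0 : Plane) hsc)
  have hφ : ∀ P, φ (F P) = (s * c)⁻¹ • P := by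
    intro P
    change (s * c)⁻¹ • F.symm (F P) +ᵥ (0 : Plane) = _
    simp
  obtain ⟨w, hw⟩ : ∃ w, w = k * (1 - c) / c ^ 2 := ⟨_, rfl⟩
  have hw0 : 0 < w := by
    rw [hw]
    have : 0 < 1 - c := by linarith
    positivity
  have hK1 : 1 < 1 / c := by rw [lt_div_iff₀ hc0]; linarith
  have hK2 : 1 / c < 2 := by rw [div_lt_iff₀ hc0]; linarith
  have hw2 : w ^ 2 = (1 / c - 1) ^ 3 * (1 / c + 1) := by
    have hk2 : k ^ 2 = 1 - c ^ 2 := by linarith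
    rw [hw, div_pow, mul_pow, hk2]
    field_simp
    ring
  have hw3 : w ^ 2 < 3 := by
    rw [hw2]
    have e1 : (1 / c - 1) ^ 3 < 1 := pow_lt_one₀ (by linarith) (by linarith) (by norm_num)
    nlinarith
  refine ⟨.xStarType, _, _, _, ⟨hv, ?_, ?_⟩, φ, w, x / (s * c), 1 / c, F !₂[s / 2, s * k / (2 * c)],
    F !₂[s, 0], hw0, Real.lt_sqrt_of_sq_lt hw3, ?_, ?_, hK2, isMinOn_perimFun hK1 hw2, ?_, ?_, ?_, ?_,
    ?_, ?_, hv'⟩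
  · exact h2
  · exact h1
  · rw [lt_div_iff₀ (by positivity), one_mul]
    rw [F.dist_map, F.dist_map] at h1
    have h3 := pow_le_pow_left₀ dist_nonneg h1 2
    rw [dist_sq_coord, dist_sq_coord] at h3
    simp at h3
    have h4 : 0 < (k * (s * (1 - c)) / c) ^ 2 := by
      have : 0 < 1 - c := by linarith
      positivity
    exact lt_of_pow_lt_pow_left₀ 2 hx0.le (by linarith)
  · rw [div_lt_div_iff₀ (by positivity) hc0]
    nlinarith
  · rw [hφ]; apply plane_ext <;> simp
  · rw [hφ]
    apply plane_ext <;> simp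
    · field_simp
    · rw [hw]; field_simp
  · rw [hφ]; apply plane_ext <;> simp
    field_simp
  · rw [hφ]; apply plane_ext <;> simp
    field_simp
  · have h1c : 1 - c ≠ 0 := by linarith
    refine ⟨1 / (2 * (1 - c)), by apply div_nonneg <;> linarith, ?_⟩
    rw [← F.coe_toAffineEquiv, ← AffineEquiv.apply_lineMap]
    congr 1
    apply plane_ext <;> simp only [lineMap_coord] <;> simp <;> field_simp
    ring
  · rw [F.dist_map, F.dist_map, dist_coord, dist_coord]
    congr 1
    simp
    ring

/-- Every minimum perimeter isosceles container is of one of the five types. -/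
theorem IsMinContainer.exists_kind {T T' : Tri} (h : IsMinContainer T T') : ∃ k, IsOfKind k T T' := by
  obtain ⟨X, Y, Z, hv, h1 | h1 | h1 | h1⟩ := h.outcome
  · exact h1.exists_kind h hv
  · exact h1.exists_kind h hv
  · exact h1.exists_kind hv
  · exact h1.exists_kind hv

/-! ### The five types are containers; which of them share a side -/

theorem wbtw_of_onRay {O U W Q : Plane} (h : OnRay O W Q) (hW : O ≠ W) (hQ : dist O Q = dist O U)
    (hWU : dist O W ≤ dist O U) : Wbtw ℝ O W Q := by
  obtain ⟨t, ht0, rfl⟩ := h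
  rw [dist_left_lineMap, Real.norm_of_nonneg ht0] at hQ
  have h0 : 0 < dist O W := dist_pos.2 hW
  have ht1 : 1 ≤ t := by
    by_contra h
    push Not at h
    nlinarith
  refine ⟨t⁻¹, ⟨by positivity, inv_le_one_of_one_le₀ ht1⟩, ?_⟩
  have : t ≠ 0 := by positivity
  apply plane_ext <;> simp only [lineMap_coord] <;> field_simp <;> ring

theorem angle_eq_of_wbtw {O U W Q : Plane} (h : Wbtw ℝ O W Q) (hW : O ≠ W) :
    EuclideanGeometry.angle U O W = EuclideanGeometry.angle U O Q := by
  obtain ⟨t, ⟨ht0, ht1⟩, rfl⟩ := h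
  have ht : 0 < t := by
    rcases ht0.lt_or_eq with h | rfl
    · exact h
    · simp at hW
  simp only [EuclideanGeometry.angle, AffineMap.lineMap_vsub_left]
  rw [InnerProductGeometry.angle_smul_right_of_pos _ _ ht]

theorem isContainer_of_inTri {T T' : Tri} {A B C P R S : Plane} (hv : verts T = {A, B, C})
    (hv' : verts T' = {P, R, S}) (hi : dist P R = dist R S) (hA : InTri P R S A)
    (hB : InTri P R S B) (hC : InTri P R S C) : IsContainer T T' :=
  ⟨⟨P, R, S, hv', hi⟩, (subset_iff hv hv').2 ⟨hA, hB, hC⟩⟩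

theorem isContainer_of_apex {T T' : Tri} {O U W Q : Plane} (hv : verts T = {O, U, W})
    (hv' : verts T' = {O, U, Q}) (h : Wbtw ℝ O W Q) (hQ : dist O Q = dist O U) :
    IsContainer T T' ∧ SharesSideAndAngle T T' := by
  have hW := (ne_of_verts hv).2.1
  refine ⟨isContainer_of_inTri hv (verts_swap_left hv') ?_ (InTri.mid _ _ _) (InTri.left _ _ _)
    (InTri.of_wbtw_right h), O, U, W, Q, hv, hv', angle_eq_of_wbtw h hW⟩
  rw [dist_comm, hQ]

theorem isContainer_of_base {T T' : Tri} {X Y Z R : Plane} (hv : verts T = {X, Y, Z})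
    (hv' : verts T' = {X, Y, R}) (h : Wbtw ℝ X Z R) (hR : dist R X = dist R Y) :
    IsContainer T T' ∧ SharesSideAndAngle T T' := by
  have hW := (ne_of_verts hv).2.1
  refine ⟨isContainer_of_inTri (verts_swap_left hv) (P := Y) (R := R) (S := X) ?_ ?_
    (InTri.left _ _ _) ?_ (InTri.of_wbtw_right ?_), X, Y, Z, R, hv, hv', angle_eq_of_wbtw h hW⟩
  · rw [hv', Set.insert_comm, Set.pair_comm]
  · rw [hR, dist_comm]
  · exact ⟨0, 0, 1, by norm_num⟩
  · exact h.symm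

theorem IsABCp.wbtw {T T' : Tri} {A B C : Plane} (hl : IsLabelling T A B C) (h : IsABCp A B C T') :
    ∃ Q, verts T' = {A, B, Q} ∧ Wbtw ℝ A C Q ∧ dist A Q = dist A B := by
  obtain ⟨Q, h1, h2, h3⟩ := h
  exact ⟨Q, h3, wbtw_of_onRay h1 (ne_of_verts hl.1).2.1 h2 hl.2.2, h2⟩

theorem IsABpC.wbtw {T T' : Tri} {A B C : Plane} (hl : IsLabelling T A B C) (h : IsABpC A B C T') :
    ∃ Q, verts T' = {C, A, Q} ∧ Wbtw ℝ C B Q ∧ dist C Q = dist C A := by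
  obtain ⟨Q, h1, h2, h3⟩ := h
  have h4 : dist C Q = dist C A := by rw [dist_comm, h2, dist_comm]
  refine ⟨Q, by rw [h3, Set.pair_comm, Set.insert_comm], wbtw_of_onRay h1 (ne_of_verts hl.1).2.2.symm h4 ?_, h4⟩
  rw [dist_comm C, dist_comm C]
  exact hl.2.1

/-- The parameter `t` of `C̄` on the line `BC` satisfies `AB² = t * (AB² + BC² - AC²)`; as `BC ≤
AC`, this forces `1 ≤ t`, so `C` lies between `B` and `C̄`. -/
theorem IsABCbar.wbtw {T T' : Tri} {A B C : Plane} (hl : IsLabelling T A B C)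
    (h : IsABCbar A B C T') :
    ∃ R, verts T' = {B, A, R} ∧ Wbtw ℝ B C R ∧ dist R B = dist R A := by
  obtain ⟨R, h1, h2, h3⟩ := h
  rw [AffineSubspace.mem_perpBisector_iff_dist_eq] at h2
  refine ⟨R, verts_swap_left h3, ?_, h2.symm⟩
  obtain ⟨t, rfl⟩ := mem_affineSpan_pair_iff_exists_lineMap_eq.1 h1
  obtain ⟨hv, hab, hbc⟩ := hl
  have ha0 : 0 < dist B C := dist_pos.2 (ne_of_verts hv).2.2
  have h4 : dist A B ^ 2 = t * (dist A B ^ 2 + dist B C ^ 2 - dist A C ^ 2) := by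
    have h5 : dist A (AffineMap.lineMap B C t) ^ 2 = (dist (AffineMap.lineMap B C t) B) ^ 2 := by
      rw [← h2, dist_comm]
    rw [dist_sq_lineMap, dist_lineMap_left, mul_pow, Real.norm_eq_abs, sq_abs] at h5
    linear_combination h5
  have ht1 : 1 ≤ t := by
    by_contra h
    push Not at h
    have h5 : dist A C ^ 2 ≤ dist A B ^ 2 := by gcongr
    have h6 : dist B C ^ 2 ≤ dist A C ^ 2 := by gcongr
    have h7 : 0 < dist B C ^ 2 := by positivity
    have h8 := mul_lt_of_lt_one_left (a := t)
      (show 0 < dist A B ^ 2 + dist B C ^ 2 - dist A C ^ 2 by linarith) h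
    linarith
  have ht : t ≠ 0 := by positivity
  refine ⟨t⁻¹, ⟨by positivity, inv_le_one_of_one_le₀ ht1⟩, ?_⟩
  apply plane_ext <;> simp only [lineMap_coord] <;> field_simp <;> ring

/-- The metric content of `IsXStarType`. -/
theorem IsXStarType.data {A B C : Plane} {T' : Tri} (h : IsXStarType A B C T') :
    ∃ (R S : Plane) (r v xb xs : ℝ), 0 < r ∧ 0 < v ∧ 1 < xb ∧ xb < xs ∧ xs < 2 ∧
      v ^ 2 = (xs - 1) ^ 3 * (xs + 1) ∧ verts T' = {A, R, S} ∧ dist A R = dist R S ∧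
      r * dist A B = xb ∧ r ^ 2 * dist A C ^ 2 = 1 + v ^ 2 ∧
      r ^ 2 * dist B C ^ 2 = (xb - 1) ^ 2 + v ^ 2 ∧ r * dist A S = xs ∧ r * dist B S = xs - xb ∧
      r * dist C S = xs * (xs - 1) ∧ R = AffineMap.lineMap S C (xs / (2 * (xs - 1))) := by
  obtain ⟨φ, v, xb, xs, R, S, hv0, hv3, hb1, hbs, hs2, hmin, hA, hC, hB, hS, hR, hRS, hv'⟩ := h
  have hs1 := hb1.trans hbs
  have hv := sq_eq_of_isMinOn hv0 hv3 hs1 hmin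
  obtain ⟨r, hr0, hr⟩ : ∃ r : ℝ, 0 < r ∧ ∀ X Y, r * dist X Y = dist (φ X) (φ Y) :=
    ⟨Dilation.ratio φ, by exact_mod_cast Dilation.ratio_pos φ, fun X Y => (Dilation.dist_eq φ X Y).symm⟩
  have hr2 : ∀ X Y, r ^ 2 * dist X Y ^ 2 = dist (φ X) (φ Y) ^ 2 := fun X Y => by rw [← hr, mul_pow]
  have hAS : r * dist A S = xs := by
    rw [hr, hA, hS, dist_coord]
    simp [Real.sqrt_sq (show 0 ≤ xs by linarith)]
  have hAC : r ^ 2 * dist A C ^ 2 = 1 + v ^ 2 := by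
    rw [hr2, hA, hC, dist_sq_coord]; simp
  have hSC : r ^ 2 * dist S C ^ 2 = (xs - 1) ^ 2 + v ^ 2 := by
    rw [hr2, hS, hC, dist_sq_coord]; simp
  refine ⟨R, S, r, v, xb, xs, hr0, hv0, hb1, hbs, hs2, hv, hv', hRS, ?_, hAC, ?_, hAS, ?_, ?_, ?_⟩
  · rw [hr, hA, hB, dist_coord]
    simp [Real.sqrt_sq (show 0 ≤ xb by linarith)]
  · rw [hr2, hB, hC, dist_sq_coord]; simp
  · rw [hr, hB, hS, dist_coord]
    simp
    rw [Real.sqrt_sq_eq_abs, abs_of_neg] <;> linarith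
  · rw [dist_comm, ← sq_eq_sq₀ (by positivity) (mul_nonneg (by linarith) (by linarith)), mul_pow, hSC, hv]
    ring
  · obtain ⟨t, ht0, rfl⟩ := hR
    congr 1
    have h1 : dist A (AffineMap.lineMap S C t) ^ 2 = (dist (AffineMap.lineMap S C t) S) ^ 2 := by
      rw [hRS]
    rw [dist_sq_lineMap, dist_lineMap_left, mul_pow, Real.norm_eq_abs, sq_abs] at h1
    have h2 : r ^ 2 * dist A S ^ 2 = xs ^ 2 := by rw [← mul_pow, hAS]
    have h3 : xs ^ 2 + t * (2 * xs - 2 * xs ^ 2) = 0 := by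
      linear_combination r ^ 2 * h1 - (1 - t) * h2 - t * hAC + t * hSC
    have h4 : xs * (xs - t * (2 * (xs - 1))) = 0 := by linear_combination h3
    rcases mul_eq_zero.1 h4 with h5 | h5
    · linarith
    · rw [eq_div_iff (by linarith)]; linarith

theorem not_sharesSide {T T' : Tri} {A B C : Plane} (hv : verts T = {A, B, C}) (hB : B ∉ verts T')
    (hC : C ∉ verts T') : ¬ SharesSide T T' := by
  rintro ⟨X, Y, hXY, hX, hY, hX', hY'⟩
  have key : ∀ Z, Z ∈ verts T → Z ∈ verts T' → Z = A := by
    intro Z h1 h2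
    rw [hv] at h1
    rcases h1 with rfl | rfl | rfl
    · rfl
    · exact absurd h2 hB
    · exact absurd h2 hC
  exact hXY ((key X hX hX').trans (key Y hY hY').symm)

theorem SharesSideAndAngle.sharesSide {T T' : Tri} (h : SharesSideAndAngle T T') :
    SharesSide T T' := by
  obtain ⟨X, Y, Z, Z', h1, h2, -⟩ := h
  refine ⟨X, Y, (ne_of_verts h1).1, ?_, ?_, ?_, ?_⟩ <;> simp [h1, h2]

theorem IsGammaStarType.isContainer {T T' : Tri} {A B C : Plane} (hv : verts T = {A, B, C})
    (h : IsGammaStarType A B C T') : IsContainer T T' ∧ ¬ SharesSide T T' := by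
  obtain ⟨-, -, -, R, S, hv', hRS, -, hB, hC⟩ := h
  obtain ⟨h1, h2, h3⟩ := ne_of_verts hv
  refine ⟨isContainer_of_inTri hv hv' hRS (InTri.left _ _ _) (InTri.of_wbtw_right hB.wbtw)
    (InTri.of_wbtw_right hC.wbtw), not_sharesSide hv ?_ ?_⟩
  · rw [hv']
    rintro (h | h | h)
    · exact h1 h.symm
    · exact hB.ne_left h
    · exact hB.ne_right h
  · rw [hv']
    rintro (h | h | h)
    · exact h2 h.symm
    · exact hC.ne_left h
    · exact hC.ne_right h

theorem IsXStarType.isContainer {T T' : Tri} {A B C : Plane} (hv : verts T = {A, B, C})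
    (h : IsXStarType A B C T') : IsContainer T T' ∧ ¬ SharesSide T T' := by
  obtain ⟨R, S, r, v, xb, xs, hr, hv0, hb1, hbs, hs2, hvs, hv', hRS, hAB, hAC, hBC, hAS, hBS, hCS, hR⟩ :=
    h.data
  obtain ⟨h1, h2, h3⟩ := ne_of_verts hv
  have hB : Wbtw ℝ A B S := by
    rw [← dist_add_dist_eq_iff]
    apply mul_left_cancel₀ hr.ne'
    linarith
  have ht : 0 < xs / (2 * (xs - 1)) := div_pos (by linarith) (by linarith)
  -- This is where `xs < 2` is needed: it puts `C` strictly before `R` on the ray from `S`.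
  have ht1 : 1 < xs / (2 * (xs - 1)) := by rw [lt_div_iff₀ (by linarith)]; linarith
  have hBS' : B ≠ S := by
    rintro rfl
    rw [dist_self] at hBS; linarith
  have hCS' : C ≠ S := by
    rintro rfl
    rw [dist_self] at hCS; nlinarith
  have hC : Wbtw ℝ S C R := by
    rw [hR]
    refine ⟨_, ⟨(inv_pos.2 ht).le, (inv_lt_one_of_one_lt₀ ht1).le⟩, ?_⟩
    have := ht.ne'
    generalize xs / (2 * (xs - 1)) = t at *
    apply plane_ext <;> simp only [lineMap_coord] <;> field_simp <;> ring
  refine ⟨isContainer_of_inTri hv hv' hRS (InTri.left _ _ _) ?_ (InTri.of_wbtw_right hC.symm),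
    not_sharesSide hv ?_ ?_⟩
  · obtain ⟨t, ⟨ht0, ht1⟩, rfl⟩ := hB
    refine ⟨1 - t, 0, t, by linarith, le_rfl, ht0, by ring, ?_, ?_⟩ <;> simp only [lineMap_coord] <;> ring
  · rw [hv']
    rintro (h | h | h)
    · exact h1 h.symm
    · obtain ⟨t, -, ht⟩ := hB
      rw [h] at ht
      apply cr_ne_zero hv'
      rw [← ht]
      simp only [cr, lineMap_coord]
      ring
    · exact hBS' h
  · rw [hv']
    rintro (h | h | h)
    · exact h2 h.symm
    · rw [← h] at hR
      have h5 : dist S C = xs / (2 * (xs - 1)) * dist S C := by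
        have h6 := dist_left_lineMap (𝕜 := ℝ) S C (xs / (2 * (xs - 1)))
        rwa [← hR, Real.norm_of_nonneg ht.le] at h6
      have h7 : 0 < dist S C := dist_pos.2 hCS'.symm
      nlinarith
    · exact hCS' h

/-- The five types consist of isosceles containers; the special ones share a side and an angle at
one of its ends with the triangle, and the others share no side. -/
theorem IsOfKind.isContainer {k : Kind} {T T' : Tri} (h : IsOfKind k T T') :
    IsContainer T T' ∧ (k.IsSpecial → SharesSideAndAngle T T') ∧
      (¬ k.IsSpecial → ¬ SharesSide T T') := by
  obtain ⟨A, B, C, hl, h⟩ := h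
  have hv := hl.1
  cases k
  · obtain ⟨Q, h1, h2, h3⟩ := IsABpC.wbtw hl h
    have h4 := isContainer_of_apex (by rw [hv, Set.insert_comm, Set.pair_comm, Set.insert_comm, Set.pair_comm A, Set.insert_comm]) h1 h2 h3
    simpa [Kind.IsSpecial] using h4
  · obtain ⟨Q, h1, h2, h3⟩ := IsABCp.wbtw hl h
    simpa [Kind.IsSpecial] using isContainer_of_apex hv h1 h2 h3
  · obtain ⟨Q, h1, h2, h3⟩ := IsABCbar.wbtw hl h
    simpa [Kind.IsSpecial] using isContainer_of_base (verts_swap_left hv) h1 h2 h3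
  · simpa [Kind.IsSpecial] using IsGammaStarType.isContainer hv h
  · simpa [Kind.IsSpecial] using IsXStarType.isContainer hv h

theorem IsOfKind.sharesSideAndAngle_iff {k : Kind} {T T' : Tri} (h : IsOfKind k T T') :
    SharesSideAndAngle T T' ↔ k.IsSpecial := by
  obtain ⟨-, h1, h2⟩ := h.isContainer
  refine ⟨fun h3 => ?_, h1⟩
  by_contra h4
  exact h2 h4 h3.sharesSide

/-! ### Perimeters of the five types in terms of the side lengths -/

/-- `A`, `B`, `C` are the vertices of a scalene triangle whose sides are `a < b < c`. -/
structure ScaleneLabelling (T : Tri) (A B C : Plane) (a b c : ℝ) : Prop where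
  verts_eq : verts T = {A, B, C}
  dist_BC : dist B C = a
  dist_AC : dist A C = b
  dist_AB : dist A B = c
  lt_left : a < b
  lt_right : b < c

namespace ScaleneLabelling

variable {T T' : Tri} {A B C : Plane} {a b c : ℝ}

theorem pos (h : ScaleneLabelling T A B C a b c) : 0 < a ∧ 0 < b ∧ 0 < c := by
  have h1 : 0 < a := by
    rw [← h.dist_BC]; exact dist_pos.2 (ne_of_verts h.verts_eq).2.2
  exact ⟨h1, h1.trans h.lt_left, (h1.trans h.lt_left).trans h.lt_right⟩

theorem isLabelling (h : ScaleneLabelling T A B C a b c) : IsLabelling T A B C :=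
  ⟨h.verts_eq, by rw [h.dist_BC, h.dist_AC]; exact h.lt_left.le,
    by rw [h.dist_AB, h.dist_AC]; exact h.lt_right.le⟩

/-- A scalene triangle has only one admissible labelling, so each type can be tested on it alone. -/
theorem eq (h : ScaleneLabelling T A B C a b c) {A' B' C' : Plane} (hl : IsLabelling T A' B' C') :
    A' = A ∧ B' = B ∧ C' = C := by
  obtain ⟨hv, h1, h2⟩ := hl
  obtain ⟨n1, n2, n3⟩ := ne_of_verts hv
  obtain ⟨hv0, ha, hb, hc, hab, hbc⟩ := h
  have hA : A' ∈ ({A, B, C} : Set Plane) := by rw [← hv0, hv]; simp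
  have hB : B' ∈ ({A, B, C} : Set Plane) := by rw [← hv0, hv]; simp
  have hC : C' ∈ ({A, B, C} : Set Plane) := by rw [← hv0, hv]; simp
  have ha' : dist C B = a := by rw [dist_comm, ha]
  have hb' : dist C A = b := by rw [dist_comm, hb]
  have hc' : dist B A = c := by rw [dist_comm, hc]
  rcases hA with rfl | rfl | rfl <;> rcases hB with rfl | rfl | rfl <;>
    rcases hC with rfl | rfl | rfl <;>
    first
    | exact absurd rfl n1
    | exact absurd rfl n2
    | exact absurd rfl n3
    | exact ⟨rfl, rfl, rfl⟩
    | (exfalso; simp only [ha, hb, hc, ha', hb', hc'] at h1 h2; linarith)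

theorem scalene (h : ScaleneLabelling T A B C a b c) (hT : T.points = ![A, B, C]) : T.Scalene := by
  rw [Affine.Triangle.scalene_iff_dist_ne_and_dist_ne_and_dist_ne, hT]
  simp [h.dist_BC, h.dist_AB, h.dist_AC]
  refine ⟨?_, ?_, ?_⟩ <;> intro h' <;> linarith [h.lt_left, h.lt_right]

theorem kind_cases (h : ScaleneLabelling T A B C a b c) {k : Kind} (hk : IsOfKind k T T') :
    (k = .ABpC ∧ IsABpC A B C T') ∨ (k = .ABCp ∧ IsABCp A B C T') ∨
    (k = .ABCbar ∧ IsABCbar A B C T') ∨ (k = .gammaStarType ∧ IsGammaStarType A B C T') ∨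
    (k = .xStarType ∧ IsXStarType A B C T') := by
  obtain ⟨A', B', C', hl, hk⟩ := hk
  obtain ⟨rfl, rfl, rfl⟩ := h.eq hl
  cases k <;> simp_all

theorem per_ABpC (h : ScaleneLabelling T A B C a b c) (hk : IsABpC A B C T') :
    ∃ e, 0 ≤ e ∧ per T' = 2 * b + e ∧ a * e ^ 2 = b * (c ^ 2 - (b - a) ^ 2) := by
  obtain ⟨Q, h1, h2, h3⟩ := hk.wbtw h.isLabelling
  refine ⟨dist A Q, dist_nonneg, ?_, ?_⟩
  · rw [per_eq h1, dist_comm Q C, h3, dist_comm C A, h.dist_AC]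
    ring
  · have h4 := apex_base_sq h3.symm h2
    rwa [dist_comm C B, dist_comm C A, h.dist_BC, h.dist_AC, h.dist_AB] at h4

theorem per_ABCp (h : ScaleneLabelling T A B C a b c) (hk : IsABCp A B C T') :
    ∃ e, 0 ≤ e ∧ per T' = 2 * c + e ∧ b * e ^ 2 = c * (a ^ 2 - (c - b) ^ 2) := by
  obtain ⟨Q, h1, h2, h3⟩ := hk.wbtw h.isLabelling
  refine ⟨dist B Q, dist_nonneg, ?_, ?_⟩
  · rw [per_eq h1, dist_comm Q A, h3, h.dist_AB]
    ring
  · have h4 := apex_base_sq h3.symm h2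
    rwa [h.dist_BC, h.dist_AC, h.dist_AB] at h4

theorem per_ABCbar (h : ScaleneLabelling T A B C a b c) (hk : IsABCbar A B C T') :
    ∃ l, per T' = c + 2 * l ∧ l * (c ^ 2 + a ^ 2 - b ^ 2) = c ^ 2 * a := by
  obtain ⟨R, h1, h2, h3⟩ := hk.wbtw h.isLabelling
  refine ⟨dist R B, ?_, ?_⟩
  · rw [per_eq h1, dist_comm A R, ← h3, dist_comm B A, h.dist_AB]
    ring
  · have h4 := (base_relation h3 h2).2
    rw [dist_comm B A, h.dist_BC, h.dist_AC, h.dist_AB] at h4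
    exact h4.symm

/-- `i` is the inner product of the sides `AB` and `AC`. In normal position `C` has abscissa 1, so
the ratio `r` of the similarity satisfies `c = r * i`. The inequality `c ^ 2 < i * x` says that `B`
precedes `S`. -/
theorem per_xStar (h : ScaleneLabelling T A B C a b c) (hk : IsXStarType A B C T') :
    ∃ i x, i = (b ^ 2 + c ^ 2 - a ^ 2) / 2 ∧ 0 < i ∧ 1 < x ∧ x < 2 ∧ c * per T' = i * (x * (x + 1)) ∧
      c ^ 2 < i * x ∧ b ^ 2 * c ^ 2 - i ^ 2 = i ^ 2 * ((x - 1) ^ 3 * (x + 1)) ∧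
      ∃ R S, verts T' = {A, R, S} ∧ Wbtw ℝ A B S ∧ c * dist A S = i * x ∧
        R = AffineMap.lineMap S C (x / (2 * (x - 1))) := by
  obtain ⟨R, S, r, v, xb, xs, hr, hv0, hb1, hbs, hs2, hvs, hv', hRS, hAB, hAC, hBC, hAS, hBS, hCS, hR⟩ :=
    hk.data
  rw [h.dist_AB] at hAB
  rw [h.dist_AC] at hAC
  rw [h.dist_BC] at hBC
  obtain ⟨i, hi⟩ : ∃ i, i = (b ^ 2 + c ^ 2 - a ^ 2) / 2 := ⟨_, rfl⟩
  have hri : r ^ 2 * i = xb := by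
    rw [hi]; rw [← hAB] at hBC ⊢
    linear_combination hAC / 2 - hBC / 2
  have hc : c = r * i := by
    apply mul_left_cancel₀ hr.ne'
    linear_combination hAB - hri
  have hi0 : 0 < i := by
    have : 0 < r * i := by rw [← hc]; exact h.pos.2.2
    exact pos_of_mul_pos_right this hr.le
  refine ⟨i, xs, hi, hi0, hb1.trans hbs, hs2, ?_, ?_, ?_, R, S, hv', ?_, ?_, hR⟩
  · have h1 : dist R S = xs / (2 * (xs - 1)) * dist C S := by
      rw [hR, dist_lineMap_left, Real.norm_of_nonneg, dist_comm S C]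
      exact div_nonneg (by linarith) (by linarith)
    have h2 : r * dist R S = xs ^ 2 / 2 := by
      rw [h1, mul_left_comm, hCS]
      have : xs - 1 ≠ 0 := by linarith
      field_simp
    have h3 : per T' = 2 * dist R S + dist A S := by
      rw [per_eq hv', hRS, dist_comm S A]; ring
    rw [h3, hc]
    linear_combination 2 * i * h2 + i * hAS
  · rw [hc]
    have h1 : (r * i) ^ 2 = i * xb := by rw [← hri]; ring
    rw [h1]
    gcongr
  · rw [← hvs]
    rw [hc]
    linear_combination i ^ 2 * hAC
  · rw [← dist_add_dist_eq_iff]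
    apply mul_left_cancel₀ hr.ne'
    rw [h.dist_AB]
    linarith
  · rw [hc]
    linear_combination i * hAS

/-- Of `B` and `C`, at the one nearer to `R` the angle of the triangle is exterior to a triangle
with angle γ* at `R`. So this angle exceeds γ* and its cosine is below `√5 - 2`. The acute angle at
`C` gives the first conjunct. -/
theorem of_gammaStar (h : ScaleneLabelling T A B C a b c) (hk : IsGammaStarType A B C T') :
    c ^ 2 < a ^ 2 + b ^ 2 ∧ (a ^ 2 + c ^ 2 < b ^ 2 + 2 * (√5 - 2) * (a * c) ∨
      a ^ 2 + b ^ 2 < c ^ 2 + 2 * (√5 - 2) * (a * b)) := by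
  obtain ⟨-, -, hC, R, S, hv', hRS, hang, hB', hC'⟩ := hk
  constructor
  · have h1 := EuclideanGeometry.law_cos A C B
    have h2 : 0 < Real.cos (EuclideanGeometry.angle A C B) := Real.cos_pos_of_mem_Ioo
      ⟨by linarith [EuclideanGeometry.angle_nonneg A C B, Real.pi_pos], hC⟩
    rw [h.dist_AB, h.dist_AC, h.dist_BC] at h1
    have h3 : 0 < b * a * Real.cos (EuclideanGeometry.angle A C B) :=
      mul_pos (mul_pos h.pos.2.1 h.pos.1) h2
    linarith
  have hAR := (ne_of_verts hv').1
  rw [angle_eq_gammaStar_iff hAR hRS] at hang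
  have h5 : √5 ^ 2 = 5 := Real.sq_sqrt (by norm_num)
  have h50 : 2 < √5 := by rw [Real.lt_sqrt (by norm_num)]; norm_num
  have h51 : √5 < 9 / 4 := by rw [Real.sqrt_lt' (by norm_num)]; norm_num
  have hl0 : 0 < dist A R := dist_pos.2 hAR
  have key : ∀ p q x : ℝ, 0 < p → p < q → 0 ≤ x →
      x ^ 2 = dist A R ^ 2 * (1 - 2 * (√5 - 2) * p + p ^ 2) →
      (dist A R * (q - p)) ^ 2 + x ^ 2 < dist A R ^ 2 * (1 - 2 * (√5 - 2) * q + q ^ 2) +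
        2 * (√5 - 2) * ((dist A R * (q - p)) * x) := by
    intro p q x hp hpq hx0 hx
    obtain ⟨y, hy⟩ : ∃ y, y = x / dist A R := ⟨_, rfl⟩
    have hxy : x = dist A R * y := by rw [hy]; field_simp
    have hy0 : 0 ≤ y := by rw [hy]; positivity
    have hy2 : y ^ 2 = 1 - 2 * (√5 - 2) * p + p ^ 2 := by
      have : dist A R ^ 2 ≠ 0 := by positivity
      apply mul_left_cancel₀ this
      rw [← hx, hxy]; ring
    have h1 : (√5 - 2) - p < (√5 - 2) * y := by
      rcases le_or_gt (√5 - 2) p with h | h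
      · have : 0 < y ^ 2 := by nlinarith
        have : 0 < y := by
          rcases hy0.lt_or_eq with h | h
          · exact h
          · rw [← h] at this; simp at this
        nlinarith [mul_pos (show 0 < √5 - 2 by linarith) this]
      · apply lt_of_pow_lt_pow_left₀ 2 (mul_nonneg (by linarith) hy0)
        rw [mul_pow, hy2]
        obtain ⟨κ, hκ⟩ : ∃ κ, κ = √5 - 2 := ⟨_, rfl⟩
        rw [← hκ] at h ⊢
        have h2 : 0 < p * (1 - κ ^ 2) * (2 * κ - p) := by
          apply mul_pos (mul_pos hp _) (by linarith)
          nlinarith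
        nlinarith
    have h2 : 0 < dist A R ^ 2 * (2 * (q - p) * ((√5 - 2) * y - ((√5 - 2) - p))) := by
      apply mul_pos (by positivity) (mul_pos (by linarith) (by linarith))
    rw [hx, hxy]
    linear_combination h2
  obtain ⟨⟨t, ⟨ht0, ht1⟩, htB⟩, hBR, hBS⟩ := hB'
  obtain ⟨⟨s, ⟨hs0, hs1⟩, hsC⟩, hCR, hCS⟩ := hC'
  have ht : 0 < t := by
    rcases ht0.lt_or_eq with h | rfl
    · exact h
    · simp at htB; exact absurd htB.symm hBR
  have hs : 0 < s := by
    rcases hs0.lt_or_eq with h | rfl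
    · exact h
    · simp at hsC; exact absurd hsC.symm hCR
  have hc2 : c ^ 2 = dist A R ^ 2 * (1 - 2 * (√5 - 2) * t + t ^ 2) := by
    rw [← h.dist_AB, ← htB, dist_sq_lineMap, hang, ← hRS]
    linear_combination t * dist A R ^ 2 * h5
  have hb2 : b ^ 2 = dist A R ^ 2 * (1 - 2 * (√5 - 2) * s + s ^ 2) := by
    rw [← h.dist_AC, ← hsC, dist_sq_lineMap, hang, ← hRS]
    linear_combination s * dist A R ^ 2 * h5
  have ha : a = dist A R * |t - s| := by
    rw [← h.dist_BC, ← htB, ← hsC, dist_lineMap_lineMap, ← hRS, Real.dist_eq, mul_comm]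
  rcases lt_trichotomy t s with hts | hts | hts
  · left
    rw [abs_of_neg (by linarith)] at ha
    rw [hb2, ha]
    have := key t s c ht hts h.pos.2.2.le hc2
    linear_combination this
  · rw [hts, sub_self, abs_zero, mul_zero] at ha
    exact absurd ha h.pos.1.ne'
  · right
    rw [abs_of_pos (by linarith)] at ha
    rw [hc2, ha]
    exact key s t b hs hts h.pos.2.1.le hb2

theorem le_ABpC (h : ScaleneLabelling T A B C a b c) {m : ℝ} (hm : IsMin A B C m) :
    ∃ e, 0 ≤ e ∧ m ≤ 2 * b + e ∧ a * e ^ 2 = b * (c ^ 2 - (b - a) ^ 2) := by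
  have hW := (ne_of_verts h.verts_eq).2.2.symm
  have h1 := hm.perm_right.perm_left.exists_le_apex hW
    (by rw [dist_comm C B, dist_comm C A, h.dist_BC, h.dist_AC]; exact h.lt_left.le)
  rwa [dist_comm C B, dist_comm C A, h.dist_BC, h.dist_AC, h.dist_AB] at h1

theorem le_ABCp (h : ScaleneLabelling T A B C a b c) {m : ℝ} (hm : IsMin A B C m) :
    ∃ e, 0 ≤ e ∧ m ≤ 2 * c + e ∧ b * e ^ 2 = c * (a ^ 2 - (c - b) ^ 2) := by
  have hW := (ne_of_verts h.verts_eq).2.1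
  have h1 := hm.exists_le_apex hW (by rw [h.dist_AB, h.dist_AC]; exact h.lt_right.le)
  rwa [h.dist_BC, h.dist_AC, h.dist_AB] at h1

theorem le_ABCbar (h : ScaleneLabelling T A B C a b c) {m : ℝ} (hm : IsMin A B C m) :
    ∃ l, m ≤ c + 2 * l ∧ l * (c ^ 2 + a ^ 2 - b ^ 2) = c ^ 2 * a := by
  obtain ⟨ha0, hb0, hc0⟩ := h.pos
  have hD : 0 < c ^ 2 + a ^ 2 - b ^ 2 := by
    have := h.lt_right
    nlinarith
  obtain ⟨t, ht⟩ : ∃ t, t = c ^ 2 / (c ^ 2 + a ^ 2 - b ^ 2) := ⟨_, rfl⟩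
  have ht0 : 0 < t := by rw [ht]; positivity
  have ht1 : 1 ≤ t := by
    rw [ht, le_div_iff₀ hD]
    have := h.lt_left
    nlinarith
  have htD : t * (c ^ 2 + a ^ 2 - b ^ 2) = c ^ 2 := by rw [ht]; field_simp
  obtain ⟨R, hR⟩ : ∃ R, R = AffineMap.lineMap B C t := ⟨_, rfl⟩
  have h1 : dist B R = t * a := by
    rw [hR, dist_left_lineMap, Real.norm_of_nonneg ht0.le, h.dist_BC]
  have h2 : dist A R = t * a := by
    rw [← sq_eq_sq₀ dist_nonneg (by positivity), hR, dist_sq_lineMap, h.dist_AB, h.dist_AC, h.dist_BC]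
    linear_combination -htD
  refine ⟨t * a, ?_, by linear_combination a * htD⟩
  have h3 := hm A R B (by rw [h2, dist_comm R, h1]) (InTri.left _ _ _) (InTri.right _ _ _)
    (InTri.of_wbtw_right ?_)
  · rw [h2, dist_comm R, h1, dist_comm B, h.dist_AB] at h3
    linarith
  · rw [wbtw_comm, hR]
    refine ⟨t⁻¹, ⟨by positivity, inv_le_one_of_one_le₀ ht1⟩, ?_⟩
    apply plane_ext <;> simp only [lineMap_coord] <;> field_simp <;> ring

end ScaleneLabelling

/-! ### Triangles with given sides, and uniqueness within a type -/

theorem eq_of_wbtw {O W Q Q' : Plane} (h : Wbtw ℝ O W Q) (h' : Wbtw ℝ O W Q') (hW : O ≠ W)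
    (hQ : dist O Q = dist O Q') : Q = Q' := by
  have hr := onRay_of_wbtw h hW
  have hr' := onRay_of_wbtw h' hW
  obtain ⟨t, ht, rfl⟩ := hr
  obtain ⟨s, hs, rfl⟩ := hr'
  rw [dist_left_lineMap, dist_left_lineMap, Real.norm_of_nonneg ht, Real.norm_of_nonneg hs] at hQ
  rw [mul_right_cancel₀ (dist_pos.2 hW).ne' hQ]

theorem exists_scaleneLabelling {a b c : ℝ} (ha : 0 < a) (hab : a < b) (hbc : b < c)
    (habc : c < a + b) :
    ∃ (T : Tri) (A B C : Plane), T.points = ![A, B, C] ∧ ScaleneLabelling T A B C a b c := by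
  obtain ⟨i, hi⟩ : ∃ i, i = (b ^ 2 + c ^ 2 - a ^ 2) / 2 := ⟨_, rfl⟩
  have hc : 0 < c := by linarith
  have hi0 : 0 < i := by rw [hi]; nlinarith
  have hib : i < b * c := by rw [hi]; nlinarith
  have hpos : 0 < b ^ 2 - (i / c) ^ 2 := by
    have h1 : i / c < b := by rwa [div_lt_iff₀ hc]
    have h2 : 0 ≤ i / c := by positivity
    nlinarith
  obtain ⟨y, hy⟩ : ∃ y, y = √(b ^ 2 - (i / c) ^ 2) := ⟨_, rfl⟩
  have hy0 : 0 < y := by rw [hy]; exact Real.sqrt_pos.2 hpos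
  have hy2 : y ^ 2 = b ^ 2 - (i / c) ^ 2 := by rw [hy, Real.sq_sqrt hpos.le]
  have hcr : cr !₂[0, 0] !₂[c, 0] !₂[i / c, y] ≠ 0 := by
    simp only [cr]
    simp
    exact ⟨hc.ne', hy0.ne'⟩
  obtain ⟨T, h1, h2⟩ := exists_tri hcr
  refine ⟨T, _, _, _, h1, h2, ?_, ?_, ?_, hab, hbc⟩
  · apply dist_eq_of_sq ha.le
    have : i / c * c = i := by field_simp
    simp
    linear_combination hy2 - 2 * this - 2 * hi
  · apply dist_eq_of_sq (by linarith)
    simp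
    linear_combination hy2
  · apply dist_eq_of_sq hc.le
    simp

namespace ScaleneLabelling

variable {T T' T'' : Tri} {A B C : Plane} {a b c : ℝ}

theorem verts_eq_of_special (h : ScaleneLabelling T A B C a b c) {k : Kind} (hs : k.IsSpecial)
    (hk : IsOfKind k T T') (hk' : IsOfKind k T T'') : verts T'' = verts T' := by
  obtain ⟨n1, n2, n3⟩ := ne_of_verts h.verts_eq
  rcases h.kind_cases hk with ⟨rfl, h1⟩ | ⟨rfl, h1⟩ | ⟨rfl, h1⟩ | ⟨rfl, -⟩ | ⟨rfl, -⟩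
  · have h2 : IsABpC A B C T'' := by simpa using h.kind_cases hk'
    obtain ⟨Q, e1, e2, e3⟩ := h1.wbtw h.isLabelling
    obtain ⟨Q', f1, f2, f3⟩ := h2.wbtw h.isLabelling
    rw [e1, f1, eq_of_wbtw e2 f2 n3.symm (e3.trans f3.symm)]
  · have h2 : IsABCp A B C T'' := by simpa using h.kind_cases hk'
    obtain ⟨Q, e1, e2, e3⟩ := h1.wbtw h.isLabelling
    obtain ⟨Q', f1, f2, f3⟩ := h2.wbtw h.isLabelling
    rw [e1, f1, eq_of_wbtw e2 f2 n2 (e3.trans f3.symm)]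
  · have h2 : IsABCbar A B C T'' := by simpa using h.kind_cases hk'
    obtain ⟨Q, e1, e2, e3⟩ := h1.wbtw h.isLabelling
    obtain ⟨Q', f1, f2, f3⟩ := h2.wbtw h.isLabelling
    have e4 := (base_relation e3 e2).2
    have f4 := (base_relation f3 f2).2
    have : dist B Q = dist B Q' := by
      have hc := (dist_pos.2 n1.symm).ne'
      have ha := (dist_pos.2 n3).ne'
      rw [dist_comm B Q, dist_comm B Q']
      refine mul_right_cancel₀ (b := dist B A ^ 2 + dist B C ^ 2 - dist A C ^ 2) ?_ (e4.symm.trans f4)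
      intro h0
      rw [h0, mul_zero] at e4
      exact (mul_ne_zero (pow_ne_zero 2 hc) ha) e4
    rw [e1, f1, eq_of_wbtw e2 f2 n3 this]
  · exact hs.elim
  · exact hs.elim

/-- The side lengths fix `(x - 1) ^ 3 * (x + 1)`, which is strictly increasing for `x > 1`; then `x`
fixes `S` and `R`. -/
theorem verts_eq_of_xStar (h : ScaleneLabelling T A B C a b c)
    (hk : IsOfKind .xStarType T T') (hk' : IsOfKind .xStarType T T'') : verts T'' = verts T' := by
  obtain ⟨n1, n2, n3⟩ := ne_of_verts h.verts_eq
  have h1 : IsXStarType A B C T' := by simpa using h.kind_cases hk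
  have h2 : IsXStarType A B C T'' := by simpa using h.kind_cases hk'
  obtain ⟨i, x, hi, hi0, hx1, hx2, -, -, hx, R, S, hv, hB, hS, hR⟩ := h.per_xStar h1
  obtain ⟨i', x', hi', hi0', hx1', hx2', -, -, hx', R', S', hv', hB', hS', hR'⟩ := h.per_xStar h2
  obtain rfl : i = i' := hi.trans hi'.symm
  have e1 : (x - 1) ^ 3 * (x + 1) = (x' - 1) ^ 3 * (x' + 1) :=
    mul_left_cancel₀ (by positivity) (hx.symm.trans hx')
  have mono : ∀ {p q : ℝ}, 1 < p → p < q → (p - 1) ^ 3 * (p + 1) < (q - 1) ^ 3 * (q + 1) := by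
    intro p q hp hq
    have : (p - 1) ^ 3 < (q - 1) ^ 3 := pow_lt_pow_left₀ (by linarith) (by linarith) (by norm_num)
    exact mul_lt_mul'' this (by linarith) (pow_nonneg (by linarith) 3) (by linarith)
  obtain rfl : x = x' := by
    rcases lt_trichotomy x x' with h | h | h
    · exact absurd e1 (mono hx1 h).ne
    · exact h
    · exact absurd e1 (mono hx1' h).ne'
  obtain rfl : S = S' := eq_of_wbtw hB hB' n1
    (mul_left_cancel₀ h.pos.2.2.ne' (hS.trans hS'.symm))
  rw [hv, hv', hR, hR']

end ScaleneLabelling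

/-! ### Concrete triangles for the three special types -/

/-- A scalene triangle all of whose minimum containers are of a type that determines the container
has exactly one minimum container. -/
theorem exists_unique_of_kind {T : Tri} {k : Kind} (hT : T.Scalene)
    (hk : ∀ T', IsMinContainer T T' → IsOfKind k T T')
    (hu : ∀ T' T'', IsOfKind k T T' → IsOfKind k T T'' → verts T'' = verts T') :
    ∃ T T' : Tri, T.Scalene ∧ IsMinContainer T T' ∧ IsOfKind k T T' ∧
      ∀ T'' : Tri, IsMinContainer T T'' → verts T'' = verts T' := by
  obtain ⟨T', hT'⟩ := exists_isMinContainer T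
  exact ⟨T, T', hT, hT', hk _ hT', fun T'' h => hu _ _ (hk _ hT') (hk _ h)⟩

theorem exists_ABpC : ∃ T T' : Tri, T.Scalene ∧ IsMinContainer T T' ∧ IsOfKind .ABpC T T' ∧
    ∀ T'' : Tri, IsMinContainer T T'' → verts T'' = verts T' := by
  obtain ⟨T, A, B, C, hT, h⟩ := exists_scaleneLabelling (a := 18) (b := 19) (c := 22)
    (by norm_num) (by norm_num) (by norm_num) (by norm_num)
  refine exists_unique_of_kind (h.scalene hT) (fun T' hT' => ?_)
    fun T' T'' => h.verts_eq_of_special trivial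
  obtain ⟨k, hk⟩ := hT'.exists_kind
  obtain ⟨e, he0, he1, he2⟩ := h.le_ABpC (hT'.isMin h.verts_eq)
  have he3 : e < 22.6 := by
    refine lt_of_pow_lt_pow_left₀ 2 (by norm_num) ?_
    linarith
  rcases h.kind_cases hk with ⟨rfl, -⟩ | ⟨rfl, h1⟩ | ⟨rfl, h1⟩ | ⟨rfl, h1⟩ | ⟨rfl, h1⟩
  · exact hk
  · exfalso
    obtain ⟨f, hf0, hf1, hf2⟩ := h.per_ABCp h1
    have : 17 < f := by
      refine lt_of_pow_lt_pow_left₀ 2 hf0 ?_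
      linarith
    linarith
  · exfalso
    obtain ⟨l, hl1, hl2⟩ := h.per_ABCbar h1
    linarith
  · exfalso
    obtain ⟨-, h2 | h2⟩ := h.of_gammaStar h1
    all_goals
      have h51 : √5 < 9 / 4 := by rw [Real.sqrt_lt' (by norm_num)]; norm_num
      linarith
  · exfalso
    obtain ⟨i, x, hi, -, hx1, -, -, hx, hx2, -⟩ := h.per_xStar h1
    norm_num at hi
    rw [hi] at hx hx2
    -- That `B` precedes `S` forces this bound, but then `(x - 1) ^ 3 * (x + 1)` exceeds the value
    -- required by the sides: there is no such container.
    have h3 : 37 / 20 < x := by linarith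
    have h4 : (17 / 20) ^ 3 < (x - 1) ^ 3 := pow_lt_pow_left₀ (by linarith) (by norm_num) (by norm_num)
    have h5 : (17 / 20) ^ 3 * (57 / 20) ≤ (x - 1) ^ 3 * (x + 1) := by
      apply mul_le_mul h4.le (by linarith) (by norm_num) (by positivity)
    norm_num at hx2 h5
    linarith

theorem exists_ABCp : ∃ T T' : Tri, T.Scalene ∧ IsMinContainer T T' ∧ IsOfKind .ABCp T T' ∧
    ∀ T'' : Tri, IsMinContainer T T'' → verts T'' = verts T' := by
  obtain ⟨T, A, B, C, hT, h⟩ := exists_scaleneLabelling (a := 3) (b := 4) (c := 5)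
    (by norm_num) (by norm_num) (by norm_num) (by norm_num)
  refine exists_unique_of_kind (h.scalene hT) (fun T' hT' => ?_)
    fun T' T'' => h.verts_eq_of_special trivial
  obtain ⟨k, hk⟩ := hT'.exists_kind
  obtain ⟨e, he0, he1, he2⟩ := h.le_ABCp (hT'.isMin h.verts_eq)
  have he3 : e < 3.2 := by
    refine lt_of_pow_lt_pow_left₀ 2 (by norm_num) ?_
    linarith
  rcases h.kind_cases hk with ⟨rfl, h1⟩ | ⟨rfl, -⟩ | ⟨rfl, h1⟩ | ⟨rfl, h1⟩ | ⟨rfl, h1⟩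
  · exfalso
    obtain ⟨f, hf0, hf1, hf2⟩ := h.per_ABpC h1
    have : 5.5 < f := by
      refine lt_of_pow_lt_pow_left₀ 2 hf0 ?_
      linarith
    linarith
  · exact hk
  · exfalso
    obtain ⟨l, hl1, hl2⟩ := h.per_ABCbar h1
    linarith
  · exfalso
    have := (h.of_gammaStar h1).1
    norm_num at this
  · exfalso
    obtain ⟨i, x, hi, -, hx1, -, hx, -, hx2, -⟩ := h.per_xStar h1
    norm_num at hi
    rw [hi] at hx hx2
    -- Here the perimeter decides: beyond `8 / 5` it is at least `16 * x * (x + 1) / 5 > 13.3`,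
    -- while the optimum is below `13.2`.
    have h3 : 8 / 5 < x := by
      by_contra h3
      push Not at h3
      have h4 : (x - 1) ^ 3 ≤ (3 / 5) ^ 3 := pow_le_pow_left₀ (by linarith) (by linarith) _
      have h5 : (x - 1) ^ 3 * (x + 1) ≤ (3 / 5) ^ 3 * (13 / 5) := by
        apply mul_le_mul h4 (by linarith) (by linarith) (by norm_num)
      norm_num at hx2 h5
      linarith
    nlinarith

theorem exists_ABCbar : ∃ T T' : Tri, T.Scalene ∧ IsMinContainer T T' ∧ IsOfKind .ABCbar T T' ∧
    ∀ T'' : Tri, IsMinContainer T T'' → verts T'' = verts T' := by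
  obtain ⟨T, A, B, C, hT, h⟩ := exists_scaleneLabelling (a := 6) (b := 7) (c := 10)
    (by norm_num) (by norm_num) (by norm_num) (by norm_num)
  refine exists_unique_of_kind (h.scalene hT) (fun T' hT' => ?_)
    fun T' T'' => h.verts_eq_of_special trivial
  obtain ⟨k, hk⟩ := hT'.exists_kind
  obtain ⟨l, hl1, hl2⟩ := h.le_ABCbar (hT'.isMin h.verts_eq)
  rcases h.kind_cases hk with ⟨rfl, h1⟩ | ⟨rfl, h1⟩ | ⟨rfl, -⟩ | ⟨rfl, h1⟩ | ⟨rfl, h1⟩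
  · exfalso
    obtain ⟨f, hf0, hf1, hf2⟩ := h.per_ABpC h1
    have : 10.5 < f := by
      refine lt_of_pow_lt_pow_left₀ 2 hf0 ?_
      linarith
    linarith
  · exfalso
    obtain ⟨f, hf0, hf1, hf2⟩ := h.per_ABCp h1
    have : 6 < f := by
      refine lt_of_pow_lt_pow_left₀ 2 hf0 ?_
      linarith
    linarith
  · exact hk
  · exfalso
    have := (h.of_gammaStar h1).1
    norm_num at this
  · exfalso
    obtain ⟨i, x, hi, -, hx1, -, -, hx, hx2, -⟩ := h.per_xStar h1
    norm_num at hi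
    rw [hi] at hx hx2
    have h3 : 8 / 5 < x := by linarith
    have h4 : (3 / 5) ^ 3 < (x - 1) ^ 3 := pow_lt_pow_left₀ (by linarith) (by norm_num) (by norm_num)
    have h5 : (3 / 5) ^ 3 * (13 / 5) ≤ (x - 1) ^ 3 * (x + 1) := by
      apply mul_le_mul h4.le (by linarith) (by norm_num) (by positivity)
    norm_num at hx2 h5
    linarith

/-! ### Separating similarity classes -/

/-- A similarity invariant of triangles. -/
noncomputable def shape (T : Tri) : ℝ :=
  (∑ i : Fin 3, ∑ j : Fin 3, dist (T.points i) (T.points j) ^ 4) /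
    (∑ i : Fin 3, ∑ j : Fin 3, dist (T.points i) (T.points j) ^ 2) ^ 2

theorem AreSimilar.shape_eq {T₁ T₂ : Tri} (h : AreSimilar T₁ T₂) : shape T₁ = shape T₂ := by
  obtain ⟨σ, h⟩ := h
  obtain ⟨r, hr, h⟩ := similar_iff_exists_pos_dist_eq.1 h
  have key : ∀ n : ℕ, ∑ i : Fin 3, ∑ j : Fin 3, dist (T₁.points i) (T₁.points j) ^ n =
      (r : ℝ) ^ n * ∑ i : Fin 3, ∑ j : Fin 3, dist (T₂.points i) (T₂.points j) ^ n := by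
    intro n
    rw [← Equiv.sum_comp σ (fun i : Fin 3 => ∑ j : Fin 3, dist (T₂.points i) (T₂.points j) ^ n),
      Finset.mul_sum]
    refine Finset.sum_congr rfl fun i _ => ?_
    rw [← Equiv.sum_comp σ (fun j : Fin 3 => dist (T₂.points (σ i)) (T₂.points j) ^ n),
      Finset.mul_sum]
    refine Finset.sum_congr rfl fun j _ => ?_
    rw [h, mul_pow]
    rfl
  unfold shape
  rw [key, key, mul_pow, ← pow_mul]
  have : (r : ℝ) ^ (2 * 2) ≠ 0 := pow_ne_zero _ (by exact_mod_cast hr.ne')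
  rw [mul_div_mul_left _ _ this]

theorem shape_eq {T : Tri} {A B C : Plane} (h : T.points = ![A, B, C]) : shape T =
    (dist A B ^ 4 + dist B C ^ 4 + dist A C ^ 4) /
      (2 * (dist A B ^ 2 + dist B C ^ 2 + dist A C ^ 2) ^ 2) := by
  simp only [shape, h, Fin.sum_univ_three]
  simp only [Matrix.cons_val, dist_self, dist_comm B A, dist_comm C A, dist_comm C B]
  rw [show (0 ^ 4 + dist A B ^ 4 + dist A C ^ 4 + (dist A B ^ 4 + 0 ^ 4 + dist B C ^ 4) +
    (dist A C ^ 4 + dist B C ^ 4 + 0 ^ 4)) = 2 * (dist A B ^ 4 + dist B C ^ 4 + dist A C ^ 4) by ring,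
    show (0 ^ 2 + dist A B ^ 2 + dist A C ^ 2 + (dist A B ^ 2 + 0 ^ 2 + dist B C ^ 2) +
    (dist A C ^ 2 + dist B C ^ 2 + 0 ^ 2)) ^ 2 =
      2 * (2 * (dist A B ^ 2 + dist B C ^ 2 + dist A C ^ 2) ^ 2) by ring]
  rw [mul_div_mul_left _ _ two_ne_zero]

/-- If the sum `E w` of the squared sides is `2 w² + β w + δ` and the area is proportional to `w`,
then the shape determines `w` as long as `2 w² ≠ δ`. -/
theorem eq_of_shape {β δ κ w w' s s' : ℝ} (hκ : 0 < κ) (hw : 0 < w) (hw' : 0 < w')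
    (hδ : ∀ x y : ℝ, (x = w ∨ x = w') → (y = w ∨ y = w') → 2 * x * y ≠ δ)
    (hE : 0 < 2 * w ^ 2 + β * w + δ) (hE' : 0 < 2 * w' ^ 2 + β * w' + δ)
    (hs : 2 * s = (2 * w ^ 2 + β * w + δ) ^ 2 - κ * w ^ 2)
    (hs' : 2 * s' = (2 * w' ^ 2 + β * w' + δ) ^ 2 - κ * w' ^ 2)
    (h : s / (2 * (2 * w ^ 2 + β * w + δ) ^ 2) = s' / (2 * (2 * w' ^ 2 + β * w' + δ) ^ 2)) :
    w = w' := by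
  rw [div_eq_div_iff (by positivity) (by positivity)] at h
  -- With `E` the sum and `s` the sum of squares of the squared sides, Heron's formula reads `E ^ 2
  -- - 2 * s = 16 * area ^ 2`, here `κ * w ^ 2`. Equal shapes therefore mean equal ratios of `w` to
  -- `E`.
  have h1 : κ * (w * (2 * w' ^ 2 + β * w' + δ)) ^ 2 = κ * (w' * (2 * w ^ 2 + β * w + δ)) ^ 2 := by
    linear_combination -h - (2 * w' ^ 2 + β * w' + δ) ^ 2 * (-hs) + (2 * w ^ 2 + β * w + δ) ^ 2 * (-hs')
  have h2 : w * (2 * w' ^ 2 + β * w' + δ) = w' * (2 * w ^ 2 + β * w + δ) := by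
    rw [← sq_eq_sq₀ (by positivity) (by positivity)]
    exact mul_left_cancel₀ hκ.ne' h1
  have h3 : (w' - w) * (2 * w * w' - δ) = 0 := by linear_combination h2
  rcases mul_eq_zero.1 h3 with h4 | h4
  · linarith
  · exact absurd (sub_eq_zero.1 h4) (hδ w w' (Or.inl rfl) (Or.inr rfl))

theorem exists_family {P : Tri → Prop} {p q : ℝ} (hpq : p < q) (f : ℝ → Tri)
    (hP : ∀ x ∈ Set.Ioo p q, P (f x)) (hf : Set.InjOn (fun x => shape (f x)) (Set.Ioo p q)) :
    ∃ F : Set Tri, F.Infinite ∧ (F.Pairwise fun T₁ T₂ => ¬ AreSimilar T₁ T₂) ∧ ∀ T ∈ F, P T := by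
  refine ⟨f '' Set.Ioo p q, ?_, ?_, ?_⟩
  · apply (Set.Ioo_infinite hpq).image
    intro x hx y hy hxy
    exact hf hx hy (congrArg shape hxy)
  · rintro _ ⟨x, hx, rfl⟩ _ ⟨y, hy, rfl⟩ hne hs
    exact hne (congrArg f (hf hx hy hs.shape_eq))
  · rintro _ ⟨x, hx, rfl⟩
    exact hP x hx

/-! ### One-parameter triangles whose optimum is not special -/

theorem IsMin.le_of_dist {A B C P R S : Plane} {m l s : ℝ} (hm : IsMin A B C m) (h1 : dist P R = l)
    (h2 : dist R S = l) (h3 : dist S P = s) (hA : InTri P R S A) (hB : InTri P R S B)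
    (hC : InTri P R S C) : m ≤ l + l + s := by
  have h := hm P R S (h1.trans h2.symm) hA hB hC
  rwa [h1, h2, h3] at h

set_option maxHeartbeats 1000000 in
theorem exists_xStar_triangle (x : ℝ) (hx : x ∈ Set.Ioo (159 / 100 : ℝ) (8 / 5)) :
    ∃ (T : Tri) (A B C : Plane) (a b : ℝ), T.points = ![A, B, C] ∧ ScaleneLabelling T A B C a b x ∧
      a ^ 2 = (x - 1) ^ 2 + 351 / 625 ∧ b ^ 2 = 976 / 625 ∧
      ∀ T', IsMinContainer T T' → IsOfKind .xStarType T T' := by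
  obtain ⟨hx1, hx2⟩ := hx
  -- `351 / 625 = (3 / 5) ^ 3 * (13 / 5)`, so the minimum point is `8 / 5` and the minimum `8 / 5 *
  -- 13 / 5 = 4.16`. The vertex `B = (x, 0)` lies just before it.
  obtain ⟨v, hv⟩ : ∃ v, v = √(351 / 625) := ⟨_, rfl⟩
  have hv0 : 0 < v := by rw [hv]; positivity
  have hv2 : v ^ 2 = 351 / 625 := by rw [hv]; exact Real.sq_sqrt (by norm_num)
  obtain ⟨a, ha⟩ : ∃ a, a = √((x - 1) ^ 2 + 351 / 625) := ⟨_, rfl⟩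
  obtain ⟨b, hb⟩ : ∃ b, b = √(976 / 625) := ⟨_, rfl⟩
  have ha0 : 0 ≤ a := by rw [ha]; positivity
  have hb0 : 0 ≤ b := by rw [hb]; positivity
  have ha2 : a ^ 2 = (x - 1) ^ 2 + 351 / 625 := by rw [ha]; exact Real.sq_sqrt (by positivity)
  have hb2 : b ^ 2 = 976 / 625 := by rw [hb]; exact Real.sq_sqrt (by norm_num)
  have ha3 : a < 0.96 := lt_of_pow_lt_pow_left₀ 2 (by norm_num) (by rw [ha2]; nlinarith)
  have ha4 : 0.9537 < a := lt_of_pow_lt_pow_left₀ 2 ha0 (by rw [ha2]; nlinarith)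
  have hb3 : b < 1.2497 := lt_of_pow_lt_pow_left₀ 2 (by norm_num) (by rw [hb2]; norm_num)
  have hb4 : 1.2496 < b := lt_of_pow_lt_pow_left₀ 2 hb0 (by rw [hb2]; norm_num)
  have hcr : cr !₂[0, 0] !₂[x, 0] !₂[1, v] ≠ 0 := by
    simp only [cr]
    simp
    exact ⟨by linarith, hv0.ne'⟩
  obtain ⟨T, h1, h2⟩ := exists_tri hcr
  have h : ScaleneLabelling T !₂[0, 0] !₂[x, 0] !₂[1, v] a b x := by
    refine ⟨h2, ?_, ?_, ?_, by linarith, by linarith⟩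
    · apply dist_eq_of_sq ha0
      rw [ha2]; simp; linear_combination hv2
    · apply dist_eq_of_sq hb0
      rw [hb2]; simp; linear_combination hv2
    · apply dist_eq_of_sq (by linarith)
      simp
  refine ⟨T, _, _, _, a, b, h1, h, ha2, hb2, fun T' hT' => ?_⟩
  have hm : per T' ≤ 4.16 := by
    refine ((hT'.isMin h2).le_of_dist (P := !₂[0, 0]) (R := !₂[4 / 5, 4 / 3 * v]) (S := !₂[8 / 5, 0])
      (l := 32 / 25) (s := 8 / 5) ?_ ?_ ?_ (InTri.left _ _ _) ?_ ?_).trans (by norm_num)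
    · apply dist_eq_of_sq (by norm_num)
      simp; linear_combination 16 / 9 * hv2
    · apply dist_eq_of_sq (by norm_num)
      simp; linear_combination 16 / 9 * hv2
    · apply dist_eq_of_sq (by norm_num)
      simp
    · exact ⟨1 - x / (8 / 5), 0, x / (8 / 5), by linarith, le_rfl, by linarith, by ring, by simp, by simp⟩
    · refine ⟨0, 3 / 4, 1 / 4, by norm_num, by norm_num, by norm_num, by norm_num, ?_, ?_⟩
      · simp; norm_num
      · simp; ring
  obtain ⟨k, hk⟩ := hT'.exists_kind
  rcases h.kind_cases hk with ⟨rfl, h3⟩ | ⟨rfl, h3⟩ | ⟨rfl, h3⟩ | ⟨rfl, h3⟩ | ⟨rfl, -⟩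
  · exfalso
    obtain ⟨e, he0, he1, he2⟩ := h.per_ABpC h3
    have h4 : (b - a) ^ 2 ≤ 0.0877 := by nlinarith
    have h5 : 1.2496 * 2.4403 ≤ b * (x ^ 2 - (b - a) ^ 2) := by
      apply mul_le_mul hb4.le _ (by norm_num) hb0
      nlinarith
    have h6 : 1.78 < e := by
      by_contra h6
      push Not at h6
      have : a * e ^ 2 ≤ 0.96 * 1.78 ^ 2 := by gcongr
      rw [he2] at this
      linarith
    linarith
  · exfalso
    obtain ⟨e, he0, he1, he2⟩ := h.per_ABCp h3
    have h4 : (x - b) ^ 2 ≤ 0.123 := by nlinarith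
    have h5 : 1.59 * 0.786 ≤ x * (a ^ 2 - (x - b) ^ 2) := by
      apply mul_le_mul (by linarith) _ (by norm_num) (by linarith)
      nlinarith
    have h6 : 0.98 < e := by
      by_contra h6
      push Not at h6
      have : b * e ^ 2 ≤ 1.2497 * 0.98 ^ 2 := by gcongr
      rw [he2] at this
      linarith
    linarith
  · exfalso
    obtain ⟨l, hl1, hl2⟩ := h.per_ABCbar h3
    -- This type is the same construction with base vertex at `x` instead of `8 / 5`, so strictness
    -- of the minimum excludes it however close `x` is.
    have h4 := lt_perimFun (v := v) (k := 8 / 5) (by norm_num) (by rw [hv2]; norm_num)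
      (show 1 < x by linarith) hx2.ne
    have hx3 : 0 < x - 1 := by linarith
    have h5 : √(1 + v ^ 2 / (1 - x) ^ 2) = a / (x - 1) := by
      rw [Real.sqrt_eq_iff_eq_sq (by positivity) (by positivity), div_pow, ha2, hv2,
        show (1 - x) ^ 2 = (x - 1) ^ 2 by ring]
      field_simp
    have h6 : 2 * l = x * (a / (x - 1)) := by
      rw [ha2, hb2] at hl2
      rw [mul_div_assoc', eq_div_iff hx3.ne']
      have : x ≠ 0 := by linarith
      apply mul_left_cancel₀ this
      linear_combination hl2
    rw [perimFun, h5] at h4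
    linarith
  · exfalso
    have := (h.of_gammaStar h3).1
    rw [ha2, hb2] at this
    linarith
  · exact hk

set_option maxHeartbeats 1000000 in
theorem exists_gammaStar_triangle (u : ℝ) (hu : u ∈ Set.Ioo (1 / 10 : ℝ) (21 / 200)) :
    ∃ (T : Tri) (A B C : Plane) (b : ℝ), T.points = ![A, B, C] ∧
      ScaleneLabelling T A B C (3 / 4 + u) b (5 / 4) ∧ A = !₂[0, 1] ∧ B = !₂[3 / 4, 0] ∧ C = !₂[-u, 0] ∧
      b ^ 2 = 1 + u ^ 2 ∧ ∀ T', IsMinContainer T T' → IsOfKind .gammaStarType T T' := by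
  obtain ⟨hu1, hu2⟩ := hu
  obtain ⟨b, hb⟩ : ∃ b, b = √(1 + u ^ 2) := ⟨_, rfl⟩
  have hb0 : 0 ≤ b := by rw [hb]; positivity
  have hb2 : b ^ 2 = 1 + u ^ 2 := by rw [hb]; exact Real.sq_sqrt (by positivity)
  have hu3 : u ^ 2 < 0.01103 := by nlinarith
  have hu4 : 0.01 < u ^ 2 := by nlinarith
  have hb3 : b < 1.0055 := lt_of_pow_lt_pow_left₀ 2 (by norm_num) (by rw [hb2]; linarith)
  have hb4 : 1.0049 < b := lt_of_pow_lt_pow_left₀ 2 hb0 (by rw [hb2]; linarith)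
  have hcr : cr !₂[0, 1] !₂[3 / 4, 0] !₂[-u, 0] ≠ 0 := by
    simp only [cr]
    simp
    linarith
  obtain ⟨T, h1, h2⟩ := exists_tri hcr
  have h : ScaleneLabelling T !₂[0, 1] !₂[3 / 4, 0] !₂[-u, 0] (3 / 4 + u) b (5 / 4) := by
    refine ⟨h2, ?_, ?_, ?_, by linarith, by linarith⟩
    · apply dist_eq_of_sq (by linarith)
      simp
    · apply dist_eq_of_sq hb0
      rw [hb2]; simp; ring
    · apply dist_eq_of_sq (by norm_num)
      simp; norm_num
  refine ⟨T, _, _, _, b, h1, h, rfl, rfl, rfl, hb2, fun T' hT' => ?_⟩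
  have hm : per T' ≤ 3.331 := by
    -- A rational approximation of the γ* container: `481² + 600² = 769²` makes the distance from
    -- `A` to `(481 / 600, 0)` rational, and the apex is the point of the line `BC` equidistant from
    -- these two.
    have key : ∀ y : ℝ, -128639 / 577200 ≤ y → y ≤ 481 / 600 →
        InTri !₂[0, 1] !₂[-128639 / 577200, 0] !₂[481 / 600, 0] !₂[y, 0] := by
      intro y hy1 hy2
      refine ⟨0, (481 / 600 - y) / (591361 / 577200), (y + 128639 / 577200) / (591361 / 577200),
        le_rfl, div_nonneg (by linarith) (by norm_num), div_nonneg (by linarith) (by norm_num), ?_, ?_, ?_⟩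
      · ring
      · simp; ring
      · simp
    refine ((hT'.isMin h2).le_of_dist (l := 591361 / 577200) (s := 769 / 600) ?_ ?_ ?_
      (InTri.left _ _ _) (key _ (by norm_num) (by norm_num))
      (key _ (by linarith) (by linarith))).trans (by norm_num)
    · apply dist_eq_of_sq (by norm_num)
      simp; norm_num
    · apply dist_eq_of_sq (by norm_num)
      simp; norm_num
    · apply dist_eq_of_sq (by norm_num)
      simp; norm_num
  obtain ⟨k, hk⟩ := hT'.exists_kind
  rcases h.kind_cases hk with ⟨rfl, h3⟩ | ⟨rfl, h3⟩ | ⟨rfl, h3⟩ | ⟨rfl, -⟩ | ⟨rfl, h3⟩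
  · exfalso
    obtain ⟨e, he0, he1, he2⟩ := h.per_ABpC h3
    have h4 : (b - (3 / 4 + u)) ^ 2 ≤ 0.0242 := by nlinarith
    have h5 : 1.0049 * 1.5383 ≤ b * ((5 / 4) ^ 2 - (b - (3 / 4 + u)) ^ 2) := by
      apply mul_le_mul hb4.le _ (by norm_num) hb0
      linarith
    have h6 : 1.34 < e := by
      by_contra h6
      push Not at h6
      have : (3 / 4 + u) * e ^ 2 ≤ 0.855 * 1.34 ^ 2 := by
        gcongr
        linarith
      rw [he2] at this
      linarith
    linarith
  · exfalso
    obtain ⟨e, he0, he1, he2⟩ := h.per_ABCp h3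
    have h4 : (5 / 4 - b) ^ 2 ≤ 0.0602 := by nlinarith
    have h5 : 0.66 ≤ (3 / 4 + u) ^ 2 - (5 / 4 - b) ^ 2 := by nlinarith
    have h6 : 0.9 < e := by
      by_contra h6
      push Not at h6
      have : b * e ^ 2 ≤ 1.0055 * 0.9 ^ 2 := by gcongr
      rw [he2] at this
      linarith
    linarith
  · exfalso
    obtain ⟨l, hl1, hl2⟩ := h.per_ABCbar h3
    rw [hb2] at hl2
    -- `C̄` depends only on `A`, `B` and the line `BC`, so the leg is `25 / 24` for every `u` and
    -- the perimeter `10 / 3` exceeds `3.331`.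
    have h4 : (3 / 4 + u) * (l - 25 / 24) = 0 := by linear_combination 2 / 3 * hl2
    rcases mul_eq_zero.1 h4 with h5 | h5 <;> linarith
  · exact hk
  · exfalso
    obtain ⟨i, x, hi, hi0, hx1, -, -, hx, hx2, -⟩ := h.per_xStar h3
    rw [hb2] at hi hx2
    have hi2 : i = 1 - 3 / 4 * u := by rw [hi]; ring
    have h3 : 1.689 < x := by
      by_contra h3
      push Not at h3
      have : i * x ≤ 0.925 * 1.689 := by
        apply mul_le_mul (by linarith) h3 (by linarith) (by norm_num)
      linarith
    have h4 : (0.689 : ℝ) ^ 3 < (x - 1) ^ 3 :=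
      pow_lt_pow_left₀ (by linarith) (by norm_num) (by norm_num)
    have h5 : 0.689 ^ 3 * 2.689 ≤ (x - 1) ^ 3 * (x + 1) := by
      apply mul_le_mul h4.le (by linarith) (by norm_num) (by linarith)
    have h6 : 0.848 ≤ i ^ 2 := by rw [hi2]; nlinarith
    have h7 : 0.848 * (0.689 ^ 3 * 2.689) ≤ i ^ 2 * ((x - 1) ^ 3 * (x + 1)) := by
      apply mul_le_mul h6 h5 (by norm_num) (by positivity)
    rw [← hx2] at h7
    linarith

/-- The leg containing `B` and `C` lies on the horizontal axis, so `A` and the angle determine the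
container up to reflection in the vertical axis. The position of `B` at `3 / 4` selects one of the
two. -/
theorem verts_of_gammaStar {u : ℝ} {T' : Tri} (hu : 0 < u)
    (h : IsGammaStarType !₂[0, 1] !₂[3 / 4, 0] !₂[-u, 0] T') :
    verts T' = {!₂[0, 1], !₂[-(√5 - 2) * √(1 / (1 - (√5 - 2) ^ 2)), 0],
      !₂[(3 - √5) * √(1 / (1 - (√5 - 2) ^ 2)), 0]} := by
  obtain ⟨-, -, -, R, S, hv, hRS, hang, ⟨⟨t, ⟨ht0, -⟩, hB⟩, -⟩, ⟨⟨s, ⟨hs0, -⟩, hC⟩, -⟩⟩ := h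
  rw [angle_eq_gammaStar_iff (ne_of_verts hv).1 hRS] at hang
  have h5 : √5 ^ 2 = 5 := Real.sq_sqrt (by norm_num)
  have h50 : 2 < √5 := by rw [Real.lt_sqrt (by norm_num)]; norm_num
  have h51 : √5 < 9 / 4 := by rw [Real.sqrt_lt' (by norm_num)]; norm_num
  have hB0 := congrArg (fun P : Plane => P 0) hB
  have hB1 := congrArg (fun P : Plane => P 1) hB
  have hC0 := congrArg (fun P : Plane => P 0) hC
  have hC1 := congrArg (fun P : Plane => P 1) hC
  simp only [lineMap_coord] at hB0 hB1 hC0 hC1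
  simp at hB0 hB1 hC0 hC1
  have e1 : dist !₂[0, 1] R ^ 2 = dist R S ^ 2 := by rw [hRS]
  have e2 : dist !₂[0, 1] S ^ 2 = (√5 - 1) ^ 2 * dist R S ^ 2 := by rw [hang, hRS, mul_pow]
  rw [dist_sq_coord, dist_sq_coord] at e1 e2
  simp at e1 e2
  obtain ⟨D, hD⟩ : ∃ D, D = S 0 - R 0 := ⟨_, rfl⟩
  obtain ⟨κ, hκ⟩ : ∃ κ, κ = √5 - 2 := ⟨_, rfl⟩
  have hts : t ≠ s := by
    rintro rfl
    linarith
  have hRS1 : S 1 - R 1 = 0 := by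
    have : (t - s) * (S 1 - R 1) = 0 := by linear_combination hB1 - hC1
    exact (mul_eq_zero.1 this).resolve_left (sub_ne_zero.2 hts)
  have hR1 : R 1 = 0 := by
    rw [hRS1] at hB1
    linarith
  have hS1 : S 1 = 0 := by linarith
  have hS0 : S 0 = R 0 + D := by linarith
  rw [hR1, hS1, hS0] at e1 e2
  have hD0 : D ≠ 0 := by
    rintro rfl
    nlinarith
  have hR0 : R 0 = -κ * D := by
    have : D * (R 0 + κ * D) = 0 := by
      rw [hκ]
      linear_combination e2 / 2 - e1 / 2 + D ^ 2 / 2 * h5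
    linarith [(mul_eq_zero.1 this).resolve_left hD0]
  have hκ1 : κ < 1 / 4 := by linarith
  have hκ0 : 0 < κ := by linarith
  have hκ2 : 0 < 1 - κ ^ 2 := by nlinarith
  have hD2 : D ^ 2 * (1 - κ ^ 2) = 1 := by
    rw [hR0] at e1
    linear_combination -e1
  have hD3 : 0 < D := by
    by_contra hD3
    push Not at hD3
    rw [← hD, hR0] at hB0
    have h6 : t * D ≤ 0 := mul_nonpos_of_nonneg_of_nonpos ht0 hD3
    have h7 : 3 / 4 ≤ κ * (-D) := by linarith
    have h8 : (3 / 4) ^ 2 ≤ (κ * (-D)) ^ 2 := by gcongr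
    nlinarith
  have hDs : √(1 / (1 - κ ^ 2)) = D := by
    rw [Real.sqrt_eq_iff_eq_sq (by positivity) hD3.le, div_eq_iff hκ2.ne', hD2]
  have h3 : 3 - √5 = 1 - κ := by rw [hκ]; ring
  rw [hv, ← hκ, h3, hDs]
  congr 3
  · apply plane_ext
    · simpa using hR0
    · simpa using hR1
  · apply plane_ext
    · simp; rw [hS0, hR0]; ring
    · simpa using hS1

theorem exists_gammaStarType : ∃ T T' : Tri, T.Scalene ∧ IsMinContainer T T' ∧
    IsOfKind .gammaStarType T T' ∧ ∀ T'' : Tri, IsMinContainer T T'' → verts T'' = verts T' := by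
  obtain ⟨T, A, B, C, b, hT, h, hA, hB, hC, -, hk⟩ :=
    exists_gammaStar_triangle (u := 41 / 400) (by constructor <;> norm_num)
  refine exists_unique_of_kind (h.scalene hT) hk fun T' T'' h1 h2 => ?_
  have h3 : IsGammaStarType A B C T' := by simpa using h.kind_cases h1
  have h4 : IsGammaStarType A B C T'' := by simpa using h.kind_cases h2
  subst hA hB hC
  rw [verts_of_gammaStar (by norm_num) h3, verts_of_gammaStar (by norm_num) h4]

theorem exists_xStarType : ∃ T T' : Tri, T.Scalene ∧ IsMinContainer T T' ∧
    IsOfKind .xStarType T T' ∧ ∀ T'' : Tri, IsMinContainer T T'' → verts T'' = verts T' := by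
  obtain ⟨T, A, B, C, a, b, hT, h, -, -, hk⟩ :=
    exists_xStar_triangle (x := 319 / 200) (by constructor <;> norm_num)
  exact exists_unique_of_kind (h.scalene hT) hk fun T' T'' => h.verts_eq_of_xStar

/-! ### The infinite families -/

theorem exists_gammaStar_family : ∃ F : Set Tri, F.Infinite ∧
    (F.Pairwise fun T₁ T₂ => ¬ AreSimilar T₁ T₂) ∧
    ∀ T ∈ F, ∀ T' : Tri, IsMinContainer T T' → IsOfKind .gammaStarType T T' := by
  obtain ⟨T₀, -⟩ := exists_gammaStarType
  have : Nonempty Tri := ⟨T₀⟩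
  choose! f A B C b hf using exists_gammaStar_triangle
  refine exists_family (show (1 / 10 : ℝ) < 21 / 200 by norm_num) f (fun u hu => (hf u hu).2.2.2.2.2.2) ?_
  have hs : ∀ u ∈ Set.Ioo (1 / 10 : ℝ) (21 / 200), shape (f u) =
      ((5 / 4) ^ 4 + (3 / 4 + u) ^ 4 + (1 + u ^ 2) ^ 2) /
        (2 * (2 * (3 / 4 + u) ^ 2 + (-3 / 2) * (3 / 4 + u) + 25 / 8) ^ 2) := by
    intro u hu
    obtain ⟨h1, h2, -, -, -, hb, -⟩ := hf u hu
    rw [shape_eq h1, h2.dist_AB, h2.dist_AC, h2.dist_BC, show b u ^ 4 = (b u ^ 2) ^ 2 by ring, hb]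
    congr 3
    ring
  intro u hu u' hu' huu
  simp only [hs u hu, hs u' hu'] at huu
  obtain ⟨h1, h2⟩ := hu
  obtain ⟨h3, h4⟩ := hu'
  -- The altitude from `A` is 1, so `16 * area ^ 2 = 4 * w ^ 2` with `w = 3 / 4 + u`.
  have := eq_of_shape (κ := 4) (by norm_num) (by linarith) (by linarith) ?_ (by nlinarith)
    (by nlinarith) (by ring) (by ring) huu
  · linarith
  · rintro x y (rfl | rfl) (rfl | rfl) <;> nlinarith

theorem exists_xStar_family : ∃ F : Set Tri, F.Infinite ∧
    (F.Pairwise fun T₁ T₂ => ¬ AreSimilar T₁ T₂) ∧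
    ∀ T ∈ F, ∀ T' : Tri, IsMinContainer T T' → IsOfKind .xStarType T T' := by
  obtain ⟨T₀, -⟩ := exists_xStarType
  have : Nonempty Tri := ⟨T₀⟩
  choose! f A B C a b hf using exists_xStar_triangle
  refine exists_family (show (159 / 100 : ℝ) < 8 / 5 by norm_num) f (fun x hx => (hf x hx).2.2.2.2) ?_
  have hs : ∀ x ∈ Set.Ioo (159 / 100 : ℝ) (8 / 5), shape (f x) =
      (x ^ 4 + ((x - 1) ^ 2 + 351 / 625) ^ 2 + (976 / 625) ^ 2) /
        (2 * (2 * x ^ 2 + (-2) * x + 1952 / 625) ^ 2) := by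
    intro x hx
    obtain ⟨h1, h2, ha, hb, -⟩ := hf x hx
    rw [shape_eq h1, h2.dist_AB, h2.dist_AC, h2.dist_BC, show a x ^ 4 = (a x ^ 2) ^ 2 by ring,
      show b x ^ 4 = (b x ^ 2) ^ 2 by ring, ha, hb]
    congr 3
    ring
  intro x hx x' hx' hxx
  simp only [hs x hx, hs x' hx'] at hxx
  obtain ⟨h1, h2⟩ := hx
  obtain ⟨h3, h4⟩ := hx'
  -- The altitude from `C` is `v`, so `κ = 4 * v ^ 2` with `w = x`.
  refine eq_of_shape (κ := 1404 / 625) (by norm_num) (by linarith) (by linarith) ?_ (by nlinarith)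
    (by nlinarith) (by ring) (by ring) hxx
  rintro x y (rfl | rfl) (rfl | rfl) <;> nlinarith

theorem exists_family_of_not_isSpecial {k : Kind} (hk : ¬ k.IsSpecial) : ∃ F : Set Tri, F.Infinite ∧
    (F.Pairwise fun T₁ T₂ => ¬ AreSimilar T₁ T₂) ∧
    ∀ T ∈ F, ∀ T' : Tri, IsMinContainer T T' →
      IsOfKind k T T' ∧ ¬ SharesSide T T' ∧ ¬ SharesSideAndAngle T T' := by
  have key : ∃ F : Set Tri, F.Infinite ∧ (F.Pairwise fun T₁ T₂ => ¬ AreSimilar T₁ T₂) ∧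
      ∀ T ∈ F, ∀ T' : Tri, IsMinContainer T T' → IsOfKind k T T' := by
    cases k
    · exact absurd trivial hk
    · exact absurd trivial hk
    · exact absurd trivial hk
    · exact exists_gammaStar_family
    · exact exists_xStar_family
  obtain ⟨F, h1, h2, h3⟩ := key
  refine ⟨F, h1, h2, fun T hT T' hT' => ?_⟩
  have h4 := (h3 T hT T' hT').isContainer.2.2 hk
  exact ⟨h3 T hT T' hT', h4, fun h => h4 h.sharesSide⟩

end IsoContainer

theorem theorem2 :
    -- for each of the two non-special types, an infinite family of pairwise non-similar triangles
    -- all of whose minimum perimeter isosceles containers are of that type and share no side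
    (∀ k : Kind, ¬ k.IsSpecial →
      ∃ F : Set Tri, F.Infinite ∧ (F.Pairwise fun T₁ T₂ => ¬ AreSimilar T₁ T₂) ∧
        ∀ T ∈ F, ∀ T' : Tri, IsMinContainer T T' →
          IsOfKind k T T' ∧ ¬ SharesSide T T' ∧ ¬ SharesSideAndAngle T T') ∧
    -- every triangle has a minimum perimeter isosceles container of one of the five types
    (∀ T : Tri, ∃ T' : Tri, IsMinContainer T T' ∧ ∃ k : Kind, IsOfKind k T T') ∧
    -- the five types consist of isosceles containers, and exactly the three special types
    -- share a side, and an angle at an end of that side, with the triangle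
    (∀ (k : Kind) (T T' : Tri), IsOfKind k T T' →
      IsContainer T T' ∧ (SharesSideAndAngle T T' ↔ k.IsSpecial)) ∧
    -- each of the five types is realized as the unique optimum for some scalene triangle
    (∀ k : Kind, ∃ T T' : Tri, T.Scalene ∧ IsMinContainer T T' ∧ IsOfKind k T T' ∧
      ∀ T'' : Tri, IsMinContainer T T'' → verts T'' = verts T') := by
  refine ⟨fun k hk => exists_family_of_not_isSpecial hk, fun T => ?_,
    fun k T T' h => ⟨h.isContainer.1, h.sharesSideAndAngle_iff⟩, fun k => ?_⟩
  · obtain ⟨T', hT'⟩ := exists_isMinContainer T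
    exact ⟨T', hT', hT'.exists_kind⟩
  · cases k
    · exact exists_ABpC
    · exact exists_ABCp
    · exact exists_ABCbar
    · exact exists_gammaStarType
    · exact exists_xStarType
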